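/- Let $k$ be a field, $H$ a Hopf algebra over $k$ whose antipode $S$ is bijective, and $\Delta(h)=h_1\otimes h_2$ in Sweedler notation. **Anti-Yetter-Drinfeld contramodules.** An anti-Yetter-Drinfeld contramodule is a left $H$-module $M$ with a linear map $\alpha:\mathrm{Hom}_k(H,M)\to M$ such that $\alpha(h\mapsto\varepsilon(h)m)=m$, $\;\alpha(h\mapsto\alpha(\Phi(h)))=\alpha(h\mapsto\Phi(h_1)(h_2))$ for $\Phi\in\mathrm{Hom}_k(H,\mathrm{Hom}_k(H,M))$, and $\alpha(a_2\varphi(S(a_3)\,-\,a_1))=a\,\alpha(\varphi)$. Morphisms are the $H$-linear maps that commute with the contraactions $\alpha$; the category is $\widehat{a\mathcal{YD}}$. It has the natural endomorphism $\varsigma_M(m)=\alpha(h\mapsto hm)$ of the identity functor, and $M$ is stable if $\varsigma_M=\mathrm{id}$. For an $H$-module $V$ let $Tr(V)=\mathrm{Hom}_k(H,V)$, with $(a\cdot\varphi)(h)=a_2\varphi(S(a_3)ha_1)$ and the contraaction $\Phi\mapsto(h\mapsto\Phi(h_1)(h_2))$. **Mixed objects.** A mixed anti-Yetter-Drinfeld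 contramodule is a cochain complex $(M^\bullet,d)$, indexed by $\mathbb Z$, in $\widehat{a\mathcal{YD}}$ with maps $h:M^i\to M^{i-1}$ such that $h^2=0$ and $dh+hd=1-\varsigma$; morphisms are chain maps that commute with $h$. For two of them, $\mathrm{Hom}^\bullet(X,Y)$ is the complex whose degree $n$ part consists of the families $f=(f^i:X^i\to Y^{i+n})_i$ with $h_Yf=(-1)^nfh_X$, with differential $f\mapsto d_Yf-(-1)^nfd_X$. An object is acyclic, or a morphism a quasi-isomorphism, if this is so for the underlying complexes of vector spaces, and $P$ is K-projective if $\mathrm{Hom}^\bullet(P,N)$ is acyclic for every acyclic $N$. $R\mathrm{Hom}_{\widehat{a\mathcal{YD}}^{S^1}}(X,Y)$ is $\mathrm{Hom}^\bullet(P,Y)$ for a quasi-isomorphism $P\to X$ with $P$ K-projective. A stable $M$ is regarded as a mixed object concentrated in degree $0$. **Chern character.** Let $A$ be a unital associative algebra in the monoidal category of left $H$-modules. On $X_n=Tr(A^{\otimes n+1})$ let $\tau$ be given by: if $\varphi(h)=a_0\otimes\dots\otimes a_n$ (the $a_i$ depending on $h$), then $(\tau\varphi)(h)=a_1\otimes\dots\otimes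 a_n\otimes h_2a_0$ with the $a_i$ taken at $h_1$. Let $d_i:X_n\to X_{n-1}$, $0\le i\le n-1$, be induced by multiplication of the tensor factors with indices $n-1-i$ and $n-i$ (the factors being numbered $0,\dots,n$), let $d_n=d_0\tau$, and let $s:X_n\to X_{n+1}$ be induced by $x\mapsto x\otimes 1$. Put $t=(-1)^n\tau$ and $N=\sum_{i=0}^nt^i$ on $X_n$, $b=\sum_{i=0}^{n}(-1)^id_i$, $b'=\sum_{i=0}^{n-1}(-1)^id_i$, $s'=sb's$ (with $b'$ of $X_{n+1}$ in between) and $B=(1-t)s'N$. Then $b^2=B^2=0$, $bB+Bb=1-\tau^{n+1}=1-\varsigma$ on $X_n$, and $ch(A)$ is the mixed anti-Yetter-Drinfeld contramodule $(Tr(A^{\otimes-\bullet+1}),b,B)$ with $X_n$ in degree $-n$. **Hopf-cyclic cohomology.** For a stable $M$ let $C^n=\mathrm{Hom}_H(A^{\otimes n+1},M)$, with the cyclic operators $(\tau f)(a_0,\dots,a_n)=\alpha\big(h\mapsto f(S^{-1}(h)a_n,a_0,\dots,a_{n-1})\big)$ and the cofaces $\delta_i:C^n\to C^{n+1}$, $(\delta_if)(a_0,\dots,a_{n+1})=f(a_0,\dots,a_ia_{i+1},\dots,a_{n+1})$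 for $0\le i\le n$, and $\delta_{n+1}=\tau\delta_0$. Put $t=(-1)^n\tau$, $N=\sum_{i=0}^nt^i$, $b=\sum_{i=0}^{n+1}(-1)^i\delta_i$, $b'=\sum_{i=0}^{n}(-1)^i\delta_i$. $HC^{old,n}(A,M)$, $n\in\mathbb Z$, is the $n$-th cohomology of the total complex of the bicomplex with $C^{q}$ in bidegree $(p,q)$, $p,q\ge0$, with vertical differentials $b$ for even $p$ and $-b'$ for odd $p$, and horizontal differentials $C^{p,q}\to C^{p+1,q}$ equal to $1-t$ for even $p$ and to $N$ for odd $p$. **Theorem.** Suppose that $A$ is projective as an $H$-module and that $M$ is a stable anti-Yetter-Drinfeld contramodule. Then there is a quasi-isomorphism $P\to ch(A)$ of mixed anti-Yetter-Drinfeld contramodules with $P$ K-projective, and for every such $P$ and every $n\in\mathbb Z$ there is an isomorphism of $k$-vector spaces $$HC^{old,n}(A,M)\;\simeq\;H^n\big(\mathrm{Hom}^\bullet(P,M)\big)=H^n\big(R\mathrm{Hom}_{\widehat{a\mathcal{YD}}^{S^1}}(ch(A),M)\big).$$ -/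

import Mathlib

open CategoryTheory TensorProduct Coalgebra

universe u

namespace HopfCyclic

theorem sum_alternating {G : Type*} [AddCommGroup G] (m : ℕ) (f : ℕ → ℕ → G)
    (hf : ∀ i j, i < j → j ≤ m → f j i = f i (j - 1)) :
    ∑ j ∈ Finset.range (m + 1), ∑ i ∈ Finset.range m, (-1 : ℤ) ^ (i + j) • f j i = 0 := by
  rw [← Finset.sum_product']
  refine Finset.sum_involution
    (fun p _ => if p.2 < p.1 then (p.2, p.1 - 1) else (p.2 + 1, p.1)) ?_ ?_ ?_ ?_
  · rintro ⟨j, i⟩ hp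
    simp only [Finset.mem_product, Finset.mem_range] at hp
    dsimp only
    split_ifs with h
    · rw [hf i j h (by omega)]
      obtain ⟨j, rfl⟩ : ∃ l, j = l + 1 := ⟨j - 1, by omega⟩
      simp only [Nat.add_sub_cancel]
      rw [← add_smul, show i + (j + 1) = (j + i) + 1 by ring, pow_succ]
      simp
    · rw [hf j (i + 1) (by omega) (by omega)]
      simp only [Nat.add_sub_cancel]
      rw [← add_smul, show j + (i + 1) = (i + j) + 1 by ring, pow_succ]
      simp
  · rintro ⟨j, i⟩ hp _
    dsimp only
    split_ifs with h
    · intro e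
      simp only [Prod.mk.injEq] at e
      omega
    · intro e
      simp only [Prod.mk.injEq] at e
      omega
  · rintro ⟨j, i⟩ hp
    simp only [Finset.mem_product, Finset.mem_range] at hp ⊢
    split_ifs with h
    · dsimp only; omega
    · dsimp only; omega
  · rintro ⟨j, i⟩ hp
    by_cases h : i < j
    · rw [if_pos h]
      dsimp only
      rw [if_neg (by omega)]
      simp only [Prod.mk.injEq, and_true]
      omega
    · rw [if_neg h]
      rw [if_pos (by omega)]
      simp

/-- The powers of an endomorphism. -/
def iter {C : Type*} [Category* C] {X : C} (f : X ⟶ X) (j : ℕ) : X ⟶ X := (show End X from f) ^ j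

theorem iter_zero {C : Type*} [Category* C] {X : C} (f : X ⟶ X) : iter f 0 = 𝟙 X := rfl

theorem iter_succ {C : Type*} [Category* C] {X : C} (f : X ⟶ X) (j : ℕ) :
    iter f (j + 1) = iter f j ≫ f := pow_succ' (show End X from f) j

/-- The part of a paracyclic object that is used in the construction of `b` and `B`: the faces
`d n i : X (n + 1) ⟶ X n` for `i ≤ n` (the last face `d n (n + 1)` is `τ ≫ d n 0`), the cyclic
generators `τ n`, and the extra degeneracies `s n`. -/
structure Paracyclic (C : Type*) [Category* C] where
  X : ℕ → C
  d (n i : ℕ) : X (n + 1) ⟶ X n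
  τ (n : ℕ) : X n ⟶ X n
  s (n : ℕ) : X n ⟶ X (n + 1)
  d_comp_d (n i j : ℕ) : i < j → j ≤ n + 1 → d (n + 1) j ≫ d n i = d (n + 1) i ≫ d n (j - 1)
  τ_comp_d (n i : ℕ) : i < n → τ (n + 1) ≫ d n (i + 1) = d n i ≫ τ n
  τ_comp_τ_comp_d (n : ℕ) : τ (n + 1) ≫ τ (n + 1) ≫ d n 0 = d n n ≫ τ n
  s_comp_d (n : ℕ) : s n ≫ d n 0 = 𝟙 _
  s_comp_d_succ (n i : ℕ) : i ≤ n → s (n + 1) ≫ d (n + 1) (i + 1) = d n i ≫ s n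

namespace Paracyclic

variable {C : Type*} [Category* C] (P : Paracyclic C)

/-- All the faces. -/
def face (n i : ℕ) : P.X (n + 1) ⟶ P.X n := if i ≤ n then P.d n i else P.τ (n + 1) ≫ P.d n 0

theorem face_of_le {n i : ℕ} (h : i ≤ n) : P.face n i = P.d n i := if_pos h

theorem face_last (n : ℕ) : P.face n (n + 1) = P.τ (n + 1) ≫ P.d n 0 := if_neg (by omega)

theorem τ_comp_face (n i : ℕ) (h : i ≤ n) :
    P.τ (n + 1) ≫ P.face n (i + 1) = P.face n i ≫ P.τ n := by
  rcases h.lt_or_eq with h | rfl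
  · rw [P.face_of_le h, P.face_of_le h.le, P.τ_comp_d n i h]
  · rw [P.face_last, P.face_of_le le_rfl, P.τ_comp_τ_comp_d]

theorem τ_comp_face_zero (n : ℕ) : P.τ (n + 1) ≫ P.face n 0 = P.face n (n + 1) := by
  rw [P.face_last, P.face_of_le (Nat.zero_le n)]

theorem face_comp_face (n i j : ℕ) (hij : i < j) (hj : j ≤ n + 2) :
    P.face (n + 1) j ≫ P.face n i = P.face (n + 1) i ≫ P.face n (j - 1) := by
  rcases hj.lt_or_eq with hj | rfl
  · rw [P.face_of_le (by omega), P.face_of_le (by omega), P.face_of_le (by omega),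
      P.face_of_le (by omega), P.d_comp_d n i j hij (by omega)]
  · rw [show n + 2 - 1 = n + 1 from rfl, ← τ_comp_face_zero, ← τ_comp_face_zero, Category.assoc]
    rcases Nat.lt_or_ge n i with hi | hi
    · obtain rfl : i = n + 1 := by omega
      rw [← τ_comp_face_zero, ← Category.assoc (P.face (n + 1) 0), ← τ_comp_face _ _ _ (by omega),
        ← Category.assoc (P.face (n + 1) (n + 1)), ← τ_comp_face _ _ _ le_rfl,
        ← τ_comp_face_zero]
      simp only [Category.assoc]
      rw [P.face_of_le (i := 0 + 1) (by omega), P.face_of_le (i := 0) (by omega),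
        P.face_of_le (i := 0) (by omega), P.d_comp_d n 0 1 (by omega) (by omega)]
    · rw [← Category.assoc (P.face (n + 1) i), ← τ_comp_face _ _ _ (by omega), Category.assoc,
        P.face_of_le (n := n + 1) (i := i + 1) (by omega), P.face_of_le (i := 0) (by omega),
        P.face_of_le (i := 0) (by omega), P.face_of_le (i := i) hi,
        P.d_comp_d n 0 (i + 1) (by omega) (by omega)]
      rfl

variable [Preadditive C]

/-- The signed cyclic generator `t = (-1) ^ n τ`. -/
def t (n : ℕ) : P.X n ⟶ P.X n := (-1 : ℤ) ^ n • P.τ n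

/-- The norm `N = 1 + t + ⋯ + t ^ n`. -/
def N (n : ℕ) : P.X n ⟶ P.X n := ∑ i ∈ Finset.range (n + 1), iter (P.t n) i

/-- The Hochschild differential. -/
def b (n : ℕ) : P.X (n + 1) ⟶ P.X n := ∑ i ∈ Finset.range (n + 2), (-1 : ℤ) ^ i • P.face n i

/-- The differential without the last face. -/
def b' (n : ℕ) : P.X (n + 1) ⟶ P.X n := ∑ i ∈ Finset.range (n + 1), (-1 : ℤ) ^ i • P.face n i

/-- The contracting homotopy `s b' s` of `b'`; it is `s` modulo degenerate elements, and unlike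
`s` it squares to zero. -/
def s' (n : ℕ) : P.X n ⟶ P.X (n + 1) := P.s n ≫ P.b' n ≫ P.s n

/-- The operator `B = (1 - t) s' N`. -/
def B (n : ℕ) : P.X n ⟶ P.X (n + 1) := P.N n ≫ P.s' n ≫ (𝟙 _ - P.t (n + 1))

theorem b'_comp_b' (n : ℕ) : P.b' (n + 1) ≫ P.b' n = 0 := by
  have := sum_alternating (n + 1) (fun j i => P.face (n + 1) j ≫ P.face n i)
    (fun i j hij hj => P.face_comp_face n i j hij (by omega))
  rw [← this]
  simp only [b', Preadditive.sum_comp, Preadditive.comp_sum, Preadditive.zsmul_comp,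
    Preadditive.comp_zsmul, smul_smul, pow_add, Finset.smul_sum]
  rw [Finset.sum_comm]

theorem b_comp_b (n : ℕ) : P.b (n + 1) ≫ P.b n = 0 := by
  have := sum_alternating (n + 2) (fun j i => P.face (n + 1) j ≫ P.face n i)
    (fun i j hij hj => P.face_comp_face n i j hij hj)
  rw [← this]
  simp only [b, Preadditive.sum_comp, Preadditive.comp_sum, Preadditive.zsmul_comp,
    Preadditive.comp_zsmul, smul_smul, pow_add, Finset.smul_sum]
  rw [Finset.sum_comm]

/-- The signed faces. -/
def c (n i : ℕ) : P.X (n + 1) ⟶ P.X n := (-1 : ℤ) ^ i • P.face n i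

theorem t_comp_c (n i : ℕ) (h : i ≤ n) : P.t (n + 1) ≫ P.c n (i + 1) = P.c n i ≫ P.t n := by
  simp only [t, c, Preadditive.zsmul_comp, Preadditive.comp_zsmul, smul_smul, P.τ_comp_face n i h]
  congr 1
  simp only [pow_succ]
  ring

theorem t_comp_c_zero (n : ℕ) : P.t (n + 1) ≫ P.c n 0 = P.c n (n + 1) := by
  simp only [t, c, Preadditive.zsmul_comp, Preadditive.comp_zsmul, smul_smul, P.τ_comp_face_zero n,
    pow_zero, one_mul]

theorem b_eq (n : ℕ) : P.b n = P.b' n + P.c n (n + 1) := Finset.sum_range_succ _ _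

theorem t_comp_sum (n m : ℕ) (h : m ≤ n + 1) :
    P.t (n + 1) ≫ (∑ i ∈ Finset.range (m + 1), P.c n i) =
      P.c n (n + 1) + (∑ i ∈ Finset.range m, P.c n i) ≫ P.t n := by
  rw [Finset.sum_range_succ', Preadditive.comp_add, t_comp_c_zero, add_comm (P.t _ ≫ _)]
  congr 1
  rw [Preadditive.comp_sum, Preadditive.sum_comp]
  exact Finset.sum_congr rfl fun i hi => P.t_comp_c n i (by
    have := Finset.mem_range.1 hi; omega)

theorem t_comp_b (n : ℕ) : P.t (n + 1) ≫ P.b n = P.c n (n + 1) + P.b' n ≫ P.t n :=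
  P.t_comp_sum n (n + 1) le_rfl

theorem one_sub_t_comp_b (n : ℕ) :
    (𝟙 _ - P.t (n + 1)) ≫ P.b n = P.b' n ≫ (𝟙 _ - P.t n) := by
  rw [Preadditive.sub_comp, t_comp_b, Preadditive.comp_sub, Category.id_comp, Category.comp_id, b_eq]
  abel

theorem b_comp_t_pow (n : ℕ) : ∀ m ≤ n + 1,
    P.b n ≫ iter (P.t n) m + iter (P.t (n + 1)) m ≫ (∑ i ∈ Finset.range m, P.c n i) =
      iter (P.t (n + 1)) m ≫ P.b n + iter (P.t (n + 1)) m ≫ (∑ i ∈ Finset.range m, P.c n i) ≫ P.t n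
  | 0, _ => by
    simp [iter_zero]
  | m + 1, h => by
    have ih := b_comp_t_pow n m (by omega)
    have ih' := congrArg (· ≫ P.t n) ih
    simp only [Preadditive.add_comp, Category.assoc] at ih'
    have e1 : iter (P.t n) (m + 1) = iter (P.t n) m ≫ P.t n := iter_succ _ _
    have e2 : iter (P.t (n + 1)) (m + 1) = iter (P.t (n + 1)) m ≫ P.t (n + 1) := iter_succ _ _
    have e3 := P.t_comp_sum n m (by omega)
    have e4 := P.t_comp_b n
    rw [e1, e2]
    simp only [Category.assoc]
    rw [e4, ← Category.assoc (P.t (n + 1)) _ (P.t n), e3]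
    have e5 : P.b' n = P.b n - P.c n (n + 1) := by rw [b_eq]; abel
    rw [e5]
    simp only [Preadditive.add_comp, Preadditive.comp_add, Preadditive.sub_comp,
      Preadditive.comp_sub, Category.assoc]
    rw [eq_sub_of_add_eq ih']
    abel

theorem N_comp_b'_aux (n : ℕ) : ∀ m ≤ n + 1,
    P.b n ≫ (∑ j ∈ Finset.range m, iter (P.t n) j) =
      (∑ j ∈ Finset.range m, iter (P.t (n + 1)) j) ≫ P.b' n +
        iter (P.t (n + 1)) m ≫ (∑ i ∈ Finset.range m, P.c n i)
  | 0, _ => by simp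
  | m + 1, h => by
    have e2 : iter (P.t (n + 1)) (m + 1) = iter (P.t (n + 1)) m ≫ P.t (n + 1) := iter_succ _ _
    rw [Finset.sum_range_succ, Finset.sum_range_succ, Preadditive.comp_add, Preadditive.add_comp,
      N_comp_b'_aux n m (by omega), e2, Category.assoc, P.t_comp_sum n m (by omega)]
    have := P.b_comp_t_pow n m (by omega)
    rw [P.b_eq] at this ⊢
    simp only [Preadditive.add_comp, Preadditive.comp_add] at this ⊢
    rw [add_assoc, add_comm (iter (P.t (n + 1)) m ≫ _), this]
    abel

theorem N_comp_b' (n : ℕ) : P.N (n + 1) ≫ P.b' n = P.b n ≫ P.N n := by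
  rw [N, N, N_comp_b'_aux _ _ _ le_rfl, Finset.sum_range_succ, Preadditive.add_comp]
  rfl

theorem s_comp_b'_zero : P.s 0 ≫ P.b' 0 = 𝟙 _ := by
  simp [b', P.face_of_le, P.s_comp_d]

theorem s_comp_b'_succ (n : ℕ) : P.s (n + 1) ≫ P.b' (n + 1) = 𝟙 _ - P.b' n ≫ P.s n := by
  rw [b', Finset.sum_range_succ', Preadditive.comp_add, P.face_of_le (Nat.zero_le _), pow_zero,
    one_smul, P.s_comp_d, add_comm (P.s _ ≫ _), sub_eq_add_neg]
  congr 1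
  rw [b', Preadditive.comp_sum, Preadditive.sum_comp, ← Finset.sum_neg_distrib]
  refine Finset.sum_congr rfl fun i hi => ?_
  have := Finset.mem_range.1 hi
  rw [P.face_of_le (by omega), P.face_of_le (by omega), Preadditive.comp_zsmul,
    Preadditive.zsmul_comp, P.s_comp_d_succ n i (by omega), pow_succ]
  simp

theorem b'_comp_s (n : ℕ) : P.b' n ≫ P.s n = 𝟙 _ - P.s (n + 1) ≫ P.b' (n + 1) := by
  rw [s_comp_b'_succ]; abel

theorem sb'_idem (n : ℕ) : (P.s (n + 1) ≫ P.b' (n + 1)) ≫ P.s (n + 1) ≫ P.b' (n + 1) =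
    P.s (n + 1) ≫ P.b' (n + 1) := by
  rw [Category.assoc, ← Category.assoc (P.b' (n + 1)), P.b'_comp_s (n + 1), Preadditive.sub_comp,
    Category.id_comp, Category.assoc, P.b'_comp_b', Limits.comp_zero, sub_zero]

theorem s'_comp_s' (n : ℕ) : P.s' n ≫ P.s' (n + 1) = 0 := by
  have e : (P.b' n ≫ P.s n) ≫ P.s (n + 1) ≫ P.b' (n + 1) = 0 := by
    rw [b'_comp_s, Preadditive.sub_comp, Category.id_comp, sb'_idem, sub_self]
  have : P.s' n ≫ P.s' (n + 1) =
      P.s n ≫ ((P.b' n ≫ P.s n) ≫ P.s (n + 1) ≫ P.b' (n + 1)) ≫ P.s (n + 1) := by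
    simp only [s', Category.assoc]
  rw [this, e, Limits.zero_comp, Limits.comp_zero]

theorem s'_comp_b'_zero : P.s' 0 ≫ P.b' 0 = 𝟙 _ := by
  rw [s', Category.assoc, Category.assoc, P.s_comp_b'_zero, Category.comp_id, P.s_comp_b'_zero]

theorem b's'_add_s'b' (n : ℕ) : P.b' n ≫ P.s' n + P.s' (n + 1) ≫ P.b' (n + 1) = 𝟙 _ := by
  have e1 : P.b' n ≫ P.s' n = (P.b' n ≫ P.s n) ≫ (P.b' n ≫ P.s n) := by
    simp only [s', Category.assoc]
  have e2 : P.s' (n + 1) ≫ P.b' (n + 1) =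
      (P.s (n + 1) ≫ P.b' (n + 1)) ≫ P.s (n + 1) ≫ P.b' (n + 1) := by
    simp only [s', Category.assoc]
  rw [e1, e2, sb'_idem, b'_comp_s, Preadditive.sub_comp, Preadditive.comp_sub, Preadditive.comp_sub,
    sb'_idem, Category.id_comp, Category.id_comp, Category.comp_id]
  abel

theorem t_pow (n : ℕ) : iter (P.t n) (n + 1) = iter (P.τ n) (n + 1) := by
  refine (smul_pow ((-1 : ℤ) ^ n) (show End (P.X n) from P.τ n) (n + 1)).trans ?_
  rw [← pow_mul, Even.neg_one_pow (Nat.even_mul_succ_self n), one_smul]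
  rfl

theorem N_comp_one_sub_t (n : ℕ) : P.N n ≫ (𝟙 _ - P.t n) = 𝟙 _ - iter (P.τ n) (n + 1) := by
  rw [← t_pow]
  exact mul_neg_geom_sum (show End (P.X n) from P.t n) (n + 1)

theorem one_sub_t_comp_N (n : ℕ) : (𝟙 _ - P.t n) ≫ P.N n = 𝟙 _ - iter (P.τ n) (n + 1) := by
  rw [← t_pow]
  exact geom_sum_mul_neg (show End (P.X n) from P.t n) (n + 1)

theorem B_comp_b_zero : P.B 0 ≫ P.b 0 = 𝟙 _ - iter (P.τ 0) 1 := by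
  rw [B, Category.assoc, Category.assoc, one_sub_t_comp_b, ← Category.assoc (P.s' 0),
    s'_comp_b'_zero, Category.id_comp, N_comp_one_sub_t]

theorem b_comp_B_add (n : ℕ) :
    P.b n ≫ P.B n + P.B (n + 1) ≫ P.b (n + 1) = 𝟙 _ - iter (P.τ (n + 1)) (n + 2) := by
  have e1 : P.b n ≫ P.B n = P.N (n + 1) ≫ (P.b' n ≫ P.s' n) ≫ (𝟙 _ - P.t (n + 1)) := by
    rw [B, ← Category.assoc, ← N_comp_b']
    simp only [Category.assoc]
  have e2 : P.B (n + 1) ≫ P.b (n + 1) =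
      P.N (n + 1) ≫ (P.s' (n + 1) ≫ P.b' (n + 1)) ≫ (𝟙 _ - P.t (n + 1)) := by
    rw [B, Category.assoc, Category.assoc, one_sub_t_comp_b]
    simp only [Category.assoc]
  rw [e1, e2, ← Preadditive.comp_add, ← Preadditive.add_comp, b's'_add_s'b', Category.id_comp,
    N_comp_one_sub_t]

theorem B_comp_B (h : ∀ n (f : P.X n ⟶ P.X (n + 1)),
    f ≫ iter (P.τ (n + 1)) (n + 2) = iter (P.τ n) (n + 1) ≫ f) (n : ℕ) : P.B n ≫ P.B (n + 1) = 0 := by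
  have e : P.B n ≫ P.B (n + 1) = P.N n ≫ (P.s' n ≫ ((𝟙 _ - P.t (n + 1)) ≫ P.N (n + 1))) ≫
      P.s' (n + 1) ≫ (𝟙 _ - P.t (n + 2)) := by
    simp only [B, Category.assoc]
  have e' : P.s' n ≫ (𝟙 _ - iter (P.τ (n + 1)) (n + 2)) = (𝟙 _ - iter (P.τ n) (n + 1)) ≫ P.s' n := by
    rw [Preadditive.comp_sub, Preadditive.sub_comp, h, Category.comp_id, Category.id_comp]
  rw [e, one_sub_t_comp_N, e', Category.assoc, ← Category.assoc (P.s' n), s'_comp_s',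
    Limits.zero_comp, Limits.comp_zero, Limits.comp_zero]

end Paracyclic

section Sweedler

open Coalgebra HopfAlgebra

variable {k H X : Type*} [Field k] [Ring H] [HopfAlgebra k H] [AddCommGroup X] [Module k X]

/-- `sw k f a = ∑ f a₁ a₂` in Sweedler notation. -/
noncomputable def sw (k : Type*) {H X : Type*} [Field k] [Ring H] [HopfAlgebra k H]
    [AddCommGroup X] (f : H → H → X) (a : H) : X :=
  ∑ i ∈ (ℛ k a).index, f ((ℛ k a).left i) ((ℛ k a).right i)

theorem lift_comul (f : H →ₗ[k] H →ₗ[k] X) (a : H) :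
    TensorProduct.lift f (comul (R := k) a) = sw k (fun x y => f x y) a := by
  conv_lhs => rw [← (ℛ k a).eq]
  simp [sw]

theorem sw_eq {f : H → H → X} (h₁ : ∀ y, IsLinearMap k (f · y)) (h₂ : ∀ x, IsLinearMap k (f x))
    (a : H) : sw k f a = TensorProduct.lift (LinearMap.mk₂ k f (fun _ _ y => (h₁ y).map_add _ _)
      (fun _ _ y => (h₁ y).map_smul _ _) (fun x => (h₂ x).map_add)
      (fun c x y => (h₂ x).map_smul c y)) (comul (R := k) a) := by
  rw [lift_comul]; rfl

theorem sw_isLinear {f : H → H → X} (h₁ : ∀ y, IsLinearMap k (f · y))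
    (h₂ : ∀ x, IsLinearMap k (f x)) : IsLinearMap k (sw k f) := by
  constructor <;> intros <;> simp [sw_eq h₁ h₂]

theorem sw_add {X : Type*} [AddCommGroup X] (f g : H → H → X) (a : H) :
    sw k (fun x y => f x y + g x y) a = sw k f a + sw k g a := by
  simp [sw, Finset.sum_add_distrib]

theorem sw_smul (c : k) (f : H → H → X) (a : H) :
    sw k (fun x y => c • f x y) a = c • sw k f a := by
  simp [sw, Finset.smul_sum]

theorem map_sw {Y : Type*} [AddCommGroup Y] [Module k Y] (g : X →ₗ[k] Y) (f : H → H → X) (a : H) :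
    g (sw k f a) = sw k (fun x y => g (f x y)) a := by
  simp [sw]

theorem sw_assoc (f : H → H → H → X) (h₁ : ∀ y z, IsLinearMap k (f · y z))
    (h₂ : ∀ x z, IsLinearMap k (f x · z)) (h₃ : ∀ x y, IsLinearMap k (f x y)) (a : H) :
    sw k (fun p z => sw k (fun x y => f x y z) p) a =
      sw k (fun x q => sw k (fun y z => f x y z) q) a := by
  let g : H →ₗ[k] H →ₗ[k] H →ₗ[k] X :=
    { toFun := fun x => LinearMap.mk₂ k (f x) (fun _ _ z => (h₂ x z).map_add _ _)
        (fun _ _ z => (h₂ x z).map_smul _ _) (fun y => (h₃ x y).map_add)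
        (fun c y z => (h₃ x y).map_smul c z)
      map_add' := fun x x' => by ext y z; exact (h₁ y z).map_add _ _
      map_smul' := fun c x => by ext y z; exact (h₁ y z).map_smul _ _ }
  have := congrArg (TensorProduct.lift
    ((TensorProduct.lift.equiv (.id k) H H X).toLinearMap ∘ₗ g))
    (sum_tmul_tmul_eq (ℛ k a) (fun i => ℛ k ((ℛ k a).left i)) (fun i => ℛ k ((ℛ k a).right i)))
  simpa [g, sw] using this

theorem sw_counit_left (f : H → X) (h : IsLinearMap k f) (a : H) :
    sw k (fun x y => counit (R := k) x • f y) a = f a := by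
  have := congrArg (h.mk' f) (sum_counit_smul (ℛ k a))
  simpa [sw] using this

theorem sw_counit_right (f : H → X) (h : IsLinearMap k f) (a : H) :
    sw k (fun x y => counit (R := k) y • f x) a = f a := by
  have := congrArg (TensorProduct.lift ((LinearMap.lsmul k X).flip ∘ₗ (h.mk' f)))
    (sum_tmul_counit_eq (ℛ k a))
  simpa only [sw, map_sum, lift.tmul, LinearMap.comp_apply, LinearMap.flip_apply,
    LinearMap.lsmul_apply, IsLinearMap.mk'_apply, one_smul] using this

theorem sw_antipode_mul (f : H → X) (h : IsLinearMap k f) (a : H) :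
    sw k (fun x y => f (antipode k x * y)) a = counit (R := k) a • f 1 := by
  have := congrArg (h.mk' f) (sum_antipode_mul_eq_smul (ℛ k a))
  simpa [sw] using this

theorem sw_mul_antipode (f : H → X) (h : IsLinearMap k f) (a : H) :
    sw k (fun x y => f (x * antipode k y)) a = counit (R := k) a • f 1 := by
  have := congrArg (h.mk' f) (sum_mul_antipode_eq_smul (ℛ k a))
  simpa [sw] using this

theorem sw_comm {X : Type*} [AddCommGroup X] (f : H → H → H → H → X) (a b : H) :
    sw k (fun x y => sw k (fun u v => f x y u v) b) a =
      sw k (fun u v => sw k (fun x y => f x y u v) a) b := by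
  simp only [sw]
  exact Finset.sum_comm

theorem sw_mul (f : H → H → X) (h₁ : ∀ y, IsLinearMap k (f · y)) (h₂ : ∀ x, IsLinearMap k (f x))
    (a b : H) :
    sw k f (a * b) = sw k (fun x y => sw k (fun x' y' => f (x * x') (y * y')) b) a := by
  rw [sw_eq h₁ h₂, Bialgebra.comul_mul]
  conv_lhs => rw [← (ℛ k a).eq, ← (ℛ k b).eq]
  simp [sw, Finset.sum_mul_sum]

theorem comul_antipode (a : H) : comul (R := k) (antipode k a) =
    sw k (fun x y => antipode k y ⊗ₜ[k] antipode k x) a := by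
  let g : H →ₗ[k] H ⊗[k] H := TensorProduct.map (antipode k) (antipode k) ∘ₗ
    (TensorProduct.comm k H H).toLinearMap ∘ₗ comul
  have hg : ∀ c, g c = sw k (fun x y => antipode k y ⊗ₜ[k] antipode k x) c := fun c => by
    simp only [g, LinearMap.comp_apply]
    conv_lhs => rw [← (ℛ k c).eq]
    simp [sw]
  have hl : ∀ c : H, comul (R := k) c = sw k (fun x y => x ⊗ₜ[k] y) c := fun c => by
    rw [sw]; exact (ℛ k c).eq.symm
  have key : WithConv.toConv g * WithConv.toConv (comul (R := k) (A := H)) = 1 := by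
    ext c
    rw [(ℛ k c).convMul_apply]
    change sw k (fun x q => g x * comul (R := k) q) c = algebraMap k (H ⊗[k] H) (counit c)
    have e1 : sw k (fun x q => g x * comul (R := k) q) c =
        sw k (fun p q => sw k (fun u v =>
          sw k (fun y z => (antipode k v * y) ⊗ₜ[k] (antipode k u * z)) q) p) c := by
      congr 1; ext p q
      rw [hg, hl]
      simp [sw, Finset.sum_mul_sum]
    rw [e1, sw_assoc]
    rotate_left
    · intros; constructor <;> intros <;> simp [sw, add_mul, tmul_add, Finset.sum_add_distrib, Finset.smul_sum]
    · intros; constructor <;> intros <;> simp [sw, add_mul, add_tmul, Finset.sum_add_distrib, Finset.smul_sum, smul_tmul']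
    · intros; apply sw_isLinear
      · intros; constructor <;> intros <;> simp [mul_add, add_tmul, smul_tmul']
      · intros; constructor <;> intros <;> simp [mul_add, tmul_add]
    have e2 : ∀ u q : H, sw k (fun v w => sw k (fun y z =>
        (antipode k v * y) ⊗ₜ[k] (antipode k u * z)) w) q = 1 ⊗ₜ[k] (antipode k u * q) := by
      intro u q
      rw [← sw_assoc (fun v y z => (antipode k v * y) ⊗ₜ[k] (antipode k u * z))]
      · have e3 : ∀ p z : H, sw k (fun v y => (antipode k v * y) ⊗ₜ[k] (antipode k u * z)) p =
            counit (R := k) p • ((1 : H) ⊗ₜ[k] (antipode k u * z)) := fun p z =>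
          sw_antipode_mul (fun t => t ⊗ₜ[k] (antipode k u * z))
            (by constructor <;> intros <;> simp [add_tmul, smul_tmul']) p
        simp only [e3]
        exact sw_counit_left (fun z => (1 : H) ⊗ₜ[k] (antipode k u * z))
            (by constructor <;> intros <;> simp [mul_add, tmul_add]) q
      all_goals intros; constructor <;> intros <;>
        simp [mul_add, add_mul, tmul_add, add_tmul, smul_tmul']
    simp only [e2]
    rw [sw_antipode_mul (fun t => (1 : H) ⊗ₜ[k] t)
      (by constructor <;> intros <;> simp [tmul_add])]
    simp [Algebra.algebraMap_eq_smul_one, Algebra.TensorProduct.one_def]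
  have := left_inv_eq_right_inv key (LinearMap.comul_right_inv (R := k) (C := H))
  rw [← hg]
  exact (LinearMap.congr_fun (congrArg WithConv.ofConv this) a).symm

theorem sw_antipode (f : H → H → X) (h₁ : ∀ y, IsLinearMap k (f · y))
    (h₂ : ∀ x, IsLinearMap k (f x)) (a : H) :
    sw k f (antipode k a) = sw k (fun x y => f (antipode k y) (antipode k x)) a := by
  rw [sw_eq h₁ h₂, comul_antipode, map_sw]
  rfl

end Sweedler

/-- Left modules over the Hopf algebra `H`, given by an action `ρ : H → End_k(V)`. -/
structure HMod (k H : Type u) [Field k] [Ring H] [HopfAlgebra k H] where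
  V : Type u
  [grp : AddCommGroup V]
  [mod : Module k V]
  ρ : H →ₐ[k] Module.End k V

attribute [instance] HMod.grp HMod.mod

variable {k H : Type u} [Field k] [Ring H] [HopfAlgebra k H]

namespace HMod

variable (U V W : HMod k H)

/-- An `H`-module in the sense of Mathlib, as an object of `HMod`. -/
noncomputable abbrev of (k H A : Type u) [Field k] [Ring H] [HopfAlgebra k H] [AddCommGroup A]
    [Module k A] [Module H A] [IsScalarTower k H A] : HMod k H where
  V := A
  ρ := Algebra.lsmul k k A

/-- The monoidal unit: `k` with `H` acting through the counit. -/
noncomputable def unit (k H : Type u) [Field k] [Ring H] [HopfAlgebra k H] : HMod k H where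
  V := k
  ρ := (Algebra.ofId k (Module.End k k)).comp (Bialgebra.counitAlgHom k H)

/-- The tensor product, with `h (v ⊗ w) = h₁ v ⊗ h₂ w`. -/
noncomputable abbrev tensor : HMod k H where
  V := V.V ⊗[k] W.V
  ρ := (Module.endTensorEndAlgHom (R := k) (S := k) (A := k)).comp
    ((Algebra.TensorProduct.map V.ρ W.ρ).comp (Bialgebra.comulAlgHom k H))

/-- `H`-linearity of a `k`-linear map. -/
def IsHLinear {V W : HMod k H} (f : V.V →ₗ[k] W.V) : Prop :=
  ∀ (a : H) (v : V.V), f (V.ρ a v) = W.ρ a (f v)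

theorem tensor_ρ (a : H) (v : V.V) (w : W.V) :
    (V.tensor W).ρ a (v ⊗ₜ[k] w : V.V ⊗[k] W.V) =
      sw k (fun x y => (V.ρ x v ⊗ₜ[k] W.ρ y w : V.V ⊗[k] W.V)) a := by
  have h : ∀ t : H ⊗[k] H, Module.endTensorEndAlgHom (R := k) (S := k) (A := k)
      (Algebra.TensorProduct.map V.ρ W.ρ t) (v ⊗ₜ[k] w) =
      TensorProduct.lift ((TensorProduct.mk k V.V W.V).compl₁₂
        (V.ρ.toLinearMap.flip v) (W.ρ.toLinearMap.flip w)) t := by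
    intro t
    induction t using TensorProduct.induction_on with
    | zero => simp
    | tmul x y => rfl
    | add x y hx hy => simp only [map_add, LinearMap.add_apply, hx, hy]
  refine (h _).trans ?_
  exact lift_comul _ _

/-- The action of `H` on `Hom_k(H, V)` by `a · φ = φ(- a)`. -/
noncomputable def precompR : H →ₐ[k] Module.End k (H →ₗ[k] V.V) := AlgHom.ofLinearMap
  ((LinearMap.llcomp k H H V.V).flip ∘ₗ (LinearMap.mul k H).flip)
  (by ext; simp) (by intros; ext; simp [mul_assoc])

/-- The action of `H` on `Hom_k(H, V)` by `a · φ = a φ(-)`. -/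
noncomputable def postcomp : H →ₐ[k] Module.End k (H →ₗ[k] V.V) := AlgHom.ofLinearMap
  (LinearMap.llcomp k H V.V V.V ∘ₗ V.ρ.toLinearMap)
  (by ext; simp) (by intros; ext; simp)

/-- The action of `H` on `Hom_k(H, V)` by `a · φ = φ(S(a) -)`. -/
noncomputable def precompS : H →ₐ[k] Module.End k (H →ₗ[k] V.V) := AlgHom.ofLinearMap
  ((LinearMap.llcomp k H H V.V).flip ∘ₗ LinearMap.mul k H ∘ₗ HopfAlgebra.antipode k)
  (by ext; simp) (by intros; ext; simp [mul_assoc, HopfAlgebra.antipode_mul_antidistrib])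

@[simp] theorem precompR_apply (a : H) (φ : H →ₗ[k] V.V) (h : H) :
    V.precompR a φ h = φ (h * a) := rfl

@[simp] theorem postcomp_apply (a : H) (φ : H →ₗ[k] V.V) (h : H) :
    V.postcomp a φ h = V.ρ a (φ h) := rfl

@[simp] theorem precompS_apply (a : H) (φ : H →ₗ[k] V.V) (h : H) :
    V.precompS a φ h = φ (HopfAlgebra.antipode k a * h) := rfl

theorem precompR_comm_postcomp (x y : H) : Commute (V.precompR x) (V.postcomp y) :=
  LinearMap.ext fun _ => LinearMap.ext fun _ => rfl

/-- The action of `H ⊗ H` on `Hom_k(H, V)` by `(a ⊗ b) · φ = b φ(- a)`. -/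
noncomputable def adjAux : H ⊗[k] H →ₐ[k] Module.End k (H →ₗ[k] V.V) :=
  Algebra.TensorProduct.lift V.precompR V.postcomp V.precompR_comm_postcomp

theorem adjAux_tmul (x y : H) (φ : H →ₗ[k] V.V) (h : H) :
    V.adjAux (x ⊗ₜ y) φ h = V.ρ y (φ (h * x)) := by
  simp only [adjAux, Algebra.TensorProduct.lift_tmul]
  rfl

theorem adjAux_comm_precompS (x : H ⊗[k] H) (y : H) :
    Commute (V.adjAux x) (V.precompS y) := by
  induction x using TensorProduct.induction_on with
  | zero => rw [map_zero]; exact Commute.zero_left _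
  | tmul x z =>
    refine LinearMap.ext fun φ => LinearMap.ext fun h => ?_
    simp only [Module.End.mul_apply, adjAux_tmul, precompS_apply, mul_assoc]
  | add x z hx hz => rw [map_add]; exact hx.add_left hz

/-- The `H`-action on `Hom_k(H, V)` given by `(a · φ)(h) = a₂ φ(S(a₃) h a₁)`, obtained
from the three commuting actions `φ(- a)`, `a φ(-)` and `φ(S(a) -)`. -/
noncomputable def adj : H →ₐ[k] Module.End k (H →ₗ[k] V.V) :=
  (Algebra.TensorProduct.lift V.adjAux V.precompS V.adjAux_comm_precompS).comp
    ((Algebra.TensorProduct.map (Bialgebra.comulAlgHom k H) (AlgHom.id k H)).comp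
      (Bialgebra.comulAlgHom k H))

theorem adj_apply (a : H) (φ : H →ₗ[k] V.V) (h : H) : V.adj a φ h =
    sw k (fun p z => sw k (fun x y =>
      V.ρ y (φ (HopfAlgebra.antipode k z * h * x))) p) a := by
  have e : ∀ a, Bialgebra.comulAlgHom k H a = sw k (fun x y => x ⊗ₜ[k] y) a :=
    fun a => (ℛ k a).eq.symm
  simp only [adj, AlgHom.comp_apply, e]
  simp only [sw, map_sum, Algebra.TensorProduct.map_tmul, AlgHom.id_apply,
    Algebra.TensorProduct.lift_tmul, LinearMap.sum_apply]
  refine Finset.sum_congr rfl fun i _ => ?_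
  simp only [e, sw, map_sum, Module.End.mul_apply, LinearMap.sum_apply, adjAux_tmul,
    precompS_apply, mul_assoc]

end HMod

/-- Anti-Yetter-Drinfeld contramodules over `H`: an `H`-module with a contraaction
`α : Hom_k(H, M) → M` that is counital and coassociative, and satisfies
`α (a₂ φ(S(a₃) - a₁)) = a α(φ)`. -/
structure AYD (k H : Type u) [Field k] [Ring H] [HopfAlgebra k H] extends HMod k H where
  α : (H →ₗ[k] V) →ₗ[k] V
  α_counit : ∀ m : V, α ((counit : H →ₗ[k] k).smulRight m) = m
  α_assoc : ∀ Φ : H →ₗ[k] H →ₗ[k] V, α (α ∘ₗ Φ) = α (TensorProduct.lift Φ ∘ₗ comul)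
  α_adj : ∀ (a : H) (φ : H →ₗ[k] V), α (toHMod.adj a φ) = ρ a (α φ)

namespace AYD

/-- The map `φ ↦ (h ↦ φ(h₁)(h₂))`. -/
noncomputable def coassocMap (V : HMod k H) : (H →ₗ[k] H →ₗ[k] V.V) →ₗ[k] (H →ₗ[k] V.V) :=
  LinearMap.lcomp k V.V comul ∘ₗ (TensorProduct.lift.equiv (.id k) H H V.V).toLinearMap

theorem coassocMap_apply (V : HMod k H) (Φ : H →ₗ[k] H →ₗ[k] V.V) (h : H) :
    coassocMap V Φ h = sw k (fun x y => Φ x y) h := lift_comul _ _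

theorem coassocMap_adj_aux (V : HMod k H) (a h₁ h₂ : H) (Φ : H →ₗ[k] H →ₗ[k] V.V) :
    sw k (fun p z => sw k (fun x y => sw k (fun q w => sw k (fun u v =>
      V.ρ v (Φ (HopfAlgebra.antipode k z * h₁ * x) (HopfAlgebra.antipode k w * h₂ * u)))
      q) y) p) a =
    sw k (fun p z' => sw k (fun w z => sw k (fun x' v => sw k (fun x u =>
      V.ρ v (Φ (HopfAlgebra.antipode k z * h₁ * x) (HopfAlgebra.antipode k w * h₂ * u)))
      x') p) z') a := by
  symm
  rw [← sw_assoc (fun p w z => sw k (fun x' v => sw k (fun x u =>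
      V.ρ v (Φ (HopfAlgebra.antipode k z * h₁ * x) (HopfAlgebra.antipode k w * h₂ * u)))
      x') p)]
  · congr 1; ext p z
    rw [← sw_assoc (fun x q w => sw k (fun u v =>
      V.ρ v (Φ (HopfAlgebra.antipode k z * h₁ * x) (HopfAlgebra.antipode k w * h₂ * u))) q)]
    · congr 1; ext p' w
      rw [sw_assoc]
      all_goals intros; constructor <;> intros <;> simp [mul_add]
    · intros; constructor <;> intros <;> simp [sw, mul_add, Finset.sum_add_distrib, Finset.smul_sum]
    · intros; apply sw_isLinear
      all_goals intros; constructor <;> intros <;> simp [mul_add]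
    · intros; constructor <;> intros <;> simp [sw, add_mul, Finset.sum_add_distrib, Finset.smul_sum]
  · intro w z
    apply sw_isLinear
    · intro v
      apply sw_isLinear
      all_goals intros; constructor <;> intros <;> simp [mul_add]
    · intros; constructor <;> intros <;> simp [sw, Finset.sum_add_distrib, Finset.smul_sum]
  · intros; constructor <;> intros <;> simp [sw, add_mul, Finset.sum_add_distrib, Finset.smul_sum]
  · intros; constructor <;> intros <;> simp [sw, add_mul, Finset.sum_add_distrib, Finset.smul_sum]

/-- The trace functor on objects: `Tr(V) = Hom_k(H, V)`, the free anti-Yetter-Drinfeld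
contramodule on the `H`-module `V`. -/
noncomputable def Tr (V : HMod k H) : AYD k H where
  V := H →ₗ[k] V.V
  ρ := V.adj
  α := coassocMap V
  α_counit m := by
    ext h
    rw [coassocMap_apply]
    simpa using sw_counit_left (k := k) (fun y => m y) ⟨by simp, by simp⟩ h
  α_assoc Φ := by
    ext h
    simp only [coassocMap_apply, LinearMap.comp_apply, lift_comul]
    rw [← sw_assoc (fun x y z => Φ x y z)]
    · simp [sw]
    all_goals intros; constructor <;> intros <;> simp
  α_adj a Φ := by
    ext h
    change coassocMap V _ h = V.adj a (coassocMap V Φ) h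
    rw [coassocMap_apply, HMod.adj_apply]
    have e1 : ∀ h₁ h₂, (HMod.adj ({ V := H →ₗ[k] V.V, ρ := V.adj } : HMod k H) a Φ) h₁ h₂ =
        sw k (fun p z => sw k (fun x y => sw k (fun q w => sw k (fun u v =>
      V.ρ v (Φ (HopfAlgebra.antipode k z * h₁ * x) (HopfAlgebra.antipode k w * h₂ * u)))
      q) y) p) a := by
      intro h₁ h₂
      rw [HMod.adj_apply]
      simp only [sw, LinearMap.sum_apply]
      simp only [HMod.adj_apply]
      rfl
    have e2 : ∀ z x, coassocMap V Φ (HopfAlgebra.antipode k z * h * x) =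
        sw k (fun w z => sw k (fun h₁ h₂ => sw k (fun x u =>
          Φ (HopfAlgebra.antipode k z * h₁ * x) (HopfAlgebra.antipode k w * h₂ * u)) x) h) z := by
      intro z x
      rw [coassocMap_apply, sw_mul, sw_mul, sw_antipode]
      all_goals intros; constructor <;> intros <;>
        simp [sw, add_mul, Finset.sum_add_distrib, Finset.smul_sum]
    simp only [e1, e2, coassocMap_adj_aux, map_sw]
    rw [sw_comm]
    congr 1; ext p z
    rw [sw_comm, sw_comm _ p z]
    congr 1; ext w z'
    rw [sw_comm]

/-- The automorphism `ς` of the identity functor: `ς_M(m) = α(h ↦ h m)`. -/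
noncomputable def sigma (M : AYD k H) : M.V →ₗ[k] M.V :=
  M.α ∘ₗ M.ρ.toLinearMap.flip

/-- `M` is stable if `ς_M` is the identity. -/
def IsStable (M : AYD k H) : Prop :=
  ∀ m : M.V, M.sigma m = m

theorem sigma_Tr (V : HMod k H) (φ : H →ₗ[k] V.V) :
    (Tr V).sigma φ = coassocMap V (V.ρ.toLinearMap.flip ∘ₗ φ) := by
  change coassocMap V (V.adj.toLinearMap.flip φ) = _
  ext h
  rw [coassocMap_apply, coassocMap_apply]
  change _ = sw k (fun x y => V.ρ y (φ x)) h
  simp only [LinearMap.flip_apply, AlgHom.toLinearMap_apply, HMod.adj_apply]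
  have e : sw k (fun a g => sw k (fun p z => sw k (fun x y =>
      V.ρ y (φ (HopfAlgebra.antipode k z * g * x))) p) a) h =
      sw k (fun p q => sw k (fun z g => sw k (fun x y =>
      V.ρ y (φ (HopfAlgebra.antipode k z * g * x))) p) q) h := by
    rw [sw_assoc (fun p z g => sw k (fun x y =>
      V.ρ y (φ (HopfAlgebra.antipode k z * g * x))) p)]
    · intros; apply sw_isLinear
      all_goals intros; constructor <;> intros <;> simp [mul_add]
    all_goals intros; constructor <;> intros <;>
      simp [sw, add_mul, mul_add, Finset.sum_add_distrib, Finset.smul_sum]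
  rw [e]
  have e2 : ∀ p q : H, sw k (fun z g => sw k (fun x y =>
      V.ρ y (φ (HopfAlgebra.antipode k z * g * x))) p) q =
      counit (R := k) q • sw k (fun x y => V.ρ y (φ x)) p := by
    intro p q
    rw [sw_comm, ← sw_smul]
    congr 1; ext x y
    rw [sw_antipode_mul (fun t => V.ρ y (φ (t * x)))]
    · simp
    · constructor <;> intros <;> simp [add_mul]
  simp only [e2]
  refine sw_counit_right (fun p => sw k (fun x y => V.ρ y (φ x)) p) ?_ h
  apply sw_isLinear
  all_goals intros; constructor <;> intros <;> simp

/-- The morphisms of anti-Yetter-Drinfeld contramodules: `H`-linear maps that commute with the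
contraactions. -/
def homs (M N : AYD k H) : Submodule k (M.V →ₗ[k] N.V) where
  carrier := {f | (∀ a m, f (M.ρ a m) = N.ρ a (f m)) ∧ ∀ φ, f (M.α φ) = N.α (f ∘ₗ φ)}
  add_mem' := by
    rintro f g ⟨hf, hf'⟩ ⟨hg, hg'⟩
    exact ⟨fun a m => by simp [hf, hg], fun φ => by simp [hf', hg', LinearMap.add_comp]⟩
  zero_mem' := ⟨fun a m => by simp, fun φ => by simp⟩
  smul_mem' := by
    rintro c f ⟨hf, hf'⟩
    exact ⟨fun a m => by simp [hf], fun φ => by simp [hf', LinearMap.smul_comp]⟩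

/-- The category of anti-Yetter-Drinfeld contramodules. -/
instance : Category (AYD k H) where
  Hom M N := M.homs N
  id M := ⟨LinearMap.id, fun _ _ => rfl, fun _ => rfl⟩
  comp f g := ⟨g.1 ∘ₗ f.1, fun a m => by simp [f.2.1, g.2.1],
    fun φ => by simp [f.2.2, g.2.2, LinearMap.comp_assoc]⟩

/-- The `k`-linear map underlying a morphism. -/
def Hom.lin {M N : AYD k H} (f : M ⟶ N) : M.V →ₗ[k] N.V := Subtype.val (p := (· ∈ M.homs N)) f

instance : Preadditive (AYD k H) where
  homGroup M N := inferInstanceAs (AddCommGroup (M.homs N))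
  add_comp _ _ _ f f' g := Subtype.ext (LinearMap.comp_add f.1 f'.1 g.1)
  comp_add _ _ _ f g g' := Subtype.ext (LinearMap.add_comp f.1 g'.1 g.1)

instance : Linear k (AYD k H) where
  homModule M N := inferInstanceAs (Module k (M.homs N))
  smul_comp _ _ _ c f g := Subtype.ext (LinearMap.comp_smul g.1 c f.1)
  comp_smul _ _ _ f c g := Subtype.ext (LinearMap.smul_comp c g.1 f.1)

/-- The forgetful functor to vector spaces. -/
def forget (k H : Type u) [Field k] [Ring H] [HopfAlgebra k H] :
    AYD k H ⥤ ModuleCat.{u} k where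
  obj M := ModuleCat.of k M.V
  map f := ModuleCat.ofHom (Hom.lin f)

instance : (forget k H).Additive where

@[ext] theorem hom_ext {M N : AYD k H} {f g : M ⟶ N} (h : ∀ x, Hom.lin f x = Hom.lin g x) :
    f = g := Subtype.ext (LinearMap.ext h)

@[simp] theorem lin_id (M : AYD k H) : Hom.lin (𝟙 M) = LinearMap.id := rfl
@[simp] theorem lin_comp {M N P : AYD k H} (f : M ⟶ N) (g : N ⟶ P) :
    Hom.lin (f ≫ g) = Hom.lin g ∘ₗ Hom.lin f := rfl
@[simp] theorem lin_add {M N : AYD k H} (f g : M ⟶ N) :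
    Hom.lin (f + g) = Hom.lin f + Hom.lin g := rfl
@[simp] theorem lin_sub {M N : AYD k H} (f g : M ⟶ N) :
    Hom.lin (f - g) = Hom.lin f - Hom.lin g := rfl
@[simp] theorem lin_zero {M N : AYD k H} : Hom.lin (0 : M ⟶ N) = 0 := rfl

theorem comp_adj {V W : HMod k H} {f : V.V →ₗ[k] W.V} (hf : HMod.IsHLinear f) (a : H)
    (φ : H →ₗ[k] V.V) : f ∘ₗ V.adj a φ = W.adj a (f ∘ₗ φ) := by
  ext h
  simp only [LinearMap.comp_apply, HMod.adj_apply, map_sw, hf _ _]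

theorem comp_coassocMap {V W : HMod k H} (f : V.V →ₗ[k] W.V) (Φ : H →ₗ[k] H →ₗ[k] V.V) :
    f ∘ₗ coassocMap V Φ = coassocMap W (LinearMap.llcomp k H V.V W.V f ∘ₗ Φ) := by
  ext h
  simp only [LinearMap.comp_apply, coassocMap_apply, map_sw]
  rfl

/-- The morphism `Tr(V) → M`, `φ ↦ α(f ∘ φ)`, that corresponds to an `H`-linear map
`f : V → M`. -/
noncomputable def extend {V : HMod k H} {M : AYD k H} (f : V.V →ₗ[k] M.V)
    (hf : HMod.IsHLinear (W := M.toHMod) f) : Tr V ⟶ M :=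
  ⟨M.α ∘ₗ LinearMap.llcomp k H V.V M.V f,
    fun a φ => (congrArg M.α (comp_adj hf a φ)).trans (M.α_adj a _),
    fun Φ => (congrArg M.α (comp_coassocMap (W := M.toHMod) f Φ)).trans (M.α_assoc _).symm⟩

/-- The trace functor on morphisms: `φ ↦ f ∘ φ`. -/
noncomputable def TrMap {V W : HMod k H} (f : V.V →ₗ[k] W.V) (hf : HMod.IsHLinear f) :
    Tr V ⟶ Tr W :=
  ⟨LinearMap.llcomp k H V.V W.V f, comp_adj hf, comp_coassocMap f⟩

/-- The zero contramodule. -/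
def zero (k H : Type u) [Field k] [Ring H] [HopfAlgebra k H] : AYD k H where
  V := PUnit
  ρ := AlgHom.ofLinearMap 0 (Subsingleton.elim _ _) (fun _ _ => Subsingleton.elim _ _)
  α := 0
  α_counit _ := Subsingleton.elim _ _
  α_assoc _ := Subsingleton.elim _ _
  α_adj _ _ := Subsingleton.elim _ _

end AYD

/-- `A` is an algebra in the monoidal category of `H`-modules. -/
structure IsModuleAlgebra (k H A : Type u) [Field k] [Ring H] [HopfAlgebra k H] [Ring A]
    [Algebra k A] [Module H A] [IsScalarTower k H A] : Prop where
  smul_mul : ∀ (h : H) (a b : A), h • (a * b) = LinearMap.mul' k A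
    (((HMod.of k H A).tensor (HMod.of k H A)).ρ h (a ⊗ₜ[k] b : A ⊗[k] A))
  smul_one : ∀ h : H, h • (1 : A) = (counit h : k) • (1 : A)

section Powers

variable (k H) (A : Type u) [Ring A] [Algebra k A] [Module H A] [IsScalarTower k H A]

/-- The tensor powers `A^{⊗ n}`, with `A^{⊗ 0} = k` and `A^{⊗ (n + 1)} = A^{⊗ n} ⊗ A`. -/
noncomputable def Pow : ℕ → HMod k H
  | 0 => HMod.unit k H
  | n + 1 => (Pow n).tensor (HMod.of k H A)

/-- The isomorphism `A ⊗ A^{⊗ n} ≃ A^{⊗ (n + 1)}`. -/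
noncomputable def front : (n : ℕ) → A ⊗[k] (Pow k H A n).V ≃ₗ[k] (Pow k H A (n + 1)).V
  | 0 => TensorProduct.comm k A k
  | n + 1 => (TensorProduct.assoc k A (Pow k H A n).V A).symm ≪≫ₗ
      TensorProduct.congr (front n) (LinearEquiv.refl k A)

/-- The map `v ⊗ w ↦ (h ↦ w ⊗ h v)`. -/
noncomputable def moveFirst (X : Type u) [AddCommGroup X] [Module k X] :
    A ⊗[k] X →ₗ[k] H →ₗ[k] X ⊗[k] A :=
  TensorProduct.lift (LinearMap.mk₂ k
    (fun v w => TensorProduct.mk k X A w ∘ₗ (HMod.of k H A).ρ.toLinearMap.flip v)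
    (by intros; ext; simp [tmul_add]) (by intros; ext; simp)
    (by intros; ext; simp) (by intros; ext; simp [smul_tmul']))

/-- The map `a₀ ⊗ ⋯ ⊗ aₙ ↦ (h ↦ a₁ ⊗ ⋯ ⊗ aₙ ⊗ h a₀)`. -/
noncomputable def rot (n : ℕ) :
    (Pow k H A (n + 1)).V →ₗ[k] H →ₗ[k] (Pow k H A (n + 1)).V :=
  moveFirst k H A (Pow k H A n).V ∘ₗ (front k H A n).symm.toLinearMap

/-- The map `x ⊗ a ⊗ b ↦ x ⊗ ab`. -/
noncomputable def mulLast (X : Type u) [AddCommGroup X] [Module k X] :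
    (X ⊗[k] A) ⊗[k] A →ₗ[k] X ⊗[k] A :=
  (LinearMap.mul' k A).lTensor X ∘ₗ (TensorProduct.assoc k X A A).toLinearMap

/-- For `i ≤ n`, the map `A^{⊗ (n + 2)} → A^{⊗ (n + 1)}` that multiplies the adjacent factors
with the indices `n - i` and `n - i + 1` (the factors have the indices `0, …, n + 1`). -/
noncomputable def mulAt : (n i : ℕ) → (Pow k H A (n + 2)).V →ₗ[k] (Pow k H A (n + 1)).V
  | n, 0 => mulLast k A (Pow k H A n).V
  | 0, _ + 1 => 0
  | n + 1, i + 1 => (mulAt n i).rTensor A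

/-- The map `x ↦ x ⊗ 1`. -/
noncomputable def unitLast (n : ℕ) : (Pow k H A n).V →ₗ[k] (Pow k H A (n + 1)).V :=
  (TensorProduct.mk k (Pow k H A n).V A).flip 1

end Powers

section PowerLemmas

variable {A : Type u} [Ring A] [Algebra k A] [Module H A] [IsScalarTower k H A]

variable (k H) in
/-- The pure tensor `a₀ ⊗ ⋯ ⊗ a_{n-1}`. -/
noncomputable def pureTensor (a : ℕ → A) : (n : ℕ) → (Pow k H A n).V
  | 0 => (1 : k)
  | n + 1 => (pureTensor a n ⊗ₜ[k] a n : (Pow k H A n).V ⊗[k] A)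

theorem pure_congr {a b : ℕ → A} : ∀ {n : ℕ}, (∀ i < n, a i = b i) → pureTensor k H a n = pureTensor k H b n
  | 0, _ => rfl
  | n + 1, h => by
    simp only [pureTensor]
    rw [pure_congr fun i hi => h i (by omega), h n (by omega)]

theorem pow_ext {X : Type*} [AddCommGroup X] [Module k X] : ∀ {n : ℕ}
    {f g : (Pow k H A n).V →ₗ[k] X}, (∀ a, f (pureTensor k H a n) = g (pureTensor k H a n)) → f = g
  | 0, f, g, h => LinearMap.ext_ring (R := k) (h 0)
  | n + 1, f, g, h => by
    refine TensorProduct.ext (M := (Pow k H A n).V) (N := A) (LinearMap.ext₂ fun x b => ?_)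
    have := pow_ext (n := n) (f := f ∘ₗ (TensorProduct.mk k (Pow k H A n).V A).flip b)
      (g := g ∘ₗ (TensorProduct.mk k (Pow k H A n).V A).flip b) (fun a => by
        have e : pureTensor k H (fun i => if i < n then a i else b) (n + 1) =
            (pureTensor k H a n ⊗ₜ[k] b : (Pow k H A n).V ⊗[k] A) := by
          simp only [pureTensor, lt_irrefl, if_false]
          rw [pure_congr (b := a) (fun i hi => by simp [hi])]
        have := h (fun i => if i < n then a i else b)
        rw [e] at this
        exact this)
    exact LinearMap.congr_fun this x

theorem front_pure (v : A) (a : ℕ → A) : ∀ n, front k H A n (v ⊗ₜ pureTensor k H a n) =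
    pureTensor k H (fun i => Nat.casesOn i v a) (n + 1)
  | 0 => rfl
  | n + 1 => by
    have := front_pure v a n
    change (front k H A n (v ⊗ₜ pureTensor k H a n) ⊗ₜ[k] a n : (Pow k H A (n + 1)).V ⊗[k] A) = _
    rw [this]
    rfl

theorem rot_pure (a : ℕ → A) (n : ℕ) (h : H) : rot k H A n (pureTensor k H a (n + 1)) h =
    pureTensor k H (fun i => if i < n then a (i + 1) else h • a 0) (n + 1) := by
  have e : pureTensor k H a (n + 1) = front k H A n (a 0 ⊗ₜ pureTensor k H (fun i => a (i + 1)) n) := by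
    rw [front_pure]
    exact pure_congr fun i _ => by cases i <;> rfl
  have e' := (LinearEquiv.symm_apply_eq (front k H A n)).2 e
  refine (congrArg (fun z => moveFirst k H A (Pow k H A n).V z h) e').trans ?_
  change (pureTensor k H (fun i => a (i + 1)) n ⊗ₜ[k] (h • a 0) : (Pow k H A n).V ⊗[k] A) = _
  simp only [pureTensor, lt_irrefl, if_false]
  rw [pure_congr (a := fun i => if i < n then a (i + 1) else h • a 0) (b := fun i => a (i + 1))
    (fun i hi => if_pos hi)]

theorem mulAt_pure (a : ℕ → A) : ∀ n i, i ≤ n → mulAt k H A n i (pureTensor k H a (n + 2)) =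
    pureTensor k H (fun j => if j < n - i then a j else if j = n - i then a j * a (j + 1)
      else a (j + 1)) (n + 1)
  | n, 0, _ => by
    have : mulAt k H A n 0 = mulLast k A (Pow k H A n).V := by cases n <;> rfl
    rw [this]
    change (pureTensor k H a n ⊗ₜ[k] (a n * a (n + 1)) : (Pow k H A n).V ⊗[k] A) = _
    simp only [pureTensor, Nat.sub_zero, lt_irrefl, if_false, if_true]
    rw [pure_congr (b := a) (fun i hi => if_pos hi)]
  | n + 1, i + 1, h => by
    have := mulAt_pure a n i (by omega)
    change (mulAt k H A n i (pureTensor k H a (n + 2)) ⊗ₜ[k] a (n + 2) : (Pow k H A (n + 1)).V ⊗[k] A) = _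
    rw [this]
    conv_rhs => rw [pureTensor]
    rw [if_neg (by omega), if_neg (by omega)]
    congr 1
    exact pure_congr fun j hj => by congr 2 <;> simp

theorem mulAt_rot (n i : ℕ) (hi : i < n) (x : (Pow k H A (n + 2)).V) (h : H) :
    mulAt k H A n (i + 1) (rot k H A (n + 1) x h) = rot k H A n (mulAt k H A n i x) h := by
  revert x
  suffices e : mulAt k H A n (i + 1) ∘ₗ (rot k H A (n + 1)).flip h =
      (rot k H A n).flip h ∘ₗ mulAt k H A n i from fun x => LinearMap.congr_fun e x
  refine pow_ext fun a => ?_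
  simp only [LinearMap.comp_apply, LinearMap.flip_apply]
  rw [rot_pure, mulAt_pure _ _ _ hi, mulAt_pure _ _ _ hi.le, rot_pure]
  refine pure_congr fun j hj => ?_
  split_ifs <;> first | omega | rfl

theorem unitLast_mulAt_zero (n : ℕ) (x : (Pow k H A (n + 1)).V) :
    mulAt k H A n 0 (unitLast k H A (n + 1) x) = x := by
  have e : mulAt k H A n 0 = mulLast k A (Pow k H A n).V := by cases n <;> rfl
  rw [e]
  suffices h : mulLast k A (Pow k H A n).V ∘ₗ unitLast k H A (n + 1) = LinearMap.id from
    LinearMap.congr_fun h x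
  refine pow_ext fun a => ?_
  change (pureTensor k H a n ⊗ₜ[k] (a n * 1) : (Pow k H A n).V ⊗[k] A) = _
  rw [mul_one]
  rfl

theorem unitLast_mulAt_succ (n i : ℕ) (x : (Pow k H A (n + 2)).V) :
    mulAt k H A (n + 1) (i + 1) (unitLast k H A (n + 2) x) =
      unitLast k H A (n + 1) (mulAt k H A n i x) := rfl

theorem mulAt_mulAt (n i j : ℕ) (hij : i < j) (hj : j ≤ n + 1) (x : (Pow k H A (n + 3)).V) :
    mulAt k H A n i (mulAt k H A (n + 1) j x) =
      mulAt k H A n (j - 1) (mulAt k H A (n + 1) i x) := by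
  revert x
  suffices e : mulAt k H A n i ∘ₗ mulAt k H A (n + 1) j =
      mulAt k H A n (j - 1) ∘ₗ mulAt k H A (n + 1) i from fun x => LinearMap.congr_fun e x
  refine pow_ext fun a => ?_
  simp only [LinearMap.comp_apply]
  rw [mulAt_pure _ _ _ hj, mulAt_pure _ _ _ (by omega), mulAt_pure _ _ _ (by omega),
    mulAt_pure _ _ _ (by omega)]
  refine pure_congr fun l hl => ?_
  split_ifs <;> first | omega | rfl | exact mul_assoc _ _ _

theorem sw_rot_rot (hA : IsModuleAlgebra k H A) (n : ℕ) (x : (Pow k H A (n + 2)).V) (h : H) :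
    sw k (fun h₁ h₂ => mulAt k H A n 0 (rot k H A (n + 1) (rot k H A (n + 1) x h₁) h₂)) h =
      rot k H A n (mulAt k H A n n x) h := by
  let F : (Pow k H A (n + 2)).V →ₗ[k] (Pow k H A (n + 1)).V :=
    { toFun := fun x => sw k (fun h₁ h₂ =>
        mulAt k H A n 0 (rot k H A (n + 1) (rot k H A (n + 1) x h₁) h₂)) h
      map_add' := by intros; simp [sw, Finset.sum_add_distrib]
      map_smul' := by intros; simp [sw, Finset.smul_sum] }
  revert x
  suffices e : F = (rot k H A n).flip h ∘ₗ mulAt k H A n n from fun x => LinearMap.congr_fun e x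
  refine pow_ext fun a => ?_
  have e : ∀ h₁ h₂ : H, mulAt k H A n 0 (rot k H A (n + 1)
      (rot k H A (n + 1) (pureTensor k H a (n + 2)) h₁) h₂) =
      (pureTensor k H (fun j => a (j + 2)) n ⊗ₜ[k] ((h₁ • a 0) * (h₂ • a 1)) :
        (Pow k H A n).V ⊗[k] A) := by
    intro h₁ h₂
    rw [rot_pure, rot_pure, mulAt_pure _ _ _ (Nat.zero_le n), pureTensor]
    simp only [Nat.sub_zero, lt_irrefl, if_false, if_true]
    congr 1
    · refine pure_congr fun j hj => ?_
      split_ifs <;> first | omega | rfl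
    · simp
  have e' : rot k H A n (mulAt k H A n n (pureTensor k H a (n + 2))) h =
      (pureTensor k H (fun j => a (j + 2)) n ⊗ₜ[k] (h • (a 0 * a 1)) : (Pow k H A n).V ⊗[k] A) := by
    rw [mulAt_pure _ _ _ le_rfl, rot_pure, pureTensor]
    simp only [lt_irrefl, if_false, Nat.sub_self, if_true]
    congr 1
    refine pure_congr fun j hj => ?_
    rw [if_pos hj, if_neg (by omega), if_neg (by omega)]
  refine Eq.trans ?_ e'.symm
  change sw k (fun h₁ h₂ => mulAt k H A n 0 (rot k H A (n + 1)
      (rot k H A (n + 1) (pureTensor k H a (n + 2)) h₁) h₂)) h = _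
  simp only [e]
  rw [hA.smul_mul, HMod.tensor_ρ, map_sw]
  exact (map_sw (TensorProduct.mk k (Pow k H A n).V A (pureTensor k H (fun j => a (j + 2)) n)) _ _).symm

theorem isHLinear_of_tmul {V W X : HMod k H} {f : V.V ⊗[k] W.V →ₗ[k] X.V}
    (h : ∀ a v w, f ((V.tensor W).ρ a (v ⊗ₜ[k] w : V.V ⊗[k] W.V)) = X.ρ a (f (v ⊗ₜ[k] w))) :
    HMod.IsHLinear (V := V.tensor W) f := fun a =>
  LinearMap.congr_fun (TensorProduct.ext (LinearMap.ext₂ (h a)) :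
    f ∘ₗ ((V.tensor W).ρ a : V.V ⊗[k] W.V →ₗ[k] V.V ⊗[k] W.V) = X.ρ a ∘ₗ f)

theorem isHLinear_rTensor {V W : HMod k H} (U : HMod k H) {f : V.V →ₗ[k] W.V}
    (hf : HMod.IsHLinear f) :
    HMod.IsHLinear (V := V.tensor U) (W := W.tensor U) (f.rTensor U.V) := by
  refine isHLinear_of_tmul fun a x y => ?_
  rw [HMod.tensor_ρ, map_sw]
  change _ = (W.tensor U).ρ a (f x ⊗ₜ[k] y : W.V ⊗[k] U.V)
  rw [HMod.tensor_ρ]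
  simp only [LinearMap.rTensor_tmul, hf _ _]

theorem isHLinear_mulLast (hA : IsModuleAlgebra k H A) (V : HMod k H) :
    HMod.IsHLinear (V := (V.tensor (HMod.of k H A)).tensor (HMod.of k H A))
      (W := V.tensor (HMod.of k H A)) (mulLast k A V.V) := by
  intro g
  refine LinearMap.congr_fun (f := (mulLast k A V.V) ∘ₗ
    (((V.tensor (HMod.of k H A)).tensor (HMod.of k H A)).ρ g :
      (V.V ⊗[k] A) ⊗[k] A →ₗ[k] (V.V ⊗[k] A) ⊗[k] A))
    (g := ((V.tensor (HMod.of k H A)).ρ g : V.V ⊗[k] A →ₗ[k] V.V ⊗[k] A) ∘ₗ mulLast k A V.V)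
    (TensorProduct.ext_threefold fun v a b => ?_)
  change mulLast k A V.V (((V.tensor (HMod.of k H A)).tensor (HMod.of k H A)).ρ g
    ((v ⊗ₜ[k] a) ⊗ₜ[k] b : (V.V ⊗[k] A) ⊗[k] A)) =
    (V.tensor (HMod.of k H A)).ρ g (v ⊗ₜ[k] (a * b) : V.V ⊗[k] A)
  rw [HMod.tensor_ρ, HMod.tensor_ρ]
  change _ = sw k (fun x y => (V.ρ x v ⊗ₜ[k] (y • (a * b)) : V.V ⊗[k] A)) g
  have e1 : ∀ x y : H, (V.ρ x v ⊗ₜ[k] (y • (a * b)) : V.V ⊗[k] A) =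
      sw k (fun y z => (V.ρ x v ⊗ₜ[k] ((y • a) * (z • b)) : V.V ⊗[k] A)) y := by
    intro x y
    rw [hA.smul_mul, HMod.tensor_ρ, map_sw]
    exact map_sw (TensorProduct.mk k V.V A (V.ρ x v)) _ _
  simp only [e1]
  rw [← sw_assoc (fun x y z => (V.ρ x v ⊗ₜ[k] ((y • a) * (z • b)) : V.V ⊗[k] A))]
  · refine (map_sw (mulLast k A V.V) _ _).trans ?_
    congr 1; ext x z
    change mulLast k A V.V ((((V.tensor (HMod.of k H A)).ρ x (v ⊗ₜ[k] a : V.V ⊗[k] A)) ⊗ₜ[k]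
      (z • b)) : (V.V ⊗[k] A) ⊗[k] A) = _
    rw [HMod.tensor_ρ]
    exact map_sw (mulLast k A V.V ∘ₗ (TensorProduct.mk k (V.V ⊗[k] A) A).flip (z • b)) _ _
  all_goals intros; constructor <;> intros <;>
    simp [add_tmul, smul_tmul', add_smul, add_mul, mul_add, tmul_add]

theorem isHLinear_mulAt (hA : IsModuleAlgebra k H A) : ∀ n i,
    HMod.IsHLinear (mulAt k H A n i)
  | n, 0 => by
    have e : mulAt k H A n 0 = mulLast k A (Pow k H A n).V := by cases n <;> rfl
    rw [e]
    exact isHLinear_mulLast hA _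
  | 0, _ + 1 => fun _ _ => by simp [mulAt]
  | n + 1, i + 1 => isHLinear_rTensor _ (isHLinear_mulAt hA n i)

theorem isHLinear_unitLast (hA : IsModuleAlgebra k H A) (n : ℕ) :
    HMod.IsHLinear (unitLast k H A n) := by
  intro a v
  change (((Pow k H A n).ρ a v) ⊗ₜ[k] 1 : (Pow k H A n).V ⊗[k] A) =
    ((Pow k H A n).tensor (HMod.of k H A)).ρ a (v ⊗ₜ[k] 1 : (Pow k H A n).V ⊗[k] A)
  rw [HMod.tensor_ρ]
  have : ∀ y : H, (HMod.of k H A).ρ y 1 = (counit y : k) • (1 : A) := hA.smul_one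
  simp only [this, tmul_smul]
  rw [sw_counit_right (fun x => ((Pow k H A n).ρ x v ⊗ₜ[k] 1 : (Pow k H A n).V ⊗[k] A))]
  constructor <;> intros <;> simp [add_tmul, smul_tmul']

end PowerLemmas

section Rotation

variable {A : Type u} [Ring A] [Algebra k A] [Module H A] [IsScalarTower k H A]

theorem hsmul_smul (h : H) (c : k) (a : A) : h • c • a = c • h • a :=
  ((HMod.of k H A).ρ h).map_smul c a

theorem isHLinear_assoc_symm (U V W : HMod k H) (a : H) (u : U.V) (v : V.V) (w : W.V) :
    (TensorProduct.assoc k U.V V.V W.V).symm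
      ((U.tensor (V.tensor W)).ρ a (u ⊗ₜ[k] (v ⊗ₜ[k] w) : U.V ⊗[k] (V.V ⊗[k] W.V))) =
    ((U.tensor V).tensor W).ρ a ((u ⊗ₜ[k] v) ⊗ₜ[k] w : (U.V ⊗[k] V.V) ⊗[k] W.V) := by
  rw [HMod.tensor_ρ, HMod.tensor_ρ]
  have e1 : ∀ x y : H, (U.ρ x u ⊗ₜ[k] (V.tensor W).ρ y (v ⊗ₜ[k] w : V.V ⊗[k] W.V) :
      U.V ⊗[k] (V.V ⊗[k] W.V)) =
      sw k (fun y z => (U.ρ x u ⊗ₜ[k] (V.ρ y v ⊗ₜ[k] W.ρ z w) : U.V ⊗[k] (V.V ⊗[k] W.V))) y := by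
    intro x y
    rw [HMod.tensor_ρ]
    exact map_sw (TensorProduct.mk k U.V (V.V ⊗[k] W.V) (U.ρ x u)) _ _
  have e2 : ∀ x z : H, ((U.tensor V).ρ x (u ⊗ₜ[k] v : U.V ⊗[k] V.V) ⊗ₜ[k] W.ρ z w :
      (U.V ⊗[k] V.V) ⊗[k] W.V) =
      sw k (fun x y => ((U.ρ x u ⊗ₜ[k] V.ρ y v) ⊗ₜ[k] W.ρ z w : (U.V ⊗[k] V.V) ⊗[k] W.V)) x := by
    intro x z
    rw [HMod.tensor_ρ]
    exact map_sw ((TensorProduct.mk k (U.V ⊗[k] V.V) W.V).flip (W.ρ z w)) _ _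
  simp only [e1, e2]
  rw [← sw_assoc (fun x y z => (U.ρ x u ⊗ₜ[k] (V.ρ y v ⊗ₜ[k] W.ρ z w) :
      U.V ⊗[k] (V.V ⊗[k] W.V)))]
  · refine (map_sw (TensorProduct.assoc k U.V V.V W.V).symm.toLinearMap _ _).trans ?_
    congr 1; ext x z
    exact map_sw (TensorProduct.assoc k U.V V.V W.V).symm.toLinearMap _ _
  all_goals intros; constructor <;> intros <;> simp [add_tmul, ← smul_tmul', tmul_add]

theorem isHLinear_front : ∀ n, HMod.IsHLinear (V := (HMod.of k H A).tensor (Pow k H A n))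
    (W := Pow k H A (n + 1)) (front k H A n).toLinearMap
  | 0 => by
    refine isHLinear_of_tmul fun a v (w : k) => ?_
    refine (congrArg (front k H A 0).toLinearMap
      (HMod.tensor_ρ (HMod.of k H A) (HMod.unit k H) a v w)).trans ?_
    refine (map_sw (front k H A 0).toLinearMap _ _).trans ?_
    refine Eq.trans ?_ (HMod.tensor_ρ (HMod.unit k H) (HMod.of k H A) a w v).symm
    change sw k (fun x y => ((counit (R := k) y * w) ⊗ₜ[k] (x • v) : k ⊗[k] A)) a =
      sw k (fun x y => ((counit (R := k) x * w) ⊗ₜ[k] (y • v) : k ⊗[k] A)) a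
    simp only [← smul_eq_mul (α := k), ← smul_tmul']
    rw [sw_counit_left (fun y => (w ⊗ₜ[k] (y • v) : k ⊗[k] A)),
      sw_counit_right (fun y => (w ⊗ₜ[k] (y • v) : k ⊗[k] A))]
    all_goals constructor <;> intros <;> simp [add_smul, tmul_add]
  | n + 1 => by
    intro a
    refine LinearMap.congr_fun (f := (front k H A (n + 1)).toLinearMap ∘ₗ
        (((HMod.of k H A).tensor (Pow k H A (n + 1))).ρ a :
          A ⊗[k] ((Pow k H A n).V ⊗[k] A) →ₗ[k] A ⊗[k] ((Pow k H A n).V ⊗[k] A)))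
      (g := (Pow k H A (n + 2)).ρ a ∘ₗ (front k H A (n + 1)).toLinearMap) ?_
    refine TensorProduct.ext (LinearMap.ext fun v => TensorProduct.ext (LinearMap.ext₂
      fun w b => ?_))
    change (front k H A n).toLinearMap.rTensor A ((TensorProduct.assoc k A (Pow k H A n).V A).symm
      (((HMod.of k H A).tensor ((Pow k H A n).tensor (HMod.of k H A))).ρ a
        (v ⊗ₜ[k] (w ⊗ₜ[k] b) : A ⊗[k] ((Pow k H A n).V ⊗[k] A)))) =
      ((Pow k H A (n + 1)).tensor (HMod.of k H A)).ρ a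
        ((front k H A n).toLinearMap.rTensor A ((v ⊗ₜ[k] w) ⊗ₜ[k] b))
    rw [show (TensorProduct.assoc k A (Pow k H A n).V A).symm _ = _ from
      isHLinear_assoc_symm (HMod.of k H A) (Pow k H A n) (HMod.of k H A) a v w b]
    exact isHLinear_rTensor (HMod.of k H A) (isHLinear_front n) a _

theorem moveFirst_equivariant (X : HMod k H) (a : H) (t : A ⊗[k] X.V) :
    moveFirst k H A X.V (((HMod.of k H A).tensor X).ρ a t) =
      (X.tensor (HMod.of k H A)).adj a (moveFirst k H A X.V t) := by
  revert t
  refine LinearMap.congr_fun (f := moveFirst k H A X.V ∘ₗ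
        (((HMod.of k H A).tensor X).ρ a : A ⊗[k] X.V →ₗ[k] A ⊗[k] X.V))
      (g := ((X.tensor (HMod.of k H A)).adj a : (H →ₗ[k] X.V ⊗[k] A) →ₗ[k] H →ₗ[k] X.V ⊗[k] A) ∘ₗ
        moveFirst k H A X.V) ?_
  refine TensorProduct.ext (LinearMap.ext₂ fun v w => LinearMap.ext fun h => ?_)
  change moveFirst k H A X.V (((HMod.of k H A).tensor X).ρ a (v ⊗ₜ[k] w : A ⊗[k] X.V)) h =
    (X.tensor (HMod.of k H A)).adj a (moveFirst k H A X.V (v ⊗ₜ[k] w)) h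
  rw [HMod.adj_apply, HMod.tensor_ρ]
  have e0 : moveFirst k H A X.V (sw k (fun x y => ((HMod.of k H A).ρ x v ⊗ₜ[k] X.ρ y w :
      A ⊗[k] X.V)) a) h = sw k (fun x y => (X.ρ y w ⊗ₜ[k] (h • x • v) : X.V ⊗[k] A)) a :=
    map_sw ((moveFirst k H A X.V).flip h) _ _
  have e1 : ∀ y x : H, (X.tensor (HMod.of k H A)).ρ y (moveFirst k H A X.V (v ⊗ₜ[k] w) x) =
      sw k (fun y u => (X.ρ y w ⊗ₜ[k] (u • x • v) : X.V ⊗[k] A)) y := fun y x =>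
    HMod.tensor_ρ X (HMod.of k H A) y w (x • v)
  refine e0.trans ?_
  simp only [e1]
  have e2 : sw k (fun p z => sw k (fun x y => sw k (fun y u => (X.ρ y w ⊗ₜ[k]
      (u • (HopfAlgebra.antipode k z * h * x) • v) : X.V ⊗[k] A)) y) p) a =
      sw k (fun p z => sw k (fun q u => sw k (fun x y => (X.ρ y w ⊗ₜ[k]
      ((u * HopfAlgebra.antipode k z) • (h * x) • v) : X.V ⊗[k] A)) q) p) a := by
    congr 1; ext p z
    rw [sw_assoc]
    · simp only [mul_smul]
    all_goals intros; constructor <;> intros <;> simp [add_smul, add_mul, mul_add, tmul_add, add_tmul, ← smul_tmul', hsmul_smul]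
  rw [e2, sw_assoc]
  · have e3 : ∀ q s : H, sw k (fun u z => sw k (fun x y => (X.ρ y w ⊗ₜ[k]
        ((u * HopfAlgebra.antipode k z) • (h * x) • v) : X.V ⊗[k] A)) q) s =
        counit (R := k) s • sw k (fun x y => (X.ρ y w ⊗ₜ[k] ((h * x) • v) : X.V ⊗[k] A)) q := by
      intro q s
      rw [sw_comm, ← sw_smul]
      congr 1; ext x y
      rw [sw_mul_antipode (fun t => (X.ρ y w ⊗ₜ[k] (t • (h * x) • v) : X.V ⊗[k] A)), one_smul]
      constructor <;> intros <;> simp [add_smul, tmul_add]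
    simp only [e3]
    rw [sw_counit_right (fun q => sw k (fun x y => (X.ρ y w ⊗ₜ[k] ((h * x) • v) : X.V ⊗[k] A)) q)]
    · simp only [mul_smul]
    · apply sw_isLinear
      all_goals intros; constructor <;> intros <;> simp [mul_add, add_smul, tmul_add, add_tmul, ← smul_tmul', hsmul_smul]
  · intros; apply sw_isLinear
    all_goals intros; constructor <;> intros <;> simp [mul_add, add_mul, add_smul, tmul_add, add_tmul, ← smul_tmul', hsmul_smul]
  all_goals intros; constructor <;> intros <;>
      simp [sw, add_mul, mul_add, add_smul, tmul_add, Finset.sum_add_distrib, Finset.smul_sum]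

theorem isHLinear_rot (n : ℕ) : HMod.IsHLinear (V := Pow k H A (n + 1))
    (W := (AYD.Tr (Pow k H A (n + 1))).toHMod) (rot k H A n) := by
  intro a x
  have e : (front k H A n).symm ((Pow k H A (n + 1)).ρ a x) =
      ((HMod.of k H A).tensor (Pow k H A n)).ρ a ((front k H A n).symm x) := by
    rw [LinearEquiv.symm_apply_eq]
    refine Eq.trans ?_ (isHLinear_front n a _).symm
    simp
  exact (congrArg (moveFirst k H A (Pow k H A n).V) e).trans (moveFirst_equivariant _ a _)

/-- The cyclic generator `τ : Tr(A^{⊗ (n + 1)}) → Tr(A^{⊗ (n + 1)})`. If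
`φ(h) = a₀ ⊗ ⋯ ⊗ aₙ`, where the `aᵢ` depend on `h`, then
`τ(φ)(h) = a₁ ⊗ ⋯ ⊗ aₙ ⊗ h₂ a₀`, where the `aᵢ` are those of `h₁`. -/
noncomputable def tau (k H A : Type u) [Field k] [Ring H] [HopfAlgebra k H] [Ring A]
    [Algebra k A] [Module H A] [IsScalarTower k H A] (n : ℕ) :
    AYD.Tr (Pow k H A (n + 1)) ⟶ AYD.Tr (Pow k H A (n + 1)) :=
  AYD.extend (rot k H A n) (isHLinear_rot n)

theorem tau_apply (n : ℕ) (φ : H →ₗ[k] (Pow k H A (n + 1)).V) (h : H) :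
    (show H →ₗ[k] (Pow k H A (n + 1)).V from AYD.Hom.lin (tau k H A n) φ) h = sw k (fun x y => rot k H A n (φ x) y) h :=
  AYD.coassocMap_apply _ _ _

end Rotation

section TauPow

variable {A : Type u} [Ring A] [Algebra k A] [Module H A] [IsScalarTower k H A]

variable (k H) in
/-- The map `c₀ ⊗ ⋯ ⊗ c_{j-1} ↦ a_j ⊗ ⋯ ⊗ a_{N-1} ⊗ c₀ ⊗ ⋯ ⊗ c_{j-1}`. -/
noncomputable def fill : (N j : ℕ) → (a : ℕ → A) → (Pow k H A j).V →ₗ[k] (Pow k H A N).V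
  | N, 0, a => LinearMap.toSpanSingleton k _ (pureTensor k H a N)
  | 0, _ + 1, _ => 0
  | N + 1, j + 1, a => (fill N j fun i => a (i + 1)).rTensor A

theorem fill_pure (c : ℕ → A) : ∀ (N j : ℕ) (a : ℕ → A), j ≤ N →
    fill k H N j a (pureTensor k H c j) =
      pureTensor k H (fun i => if i + j < N then a (i + j) else c (i + j - N)) N
  | N, 0, a, _ => by
    have : fill k H N 0 a = LinearMap.toSpanSingleton k _ (pureTensor k H a N) := by cases N <;> rfl
    rw [this]
    refine (one_smul k _).trans (pure_congr fun i hi => ?_)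
    simp [hi]
  | 0, j + 1, a, h => by omega
  | N + 1, j + 1, a, h => by
    have := fill_pure c N j (fun i => a (i + 1)) (by omega)
    change (fill k H N j (fun i => a (i + 1)) (pureTensor k H c j) ⊗ₜ[k] c j : (Pow k H A N).V ⊗[k] A) = _
    rw [this]
    conv_rhs => rw [pureTensor]
    rw [if_neg (by omega), show N + (j + 1) - (N + 1) = j by omega]
    congr 1
    refine pure_congr fun i hi => ?_
    split_ifs <;> first | omega | (congr 1 <;> omega)

theorem pow_ρ_succ (h : H) (a : ℕ → A) (j : ℕ) :
    (Pow k H A (j + 1)).ρ h (pureTensor k H a (j + 1)) = sw k (fun x y =>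
      ((Pow k H A j).ρ x (pureTensor k H a j) ⊗ₜ[k] (y • a j) : (Pow k H A j).V ⊗[k] A)) h :=
  HMod.tensor_ρ _ _ _ _ _

/-- One step of the rotation of a filled tensor. -/
theorem rot_fill (N j : ℕ) (a : ℕ → A) (hj : j ≤ N) (x : (Pow k H A j).V) (h : H) :
    rot k H A N (fill k H (N + 1) j a x) h =
      fill k H (N + 1) (j + 1) a (x ⊗ₜ[k] (h • a j) : (Pow k H A j).V ⊗[k] A) := by
  revert x
  suffices e : (rot k H A N).flip h ∘ₗ fill k H (N + 1) j a = fill k H (N + 1) (j + 1) a ∘ₗ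
      (TensorProduct.mk k (Pow k H A j).V A).flip (h • a j) from fun x => LinearMap.congr_fun e x
  refine pow_ext fun c => ?_
  have e : (TensorProduct.mk k (Pow k H A j).V A).flip (h • a j) (pureTensor k H c j) =
      pureTensor k H (fun i => if i < j then c i else h • a j) (j + 1) := by
    change _ = (pureTensor k H (fun i => if i < j then c i else h • a j) j ⊗ₜ[k] _ :
      (Pow k H A j).V ⊗[k] A)
    rw [pure_congr (b := c) fun i hi => if_pos hi]
    simp only [lt_irrefl, if_false]
    rfl
  simp only [LinearMap.comp_apply, LinearMap.flip_apply]
  rw [fill_pure _ _ _ _ (by omega), rot_pure]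
  refine Eq.trans ?_ (congrArg (fill k H (N + 1) (j + 1) a) e.symm)
  rw [fill_pure _ _ _ _ (by omega)]
  refine pure_congr fun i hi => ?_
  split_ifs <;> first | omega | (congr 1 <;> omega) | (congr 2 <;> omega)

variable (k H A) in
/-- The iterates of the rotation. -/
noncomputable def rotIter (n : ℕ) : ℕ → (Pow k H A (n + 1)).V → H → (Pow k H A (n + 1)).V
  | 0, x, h => counit (R := k) h • x
  | j + 1, x, h => sw k (fun u v => rot k H A n (rotIter n j x u) v) h

theorem rotIter_isLinear (n : ℕ) : ∀ (j : ℕ) (x : (Pow k H A (n + 1)).V),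
    IsLinearMap k (rotIter k H A n j x)
  | 0, x => by constructor <;> intros <;> simp [rotIter, add_smul, mul_smul]
  | j + 1, x => by
    have := rotIter_isLinear n j x
    refine sw_isLinear (f := fun u v => rot k H A n (rotIter k H A n j x u) v) ?_ ?_
    · intros; constructor <;> intros <;> simp [this.map_add, this.map_smul]
    · intros; constructor <;> intros <;> simp

theorem rotIter_isLinear' (n : ℕ) : ∀ (j : ℕ) (h : H),
    IsLinearMap k (fun x => rotIter k H A n j x h)
  | 0, h => ⟨fun _ _ => smul_add _ _ _, fun _ _ => smul_comm _ _ _⟩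
  | j + 1, h => by
    have := rotIter_isLinear' n j
    constructor <;> intros <;> simp [rotIter, (this _).map_add, (this _).map_smul, sw,
      Finset.sum_add_distrib, Finset.smul_sum]

theorem rotIter_pure (a : ℕ → A) (n : ℕ) : ∀ (j : ℕ), j ≤ n + 1 → ∀ h : H,
    rotIter k H A n j (pureTensor k H a (n + 1)) h =
      fill k H (n + 1) j a ((Pow k H A j).ρ h (pureTensor k H a j))
  | 0, _, h => by
    change _ = ((counit (R := k) h * 1) • pureTensor k H a (n + 1) : (Pow k H A (n + 1)).V)
    rw [mul_one]
    rfl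
  | j + 1, hj, h => by
    rw [pow_ρ_succ]
    refine Eq.trans ?_ (map_sw (fill k H (n + 1) (j + 1) a) _ _).symm
    rw [rotIter]
    congr 1; ext x y
    rw [rotIter_pure a n j (by omega), rot_fill _ _ _ (by omega)]

theorem rotIter_top (n : ℕ) (x : (Pow k H A (n + 1)).V) (h : H) :
    rotIter k H A n (n + 1) x h = (Pow k H A (n + 1)).ρ h x := by
  refine LinearMap.congr_fun (f := (rotIter_isLinear' n (n + 1) h).mk')
    (g := (Pow k H A (n + 1)).ρ h) (pow_ext fun a => ?_) x
  refine (rotIter_pure a n (n + 1) le_rfl h).trans ?_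
  have : fill k H (n + 1) (n + 1) a = LinearMap.id := pow_ext fun c => by
    rw [fill_pure _ _ _ _ le_rfl]
    exact pure_congr fun i _ => by rw [if_neg (by omega)]; congr 1; omega
  rw [this]
  rfl

theorem tau_pow_apply (n : ℕ) : ∀ (j : ℕ) (φ : H →ₗ[k] (Pow k H A (n + 1)).V) (h : H),
    (show H →ₗ[k] (Pow k H A (n + 1)).V from AYD.Hom.lin ((show End _ from tau k H A n) ^ j) φ) h =
      sw k (fun x y => rotIter k H A n j (φ x) y) h
  | 0, φ, h => by
    change φ h = sw k (fun x y => counit (R := k) y • φ x) h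
    exact (sw_counit_right φ ⟨by simp, by simp⟩ h).symm
  | j + 1, φ, h => by
    have ih := tau_pow_apply n j φ
    rw [pow_succ']
    refine (tau_apply n _ h).trans ?_
    have := rotIter_isLinear (k := k) (H := H) (A := A) n j
    have := rotIter_isLinear' (k := k) (H := H) (A := A) n j
    have e : ∀ x y, rot k H A n ((show H →ₗ[k] (Pow k H A (n + 1)).V from
        AYD.Hom.lin ((show End _ from tau k H A n) ^ j) φ) x) y =
        sw k (fun u v => rot k H A n (rotIter k H A n j (φ u) v) y) x := by
      intro x y
      rw [ih]
      exact map_sw ((rot k H A n).flip y) _ _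
    refine (congrArg (sw k · h) (funext₂ e)).trans ?_
    rw [sw_assoc]
    · rfl
    all_goals intros; constructor <;> intros <;>
      simp [(rotIter_isLinear' _ _ _).map_add, (rotIter_isLinear' _ _ _).map_smul,
        (rotIter_isLinear _ _ _).map_add, (rotIter_isLinear _ _ _).map_smul]

theorem tau_pow_succ (n : ℕ) (φ : H →ₗ[k] (Pow k H A (n + 1)).V) :
    AYD.Hom.lin ((show End _ from tau k H A n) ^ (n + 1)) φ =
      (AYD.Tr (Pow k H A (n + 1))).sigma φ := by
  refine Eq.trans ?_ (AYD.sigma_Tr _ _).symm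
  refine LinearMap.ext fun h => (tau_pow_apply n (n + 1) φ h).trans ?_
  rw [AYD.coassocMap_apply]
  simp only [rotIter_top]
  rfl

end TauPow

/-- Every morphism commutes with `ς`. -/
theorem AYD.sigma_naturality {M N : AYD k H} (f : M ⟶ N) (x : M.V) :
    N.sigma (AYD.Hom.lin f x) = AYD.Hom.lin f (M.sigma x) := by
  refine (congrArg N.α ?_).trans (f.2.2 _).symm
  exact LinearMap.ext fun h => (f.2.1 h x).symm

open CochainComplex.HomComplex

/-- Mixed anti-Yetter-Drinfeld contramodules: a cochain complex of anti-Yetter-Drinfeld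
contramodules with a differential `h` of degree `-1` such that `d h + h d = 1 - ς`. -/
structure MixedAYD (k H : Type u) [Field k] [Ring H] [HopfAlgebra k H] where
  cx : CochainComplex (AYD k H) ℤ
  h : Cochain cx cx (-1)
  h_comp_h : h.comp h (show (-1 : ℤ) + -1 = -2 by norm_num) = 0
  homotopy (i : ℤ) (x : (cx.X i).V) :
    AYD.Hom.lin (h.v i (i - 1) rfl ≫ cx.d (i - 1) i +
      cx.d i (i + 1) ≫ h.v (i + 1) i (by omega)) x = x - (cx.X i).sigma x

namespace MixedAYD

/-- Morphisms of mixed anti-Yetter-Drinfeld contramodules are the maps of complexes that commute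
with the homotopies. -/
instance : Category (MixedAYD k H) where
  Hom X Y := {f : X.cx ⟶ Y.cx //
    ∀ (p q : ℤ) (hpq : p + -1 = q), f.f p ≫ Y.h.v p q hpq = X.h.v p q hpq ≫ f.f q}
  id X := ⟨𝟙 _, fun p q hpq => by simp⟩
  comp f g := ⟨f.1 ≫ g.1, fun p q hpq => by
    rw [HomologicalComplex.comp_f, HomologicalComplex.comp_f, Category.assoc, g.2 p q hpq,
      ← Category.assoc, f.2 p q hpq, Category.assoc]⟩

section OfNonpos

variable (X : ℕ → AYD k H)

/-- The graded object with `X n` in degree `-n`, and zero in the positive degrees. -/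
def obj : ℤ → AYD k H
  | .ofNat 0 => X 0
  | .ofNat (_ + 1) => AYD.zero k H
  | .negSucc n => X (n + 1)

variable {X}

/-- The graded morphism with the given components. -/
def map (f : ∀ m n, X m ⟶ X n) : ∀ i j : ℤ, obj X i ⟶ obj X j
  | .ofNat 0, .ofNat 0 => f 0 0
  | .ofNat 0, .negSucc n => f 0 (n + 1)
  | .negSucc m, .ofNat 0 => f (m + 1) 0
  | .negSucc m, .negSucc n => f (m + 1) (n + 1)
  | .ofNat (_ + 1), _ => 0
  | .ofNat 0, .ofNat (_ + 1) => 0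
  | .negSucc _, .ofNat (_ + 1) => 0

/-- The components of `b`. -/
def down (b : ∀ n, X (n + 1) ⟶ X n) (m n : ℕ) : X m ⟶ X n :=
  if h : n + 1 = m then eqToHom (by rw [h]) ≫ b n else 0

/-- The components of `B`. -/
def up (B : ∀ n, X n ⟶ X (n + 1)) (m n : ℕ) : X m ⟶ X n :=
  if h : m + 1 = n then B m ≫ eqToHom (by rw [h]) else 0

@[simp] theorem down_self (b : ∀ n, X (n + 1) ⟶ X n) (n : ℕ) : down b (n + 1) n = b n := by
  simp [down]

@[simp] theorem up_self (B : ∀ n, X n ⟶ X (n + 1)) (n : ℕ) : up B n (n + 1) = B n := by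
  simp [up]

theorem down_of_ne (b : ∀ n, X (n + 1) ⟶ X n) {m n : ℕ} (h : n + 1 ≠ m) : down b m n = 0 :=
  dif_neg h

theorem map_down_shape (b : ∀ n, X (n + 1) ⟶ X n) :
    ∀ i j : ℤ, i + 1 ≠ j → map (down b) i j = 0 := by
  rintro ((_ | i) | i) ((_ | j) | j) hij <;> (try simp only [Int.ofNat_eq_natCast] at hij) <;>
    first | (exact down_of_ne b (by omega)) | rfl

theorem map_down_comp (b : ∀ n, X (n + 1) ⟶ X n) (hb : ∀ n, b (n + 1) ≫ b n = 0) :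
    ∀ i j l : ℤ, i + 1 = j → j + 1 = l → map (down b) i j ≫ map (down b) j l = 0 := by
  rintro ((_ | i) | i) ((_ | j) | j) ((_ | l) | l) hij hjl <;>
    (try simp only [Int.ofNat_eq_natCast] at hij hjl) <;>
    first
    | omega
    | (exact Limits.zero_comp)
    | (exact Limits.comp_zero)
    | skip
  · obtain rfl : j = 0 := by omega
    obtain rfl : i = 1 := by omega
    change down b 2 1 ≫ down b 1 0 = 0
    rw [down_self, down_self, hb]
  · obtain rfl : j = l + 1 := by omega
    obtain rfl : i = l + 2 := by omega
    change down b (l + 3) (l + 2) ≫ down b (l + 2) (l + 1) = 0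
    rw [down_self, down_self, hb]

theorem map_up_comp (B : ∀ n, X n ⟶ X (n + 1)) (hB : ∀ n, B n ≫ B (n + 1) = 0) :
    ∀ i j l : ℤ, i + -1 = j → j + -1 = l → map (up B) i j ≫ map (up B) j l = 0 := by
  rintro ((_ | i) | i) ((_ | j) | j) ((_ | l) | l) hij hjl <;>
    (try simp only [Int.ofNat_eq_natCast] at hij hjl) <;>
    first
    | omega
    | (exact Limits.zero_comp)
    | (exact Limits.comp_zero)
    | skip
  · obtain rfl : j = 0 := by omega
    obtain rfl : l = 1 := by omega
    change up B 0 1 ≫ up B 1 2 = 0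
    rw [up_self, up_self, hB]
  · obtain rfl : j = i + 1 := by omega
    obtain rfl : l = i + 2 := by omega
    change up B (i + 1) (i + 2) ≫ up B (i + 2) (i + 3) = 0
    rw [up_self, up_self, hB]

/-- The complex with `X n` in degree `-n`, for `n ≥ 0`, and differential `b`. -/
def nonposComplex (b : ∀ n, X (n + 1) ⟶ X n) (hb : ∀ n, b (n + 1) ≫ b n = 0) :
    CochainComplex (AYD k H) ℤ where
  X := obj X
  d := map (down b)
  shape := map_down_shape b
  d_comp_d' := map_down_comp b hb

/-- The mixed contramodule with `X n` in degree `-n`, for `n ≥ 0`, differential `b` and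
homotopy `B`. -/
def ofNonpos (b : ∀ n, X (n + 1) ⟶ X n) (B : ∀ n, X n ⟶ X (n + 1))
    (hb : ∀ n, b (n + 1) ≫ b n = 0) (hB : ∀ n, B n ≫ B (n + 1) = 0)
    (h₀ : ∀ x, AYD.Hom.lin (B 0 ≫ b 0) x = x - (X 0).sigma x)
    (h₁ : ∀ n x, AYD.Hom.lin (b n ≫ B n + B (n + 1) ≫ b (n + 1)) x =
      x - (X (n + 1)).sigma x) : MixedAYD k H where
  cx := nonposComplex b hb
  h := Cochain.mk fun p q _ => map (up B) p q
  h_comp_h := by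
    refine Cochain.ext _ _ fun p q hpq => ?_
    rw [Cochain.comp_v _ _ _ p (p + -1) q rfl (by omega)]
    exact map_up_comp B hB p (p + -1) q rfl (by omega)
  homotopy i x := by
    rcases i with ((_ | i) | i)
    · have e : (up B 0 1 ≫ down b 1 0 + 0 : X 0 ⟶ X 0) = B 0 ≫ b 0 := by
        rw [up_self, down_self, add_zero]
      exact (congrArg (AYD.Hom.lin · x) e).trans (h₀ x)
    · exact Subsingleton.elim (α := PUnit) _ _
    · have e : (up B (i + 1) (i + 2) ≫ down b (i + 2) (i + 1) + down b (i + 1) i ≫ up B i (i + 1) :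
          X (i + 1) ⟶ X (i + 1)) = b i ≫ B i + B (i + 1) ≫ b (i + 1) := by
        rw [up_self, down_self, up_self, down_self, add_comm (b i ≫ _)]
      cases i <;> exact (congrArg (AYD.Hom.lin · x) e).trans (h₁ _ x)

end OfNonpos

/-- A stable anti-Yetter-Drinfeld contramodule as a mixed one, concentrated in degree `0`. -/
def single (M : AYD k H) (hM : M.IsStable) : MixedAYD k H :=
  ofNonpos (X := fun n => Nat.casesOn n M fun _ => AYD.zero k H) (fun _ => 0) (fun _ => 0)
    (fun _ => Limits.comp_zero) (fun _ => Limits.comp_zero)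
    (fun x => by
      have := hM x
      simp [this])
    (fun n x => Subsingleton.elim (α := PUnit) _ _)

end MixedAYD

section ChernCharacter

variable {A : Type u} [Ring A] [Algebra k A] [Module H A] [IsScalarTower k H A]

/-- The paracyclic object `Tr(A^{⊗ (• + 1)})`. -/
noncomputable def trPow (hA : IsModuleAlgebra k H A) : Paracyclic (AYD k H) where
  X n := AYD.Tr (Pow k H A (n + 1))
  d n i := AYD.TrMap (mulAt k H A n i) (isHLinear_mulAt hA n i)
  τ n := tau k H A n
  s n := AYD.TrMap (unitLast k H A (n + 1)) (isHLinear_unitLast hA (n + 1))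
  d_comp_d n i j hij hj := AYD.hom_ext fun (φ : H →ₗ[k] _) => LinearMap.ext fun h =>
    mulAt_mulAt n i j hij hj (φ h)
  τ_comp_d n i hi := by
    refine AYD.hom_ext fun (φ : H →ₗ[k] (Pow k H A (n + 2)).V) => LinearMap.ext fun h => ?_
    refine (congrArg (mulAt k H A n (i + 1)) (tau_apply (n + 1) φ h)).trans ?_
    refine (map_sw _ _ _).trans (Eq.trans ?_ (tau_apply n (mulAt k H A n i ∘ₗ φ) h).symm)
    simp only [mulAt_rot n i hi]
    rfl
  τ_comp_τ_comp_d n := by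
    refine AYD.hom_ext fun (φ : H →ₗ[k] (Pow k H A (n + 2)).V) => LinearMap.ext fun h => ?_
    refine (congrArg (mulAt k H A n 0) (tau_apply (n + 1) _ h)).trans ?_
    refine (map_sw _ _ _).trans (Eq.trans ?_ (tau_apply n (mulAt k H A n n ∘ₗ φ) h).symm)
    have e : ∀ x y, mulAt k H A n 0 (rot k H A (n + 1)
        ((show H →ₗ[k] (Pow k H A (n + 2)).V from AYD.Hom.lin (tau k H A (n + 1)) φ) x) y) =
        sw k (fun u v => mulAt k H A n 0 (rot k H A (n + 1) (rot k H A (n + 1) (φ u) v) y)) x := by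
      intro x y
      rw [tau_apply]
      exact map_sw (mulAt k H A n 0 ∘ₗ (rot k H A (n + 1)).flip y) _ _
    refine (congrArg (sw k · h) (funext₂ e)).trans ?_
    rw [sw_assoc (fun u v y => mulAt k H A n 0 (rot k H A (n + 1) (rot k H A (n + 1) (φ u) v) y))]
    · simp only [sw_rot_rot hA]
      rfl
    all_goals intros; constructor <;> intros <;> simp
  s_comp_d n := AYD.hom_ext fun (φ : H →ₗ[k] _) => LinearMap.ext fun h => unitLast_mulAt_zero n (φ h)
  s_comp_d_succ n i _ := AYD.hom_ext fun (φ : H →ₗ[k] _) => LinearMap.ext fun h =>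
    unitLast_mulAt_succ n i (φ h)

theorem trPow_iter (hA : IsModuleAlgebra k H A) (n : ℕ) (x : ((trPow hA).X n).V) :
    AYD.Hom.lin (iter ((trPow hA).τ n) (n + 1)) x = ((trPow hA).X n).sigma x :=
  tau_pow_succ n x

/-- The Chern character `ch(A) = (Tr(A^{⊗ (- • + 1)}), b, B)`. -/
noncomputable def ch (hA : IsModuleAlgebra k H A) : MixedAYD k H :=
  MixedAYD.ofNonpos (trPow hA).b (trPow hA).B (trPow hA).b_comp_b
    ((trPow hA).B_comp_B fun n f => AYD.hom_ext fun x => by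
      rw [AYD.lin_comp, AYD.lin_comp, LinearMap.comp_apply, LinearMap.comp_apply, trPow_iter,
        trPow_iter, AYD.sigma_naturality])
    (fun x => by
      rw [Paracyclic.B_comp_b_zero, AYD.lin_sub, LinearMap.sub_apply, trPow_iter]
      rfl)
    (fun n x => by
      rw [Paracyclic.b_comp_B_add, AYD.lin_sub, LinearMap.sub_apply, trPow_iter]
      rfl)

end ChernCharacter

namespace MixedAYD

section DerivedHom

variable (X Y : MixedAYD k H)

/-- The degree `n` part of the complex of maps from `X` to `Y`: the cochains that commute
with the homotopies in the graded sense. -/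
def dgHom (n : ℤ) : Submodule k (Cochain X.cx Y.cx n) where
  carrier := {f | f.comp Y.h (show n + -1 = n - 1 by ring) =
    n.negOnePow • X.h.comp f (show -1 + n = n - 1 by ring)}
  add_mem' := by
    rintro f g hf hg
    simp only [Set.mem_ofPred_eq] at hf hg ⊢
    rw [Cochain.add_comp, Cochain.comp_add, hf, hg, smul_add]
  zero_mem' := by simp
  smul_mem' := by
    rintro c f hf
    simp only [Set.mem_ofPred_eq] at hf ⊢
    rw [Cochain.smul_comp, Cochain.comp_smul, hf, smul_comm]

/-- The cocycles of the complex of maps from `X` to `Y`, with the differential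
`f ↦ d ∘ f - (-1) ^ n f ∘ d`. -/
def homCocycles (n : ℤ) : Submodule k (Cochain X.cx Y.cx n) :=
  X.dgHom Y n ⊓ LinearMap.ker (δ_hom k X.cx Y.cx n (n + 1))

/-- The coboundaries. -/
def homCoboundaries (n : ℤ) : Submodule k (Cochain X.cx Y.cx n) :=
  (X.dgHom Y (n - 1)).map (δ_hom k X.cx Y.cx (n - 1) n)

/-- The cohomology of the complex of maps from `X` to `Y`. -/
abbrev HomCohomology (n : ℤ) : Type u :=
  X.homCocycles Y n ⧸ (X.homCoboundaries Y n).submoduleOf (X.homCocycles Y n)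

/-- The underlying complex of vector spaces. -/
noncomputable abbrev underlying : CochainComplex (ModuleCat.{u} k) ℤ :=
  ((AYD.forget k H).mapHomologicalComplex (ComplexShape.up ℤ)).obj X.cx

/-- `X` is acyclic. -/
def IsAcyclic : Prop := X.underlying.Acyclic

/-- `X` is K-projective: every complex of maps from `X` to an acyclic object is acyclic. -/
def IsKProjective : Prop :=
  ∀ N : MixedAYD k H, N.IsAcyclic → ∀ n, Subsingleton (X.HomCohomology N n)

variable {X Y}

/-- A morphism that induces isomorphisms in cohomology. -/
def IsQuasiIso (f : X ⟶ Y) : Prop :=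
  QuasiIso (((AYD.forget k H).mapHomologicalComplex (ComplexShape.up ℤ)).map
    (Subtype.val (p := fun f : X.cx ⟶ Y.cx => ∀ (p q : ℤ) (hpq : p + -1 = q),
      f.f p ≫ Y.h.v p q hpq = X.h.v p q hpq ≫ f.f q) f))

end DerivedHom

end MixedAYD

section Tsygan

variable {C : ℕ → Type u} [∀ n, AddCommGroup (C n)] [∀ n, Module k (C n)]

/-- The degree `n` part of the total complex of the cyclic bicomplex, which has `C q` in the
bidegree `(p, q)` for all `p, q ≥ 0`. -/
abbrev Tot (C : ℕ → Type u) (n : ℤ) : Type u :=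
  ∀ x : {x : ℕ × ℕ // (x.1 : ℤ) + x.2 = n}, C x.1.2

/-- The cyclic bicomplex of a cocyclic vector space with cofaces `δ n i : C n → C (n + 1)`, for
`i ≤ n + 1`, and cyclic operators `τ n : C n → C n`. -/
structure CyclicData (k : Type u) [Field k] (C : ℕ → Type u) [∀ n, AddCommGroup (C n)]
    [∀ n, Module k (C n)] where
  δ (n i : ℕ) : C n →ₗ[k] C (n + 1)
  τ (n : ℕ) : Module.End k (C n)

namespace CyclicData

variable (P : CyclicData k C)

/-- The signed cyclic operator `t = (-1) ^ n τ`. -/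
def t (n : ℕ) : Module.End k (C n) := (-1 : ℤ) ^ n • P.τ n

/-- The norm `N = 1 + t + ⋯ + t ^ n`. -/
def N (n : ℕ) : Module.End k (C n) := ∑ i ∈ Finset.range (n + 1), P.t n ^ i

/-- The Hochschild differential `b`, the alternating sum of all the cofaces. -/
def b (n : ℕ) : C n →ₗ[k] C (n + 1) := ∑ i ∈ Finset.range (n + 2), (-1 : ℤ) ^ i • P.δ n i

/-- The alternating sum of all the cofaces but the last one. -/
def b' (n : ℕ) : C n →ₗ[k] C (n + 1) := ∑ i ∈ Finset.range (n + 1), (-1 : ℤ) ^ i • P.δ n i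

/-- The vertical differentials: `b` in the even columns and `-b'` in the odd columns. -/
def vert {n m : ℤ} (h : n + 1 = m) :
    (x : {x : ℕ × ℕ // (x.1 : ℤ) + x.2 = m}) → Tot C n →ₗ[k] C x.1.2
  | ⟨(_, 0), _⟩ => 0
  | ⟨(p, q + 1), hx⟩ => (if Even p then P.b q else -P.b' q) ∘ₗ
      LinearMap.proj (φ := fun x : {x : ℕ × ℕ // (x.1 : ℤ) + x.2 = n} => C x.1.2)
        ⟨(p, q), by push_cast at hx; dsimp only; omega⟩

/-- The horizontal differentials: `1 - t` from the even columns and `N` from the odd columns. -/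
def horiz {n m : ℤ} (h : n + 1 = m) :
    (x : {x : ℕ × ℕ // (x.1 : ℤ) + x.2 = m}) → Tot C n →ₗ[k] C x.1.2
  | ⟨(0, _), _⟩ => 0
  | ⟨(p + 1, q), hx⟩ => (if Even p then 1 - P.t q else P.N q) ∘ₗ
      LinearMap.proj (φ := fun x : {x : ℕ × ℕ // (x.1 : ℤ) + x.2 = n} => C x.1.2)
        ⟨(p, q), by push_cast at hx; dsimp only; omega⟩

/-- The differential of the total complex. -/
def D {n m : ℤ} (h : n + 1 = m) : Tot C n →ₗ[k] Tot C m :=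
  LinearMap.pi fun x => P.vert h x + P.horiz h x

/-- Cyclic cohomology: the cohomology of the total complex of the cyclic bicomplex. -/
abbrev HC (n : ℤ) : Type u :=
  LinearMap.ker (P.D (n := n) rfl) ⧸
    (LinearMap.range (P.D (show n - 1 + 1 = n by ring))).submoduleOf (LinearMap.ker (P.D rfl))

end CyclicData

end Tsygan

section HopfCyclicCohomology

/-- The inverse of the antipode. -/
noncomputable def antipodeInv
    (hS : Function.Bijective (HopfAlgebra.antipode k : H →ₗ[k] H)) : H →ₗ[k] H :=
  (LinearEquiv.ofBijective _ hS).symm.toLinearMap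

variable (hS : Function.Bijective (HopfAlgebra.antipode k : H →ₗ[k] H))

theorem antipode_antipodeInv (a : H) : HopfAlgebra.antipode k (antipodeInv hS a) = a :=
  (LinearEquiv.ofBijective _ hS).apply_symm_apply a

theorem antipodeInv_antipode (a : H) : antipodeInv hS (HopfAlgebra.antipode k a) = a :=
  (LinearEquiv.ofBijective _ hS).symm_apply_apply a

theorem antipodeInv_mul (a b : H) : antipodeInv hS (a * b) = antipodeInv hS b * antipodeInv hS a :=
  hS.injective (by
    rw [HopfAlgebra.antipode_mul_antidistrib]
    simp only [antipode_antipodeInv])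

theorem sw_mul_antipodeInv {X : Type*} [AddCommGroup X] [Module k X] (f : H → X)
    (h : IsLinearMap k f) (a : H) :
    sw k (fun x y => f (y * antipodeInv hS x)) a = counit (R := k) a • f 1 := by
  have := sw_mul_antipode (fun x => f (antipodeInv hS x))
    ⟨fun x y => by rw [map_add, h.map_add], fun c x => by rw [map_smul, h.map_smul]⟩ a
  beta_reduce at this
  simp only [antipodeInv_mul, antipodeInv_antipode] at this
  rw [this]
  congr 2
  exact hS.injective (by rw [antipode_antipodeInv, HopfAlgebra.antipode_one])

variable (A : Type u) [Ring A] [Algebra k A] [Module H A] [IsScalarTower k H A]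

/-- The map `a₀ ⊗ ⋯ ⊗ aₙ ↦ (h ↦ S⁻¹(h) aₙ ⊗ a₀ ⊗ ⋯ ⊗ a_{n-1})`. -/
noncomputable def rotBack (n : ℕ) :
    (Pow k H A (n + 1)).V →ₗ[k] H →ₗ[k] (Pow k H A (n + 1)).V :=
  TensorProduct.lift (M := (Pow k H A n).V) (N := A) (LinearMap.mk₂ k
    (fun w v => (front k H A n).toLinearMap ∘ₗ (TensorProduct.mk k A (Pow k H A n).V).flip w ∘ₗ
      (HMod.of k H A).ρ.toLinearMap.flip v ∘ₗ antipodeInv hS)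
    (by intros; ext; simp) (by intros; ext; simp)
    (by intros; ext; simp) (by intros; ext; simp [← smul_tmul']))

theorem rotBack_tmul (n : ℕ) (w : (Pow k H A n).V) (v : A) (h : H) :
    rotBack hS A n (w ⊗ₜ[k] v : (Pow k H A n).V ⊗[k] A) h =
      front k H A n ((antipodeInv hS h • v) ⊗ₜ w) := rfl

theorem isHLinear_rotBack (n : ℕ) : HMod.IsHLinear (V := Pow k H A (n + 1))
    (W := (AYD.Tr (Pow k H A (n + 1))).toHMod) (rotBack hS A n) := by
  refine isHLinear_of_tmul (V := Pow k H A n) (W := HMod.of k H A)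
    (X := (AYD.Tr (Pow k H A (n + 1))).toHMod) fun a w v => LinearMap.ext fun h => ?_
  change rotBack hS A n (((Pow k H A n).tensor (HMod.of k H A)).ρ a
    (w ⊗ₜ[k] v : (Pow k H A n).V ⊗[k] A)) h =
    (Pow k H A (n + 1)).adj a (rotBack hS A n (w ⊗ₜ[k] v : (Pow k H A n).V ⊗[k] A)) h
  rw [HMod.adj_apply, HMod.tensor_ρ]
  have e0 : rotBack hS A n (sw k (fun x y => ((Pow k H A n).ρ x w ⊗ₜ[k] (HMod.of k H A).ρ y v :
      (Pow k H A n).V ⊗[k] A)) a) h = sw k (fun x y =>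
      front k H A n ((antipodeInv hS h • y • v) ⊗ₜ (Pow k H A n).ρ x w)) a :=
    map_sw ((rotBack hS A n).flip h) _ _
  refine e0.trans ?_
  have e1 : ∀ y x : H, (Pow k H A (n + 1)).ρ y
      (rotBack hS A n (w ⊗ₜ[k] v : (Pow k H A n).V ⊗[k] A) x) = sw k (fun y u =>
      front k H A n ((y • antipodeInv hS x • v) ⊗ₜ (Pow k H A n).ρ u w)) y := by
    intro y x
    rw [rotBack_tmul]
    refine (isHLinear_front n y _).symm.trans ?_
    refine (congrArg (front k H A n).toLinearMap (HMod.tensor_ρ (HMod.of k H A) _ y _ w)).trans ?_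
    exact map_sw (front k H A n).toLinearMap _ _
  simp only [e1, antipodeInv_mul, antipodeInv_antipode]
  have e2 : sw k (fun p z => sw k (fun x y => sw k (fun y u => front k H A n
      ((y • (antipodeInv hS x * (antipodeInv hS h * z)) • v) ⊗ₜ (Pow k H A n).ρ u w)) y) p) a =
      sw k (fun p z => sw k (fun q u => sw k (fun x y => front k H A n
      (((y * antipodeInv hS x) • (antipodeInv hS h * z) • v) ⊗ₜ (Pow k H A n).ρ u w)) q) p) a := by
    congr 1; ext p z
    rw [sw_assoc]
    · simp only [mul_smul]
    all_goals intros; constructor <;> intros <;>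
      simp [add_smul, mul_add, add_mul, tmul_add, add_tmul, ← smul_tmul', hsmul_smul]
  rw [e2]
  have e3 : ∀ p z : H, sw k (fun q u => sw k (fun x y => front k H A n
      (((y * antipodeInv hS x) • (antipodeInv hS h * z) • v) ⊗ₜ (Pow k H A n).ρ u w)) q) p =
      front k H A n (((antipodeInv hS h * z) • v) ⊗ₜ (Pow k H A n).ρ p w) := by
    intro p z
    have e4 : ∀ q u : H, sw k (fun x y => front k H A n
      (((y * antipodeInv hS x) • (antipodeInv hS h * z) • v) ⊗ₜ (Pow k H A n).ρ u w)) q =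
      counit (R := k) q •
        front k H A n (((antipodeInv hS h * z) • v) ⊗ₜ (Pow k H A n).ρ u w) := by
      intro q u
      rw [sw_mul_antipodeInv hS (fun t => front k H A n
        ((t • (antipodeInv hS h * z) • v) ⊗ₜ (Pow k H A n).ρ u w)), one_smul]
      constructor <;> intros <;> simp [add_smul, add_tmul, ← smul_tmul']
    simp only [e4]
    rw [sw_counit_left (fun u =>
      front k H A n (((antipodeInv hS h * z) • v) ⊗ₜ (Pow k H A n).ρ u w))]
    constructor <;> intros <;> simp [tmul_add]
  simp only [e3]
  simp only [mul_smul]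

variable (M : AYD k H)

/-- The space `Hom_H(A^{⊗ (n + 1)}, M)`. -/
def HomH (n : ℕ) : Submodule k ((Pow k H A (n + 1)).V →ₗ[k] M.V) where
  carrier := {f | HMod.IsHLinear (W := M.toHMod) f}
  add_mem' hf hg a v := by
    rw [LinearMap.add_apply, hf a v, hg a v, LinearMap.add_apply, map_add]
  zero_mem' a v := by simp
  smul_mem' c f hf a v := by
    rw [LinearMap.smul_apply, hf a v, LinearMap.smul_apply, map_smul]

variable {A}

/-- For `i ≤ n` the coface `(δᵢ f)(a₀, …, a_{n+1}) = f(a₀, …, aᵢ a_{i+1}, …, a_{n+1})`. -/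
noncomputable def coface (hA : IsModuleAlgebra k H A) (n i : ℕ) : HomH A M n →ₗ[k] HomH A M (n + 1) where
  toFun f := ⟨f.1 ∘ₗ mulAt k H A n (n - i), fun a v => by
    rw [LinearMap.comp_apply, isHLinear_mulAt hA n _ a v, f.2 a]; rfl⟩
  map_add' _ _ := rfl
  map_smul' _ _ := rfl

variable (A)

/-- The cyclic operator `(τ f)(a₀, …, aₙ) = α(h ↦ f(S⁻¹(h) aₙ, a₀, …, a_{n-1}))`. -/
noncomputable def cyclicOp (n : ℕ) : HomH A M n →ₗ[k] HomH A M n where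
  toFun f := ⟨M.α ∘ₗ LinearMap.llcomp k H _ M.V f.1 ∘ₗ rotBack hS A n, fun a v =>
    (congrArg M.α ((congrArg (f.1 ∘ₗ ·) (isHLinear_rotBack hS A n a v)).trans
      (AYD.comp_adj (W := M.toHMod) f.2 a _))).trans (M.α_adj a _)⟩
  map_add' f g := by ext v; simp
  map_smul' c f := by ext v; simp

theorem cyclicOp_apply (n : ℕ) (f : HomH A M n) (v : (Pow k H A (n + 1)).V) :
    (cyclicOp hS A M n f).1 v = M.α (f.1 ∘ₗ rotBack hS A n v) := rfl

variable {A}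

/-- The cocyclic vector space `Hom_H(A^{⊗ (• + 1)}, M)` of Hopf-cyclic cohomology. The last
coface is `δ_{n+1} = τ δ₀`. -/
noncomputable def hopfCyclicData (hA : IsModuleAlgebra k H A) :
    CyclicData k (fun n => HomH A M n) where
  δ n i := if i ≤ n then coface M hA n i else cyclicOp hS A M (n + 1) ∘ₗ coface M hA n 0
  τ n := cyclicOp hS A M n

/-- Hopf-cyclic cohomology of the algebra `A` with coefficients in `M`. -/
abbrev HCold (hA : IsModuleAlgebra k H A) (n : ℤ) : Type u := (hopfCyclicData hS M hA).HC n

end HopfCyclicCohomology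

end HopfCyclic

open HopfCyclic

/-!
Write `X_n = Tr(A^{⊗ (n + 1)})` and `κ = 1 - ς`. The cyclic bicomplex of the paracyclic object `X`,
with `b` and `-b'` in its columns and `1 - t` and `N` in its rows, is not a bicomplex: the total
differential `D` on the total object `T` satisfies `D² = κ U`, where `U` is the shift by two
columns, since `N (1 - t) = (1 - t) N = κ`. It is nevertheless the datum that is needed to define a
mixed contramodule `Q = T ⊕ T[1]` with `d(x, y) = (D x + κ y, - U x - D y)` and `h(x, y) = (0, x)`
(`CurvedComplex.free`). As `h` identifies the two summands, a map from `Q` to a mixed object `N` that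
commutes with `h` is determined by its restriction to `T`, which can be any graded map.

* *`Q` is K-projective* (`CurvedComplex.isKProjective_free`). Twisting by `S⁻¹` shows that
  `V ⊗ A` is a projective `H`-module if `A` is (`exists_lift_tensor`), and `Tr` is left adjoint to the
  forgetful functor, so that maps out of the contramodules `X_n` lift along surjections. As `T` is
  bounded above, a primitive of a cocycle with values in an acyclic object is constructed degree by
  degree, from the top degree downwards.
* *`Q` resolves `ch(A)`* (`Paracyclic.isQuasiIso_aug`). The augmentation `Q → ch(A)` is the identity
  on the column `p = 0` of `T`, `(1 - t) s'` on the column `p = 1` of `T`, and `B` on the column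
  `p = 0` of `T[1]`. As a map of complexes it has a section, the inclusion of the column `p = 0`, and
  this is a homotopy inverse: the homotopy `contrX` cancels `T[1]` against the columns `p ≥ 2` of `T`
  by means of the part `- U` of the differential, and contracts the column `p = 1` by `s'`.
* *Maps from `Q` to `M` compute Hopf-cyclic cohomology* (`nonempty_HCold_equiv`). As `h = 0` on `M`,
  these maps are the families of maps `X_q → M`, with the differential dual to `D`, and
  `Hom(X_q, M) = Hom_H(A^{⊗ (q + 1)}, M)`. Under this identification the cyclic operator is inverse
  to the precomposition with `τ` (`cyclicOp_toHomH`) and the cofaces come in reverse order, so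
  that the two bicomplexes agree after twisting the even columns by `t` and inserting signs
  (`toEntry_col`, `toEntry_row`); stability of `M` makes `t` invertible.
* *Independence of the resolution* (`MixedAYD.nonempty_homCohomology_equiv`). The cone of a morphism of
  mixed objects is mixed, so that maps from a K-projective object to a quasi-isomorphism induce
  isomorphisms in cohomology; two K-projective resolutions are therefore homotopy equivalent.
-/

namespace HopfCyclic

open CochainComplex.HomComplex

variable {k H : Type u} [Field k] [Ring H] [HopfAlgebra k H]

/-! ### The additive category of contramodules -/

namespace AYD

theorem lin_neg {M N : AYD k H} (f : M ⟶ N) : Hom.lin (-f) = -Hom.lin f := rfl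

/-- The natural endomorphism `ς` as a morphism of contramodules. -/
noncomputable def sigmaHom (M : AYD k H) : M ⟶ M :=
  ⟨M.sigma, fun a m => by
    have e : M.toHMod.adj a (M.ρ.toLinearMap.flip m) = M.ρ.toLinearMap.flip (M.ρ a m) := by
      ext h
      rw [HMod.adj_apply]
      have e1 : ∀ p z : H, sw k (fun x y => M.ρ y (M.ρ.toLinearMap.flip m
          (HopfAlgebra.antipode k z * h * x))) p =
          sw k (fun x y => M.ρ ((y * HopfAlgebra.antipode k z) * (h * x)) m) p := by
        intro p z
        congr 1; ext x y
        simp [mul_assoc]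
      simp only [e1]
      rw [sw_assoc (fun x y z => M.ρ ((y * HopfAlgebra.antipode k z) * (h * x)) m)]
      · have e2 : ∀ x q : H, sw k (fun y z => M.ρ ((y * HopfAlgebra.antipode k z) * (h * x)) m) q =
            counit (R := k) q • M.ρ (h * x) m := by
          intro x q
          rw [sw_mul_antipode (fun t => M.ρ (t * (h * x)) m), one_mul]
          constructor <;> intros <;> simp [add_mul]
        simp only [e2]
        rw [sw_counit_right (fun x => M.ρ (h * x) m)]
        · simp
        · constructor <;> intros <;> simp [mul_add]
      all_goals intros; constructor <;> intros <;> simp [mul_add, add_mul]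
    exact (congrArg M.α e).symm.trans (M.α_adj a _),
  fun φ => by
    have e1 : M.ρ.toLinearMap.flip (M.α φ) = M.α ∘ₗ M.toHMod.adj.toLinearMap.flip φ :=
      LinearMap.ext fun h => (M.α_adj h φ).symm
    have e2 : M.sigma ∘ₗ φ = M.α ∘ₗ (M.ρ.toLinearMap.flip ∘ₗ φ) := rfl
    rw [e2, M.α_assoc]
    refine (congrArg M.α e1).trans ((M.α_assoc _).trans (congrArg M.α ?_))
    exact sigma_Tr M.toHMod φ⟩

theorem sigmaHom_naturality {M N : AYD k H} (f : M ⟶ N) :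
    f ≫ N.sigmaHom = M.sigmaHom ≫ f :=
  hom_ext fun x => sigma_naturality f x

/-- The direct sum of two contramodules. -/
def prod (M N : AYD k H) : AYD k H where
  V := M.V × N.V
  ρ := AlgHom.ofLinearMap
    { toFun := fun a => (M.ρ a).prodMap (N.ρ a)
      map_add' := fun a b => by ext <;> simp
      map_smul' := fun a b => by ext <;> simp }
    (by ext <;> simp) (fun a b => by ext <;> simp)
  α := (M.α ∘ₗ LinearMap.llcomp k H _ _ (LinearMap.fst k M.V N.V)).prod
    (N.α ∘ₗ LinearMap.llcomp k H _ _ (LinearMap.snd k M.V N.V))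
  α_counit m := Prod.ext (M.α_counit m.1) (N.α_counit m.2)
  α_assoc Φ := Prod.ext
    ((M.α_assoc (LinearMap.llcomp k H _ _ (LinearMap.fst k M.V N.V) ∘ₗ Φ)).trans
      (congrArg M.α (by rw [LinearMap.llcomp_apply', ← LinearMap.comp_assoc]; congr 1; ext; rfl)))
    ((N.α_assoc (LinearMap.llcomp k H _ _ (LinearMap.snd k M.V N.V) ∘ₗ Φ)).trans
      (congrArg N.α (by rw [LinearMap.llcomp_apply', ← LinearMap.comp_assoc]; congr 1; ext; rfl)))
  α_adj a φ := Prod.ext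
    ((congrArg M.α (comp_adj (V := ⟨M.V × N.V, _⟩) (W := M.toHMod) (f := LinearMap.fst k M.V N.V)
      (fun _ _ => rfl) a φ)).trans (M.α_adj a _))
    ((congrArg N.α (comp_adj (V := ⟨M.V × N.V, _⟩) (W := N.toHMod) (f := LinearMap.snd k M.V N.V)
      (fun _ _ => rfl) a φ)).trans (N.α_adj a _))

theorem isZero_of_subsingleton (M : AYD k H) [Subsingleton M.V] : Limits.IsZero M where
  unique_to N := ⟨⟨⟨0⟩, fun f => hom_ext fun x => by
    rw [Subsingleton.elim x 0, map_zero, map_zero]⟩⟩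
  unique_from N := ⟨⟨⟨0⟩, fun f => hom_ext fun x => Subsingleton.elim _ _⟩⟩

theorem isZero_zero : Limits.IsZero (zero k H) :=
  have : Subsingleton (zero k H).V := inferInstanceAs (Subsingleton PUnit)
  isZero_of_subsingleton _

instance : Limits.HasZeroObject (AYD k H) := ⟨zero k H, isZero_zero⟩

instance : Limits.HasBinaryBiproducts (AYD k H) :=
  Limits.HasBinaryBiproducts.mk fun {M N} => by
    let fst : prod M N ⟶ M := ⟨LinearMap.fst k M.V N.V, fun _ _ => rfl, fun _ => rfl⟩
    let snd : prod M N ⟶ N := ⟨LinearMap.snd k M.V N.V, fun _ _ => rfl, fun _ => rfl⟩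
    let inl : M ⟶ prod M N := ⟨LinearMap.inl k M.V N.V, fun a m => Prod.ext rfl (map_zero (N.ρ a)).symm,
      fun φ => Prod.ext rfl (map_zero N.α).symm⟩
    let inr : N ⟶ prod M N := ⟨LinearMap.inr k M.V N.V, fun a m => Prod.ext (map_zero (M.ρ a)).symm rfl,
      fun φ => Prod.ext (map_zero M.α).symm rfl⟩
    exact Limits.HasBinaryBiproduct.mk ⟨Limits.BinaryBicone.mk (prod M N) fst snd inl inr rfl rfl rfl rfl,
        Limits.isBinaryBilimitOfTotal _ (hom_ext fun x =>
          Prod.ext (add_zero (Prod.fst (α := M.V) (β := N.V) x)) (zero_add (Prod.snd (α := M.V) (β := N.V) x)))⟩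

instance : Limits.HasFiniteBiproducts (AYD k H) :=
  have : Limits.HasFiniteProducts (AYD k H) := by
    have : Limits.HasTerminal (AYD k H) := Limits.HasZeroObject.hasTerminal
    exact hasFiniteProducts_of_has_binary_and_terminal
  Limits.HasFiniteBiproducts.of_hasFiniteProducts

end AYD

/-! ### Projective contramodules -/

theorem sw_antipodeInv_mul (hS : Function.Bijective (HopfAlgebra.antipode k : H →ₗ[k] H))
    {X : Type*} [AddCommGroup X] [Module k X] (f : H → X) (h : IsLinearMap k f) (a : H) :
    sw k (fun x y => f (antipodeInv hS y * x)) a = counit (R := k) a • f 1 := by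
  have := sw_antipode_mul (fun x => f (antipodeInv hS x))
    ⟨fun x y => by rw [map_add, h.map_add], fun c x => by rw [map_smul, h.map_smul]⟩ a
  beta_reduce at this
  simp only [antipodeInv_mul, antipodeInv_antipode] at this
  rw [this]
  congr 2
  exact hS.injective (by rw [antipode_antipodeInv, HopfAlgebra.antipode_one])

section TensorLift

variable (hS : Function.Bijective (HopfAlgebra.antipode k : H →ₗ[k] H))
  {A : Type u} [Ring A] [Algebra k A]

/-- For a `k`-linear map `f : V ⊗ A → L` the map
`∑ h b ↦ (v ↦ h₂ f(S⁻¹(h₁) v ⊗ b))` on the free `H`-module on `A`; it is the unique candidate for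
an `H`-linear map on `V ⊗ (A →₀ H)` that agrees with `f` on the elements `v ⊗ 1 b`. -/
noncomputable def freeExtend (V L : HMod k H) (f : V.V ⊗[k] A →ₗ[k] L.V) :
    (A →₀ H) →ₗ[k] V.V →ₗ[k] L.V :=
  Finsupp.lsum k fun b => TensorProduct.lift (LinearMap.mk₂ k
    (fun x y => L.ρ y ∘ₗ f ∘ₗ (TensorProduct.mk k V.V A).flip b ∘ₗ V.ρ (antipodeInv hS x))
    (by intros; ext; simp) (by intros; ext; simp)
    (by intros; ext; simp) (by intros; ext; simp)) ∘ₗ comul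

theorem freeExtend_single (V L : HMod k H) (f : V.V ⊗[k] A →ₗ[k] L.V) (b : A) (h : H) (v : V.V) :
    freeExtend hS V L f (Finsupp.single b h) v =
      sw k (fun x y => L.ρ y (f (V.ρ (antipodeInv hS x) v ⊗ₜ b))) h := by
  rw [freeExtend, Finsupp.lsum_single, LinearMap.comp_apply, lift_comul]
  exact map_sw (LinearMap.applyₗ v) _ _

theorem freeExtend_smul (V L : HMod k H) (f : V.V ⊗[k] A →ₗ[k] L.V) (F : A →₀ H) (g : H)
    (v : V.V) :
    sw k (fun x y => freeExtend hS V L f (y • F) (V.ρ x v)) g =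
      L.ρ g (freeExtend hS V L f F v) := by
  induction F using Finsupp.induction_linear with
  | zero => simp [sw]
  | add F F' hF hF' =>
    simp only [smul_add, map_add, LinearMap.add_apply, sw_add, hF, hF']
  | single b h =>
    simp only [Finsupp.smul_single, freeExtend_single, smul_eq_mul, map_sw]
    have e1 : ∀ p q : H, sw k (fun x y => L.ρ y (f (V.ρ (antipodeInv hS x) (V.ρ p v) ⊗ₜ b)))
        (q * h) = sw k (fun q₁ q₂ => sw k (fun x y =>
          L.ρ (q₂ * y) (f (V.ρ (antipodeInv hS x * (antipodeInv hS q₁ * p)) v ⊗ₜ b))) h) q := by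
      intro p q
      rw [sw_mul]
      · simp only [antipodeInv_mul, ← Module.End.mul_apply, ← map_mul, mul_assoc]
      all_goals intros; constructor <;> intros <;> simp [add_tmul, ← smul_tmul']
    simp only [e1]
    rw [← sw_assoc (fun p q₁ q₂ => sw k (fun x y =>
          L.ρ (q₂ * y) (f (V.ρ (antipodeInv hS x * (antipodeInv hS q₁ * p)) v ⊗ₜ b))) h)]
    · have e2 : ∀ r q₂ : H, sw k (fun p q₁ => sw k (fun x y =>
          L.ρ (q₂ * y) (f (V.ρ (antipodeInv hS x * (antipodeInv hS q₁ * p)) v ⊗ₜ b))) h) r =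
          counit (R := k) r • sw k (fun x y =>
            L.ρ (q₂ * y) (f (V.ρ (antipodeInv hS x) v ⊗ₜ b))) h := by
        intro r q₂
        rw [sw_comm, ← sw_smul]
        congr 1; ext x y
        rw [sw_antipodeInv_mul hS (fun t => L.ρ (q₂ * y) (f (V.ρ (antipodeInv hS x * t) v ⊗ₜ b))),
          mul_one]
        constructor <;> intros <;> simp [mul_add, add_tmul, ← smul_tmul']
      simp only [e2]
      rw [sw_counit_left (fun q₂ => sw k (fun x y =>
            L.ρ (q₂ * y) (f (V.ρ (antipodeInv hS x) v ⊗ₜ b))) h)]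
      · simp only [map_mul, Module.End.mul_apply]
      · constructor <;> intros <;> simp [sw, add_mul, Finset.sum_add_distrib, Finset.smul_sum]
    all_goals intros; constructor <;> intros <;>
      simp [sw, add_mul, mul_add, add_tmul, ← smul_tmul', Finset.sum_add_distrib, Finset.smul_sum]

variable [Module H A] [IsScalarTower k H A]

theorem comp_freeExtend {V L M : HMod k H} (f : V.V ⊗[k] A →ₗ[k] L.V) {p : L.V →ₗ[k] M.V}
    (hp : HMod.IsHLinear p) (hpf : HMod.IsHLinear (V := V.tensor (HMod.of k H A)) (p ∘ₗ f))
    (F : A →₀ H) (v : V.V) :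
    p (freeExtend hS V L f F v) = p (f (v ⊗ₜ Finsupp.linearCombination H id F)) := by
  induction F using Finsupp.induction_linear with
  | zero => simp
  | add F F' hF hF' => simp only [map_add, LinearMap.add_apply, tmul_add, hF, hF']
  | single b h =>
    simp only [freeExtend_single, map_sw, hp _ _, Finsupp.linearCombination_single, id]
    have e1 : ∀ x y : H, M.ρ y (p (f (V.ρ (antipodeInv hS x) v ⊗ₜ b))) =
        sw k (fun y z => p (f (V.ρ (y * antipodeInv hS x) v ⊗ₜ (z • b)))) y := by
      intro x y
      refine (hpf y _).symm.trans ?_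
      refine (congrArg (p ∘ₗ f) (HMod.tensor_ρ V (HMod.of k H A) y _ _)).trans ?_
      refine (map_sw (p ∘ₗ f) _ _).trans ?_
      simp only [map_mul, Module.End.mul_apply]
      rfl
    simp only [e1]
    rw [← sw_assoc (fun x y z => p (f (V.ρ (y * antipodeInv hS x) v ⊗ₜ (z • b))))]
    · have e2 : ∀ r z : H, sw k (fun x y => p (f (V.ρ (y * antipodeInv hS x) v ⊗ₜ (z • b)))) r =
          counit (R := k) r • p (f (v ⊗ₜ (z • b))) := by
        intro r z
        rw [sw_mul_antipodeInv hS (fun t => p (f (V.ρ t v ⊗ₜ (z • b))))]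
        · simp
        · constructor <;> intros <;> simp [add_tmul, ← smul_tmul']
      simp only [e2]
      rw [sw_counit_left (fun z => p (f (v ⊗ₜ (z • b))))]
      constructor <;> intros <;> simp [add_smul, tmul_add]
    all_goals intros; constructor <;> intros <;>
      simp [add_mul, mul_add, add_smul, tmul_add, add_tmul, ← smul_tmul']

/-- If `A` is a projective `H`-module, then so is `V ⊗ A`. -/
theorem exists_lift_tensor (hS : Function.Bijective (HopfAlgebra.antipode k : H →ₗ[k] H))
    [Module.Projective H A] {V L M : HMod k H} {p : L.V →ₗ[k] M.V}
    (hp : HMod.IsHLinear p) {u : V.V ⊗[k] A →ₗ[k] M.V}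
    (hu : HMod.IsHLinear (V := V.tensor (HMod.of k H A)) u) (hpu : ∀ t, ∃ l, p l = u t) :
    ∃ v : V.V ⊗[k] A →ₗ[k] L.V,
      HMod.IsHLinear (V := V.tensor (HMod.of k H A)) v ∧ p ∘ₗ v = u := by
  obtain ⟨f, hf⟩ := Module.projective_lifting_property p.rangeRestrict
    (u.codRestrict (LinearMap.range p) hpu) p.surjective_rangeRestrict
  have hf : p ∘ₗ f = u := LinearMap.ext fun t =>
    congrArg Subtype.val (LinearMap.congr_fun hf t)
  obtain ⟨s, hs⟩ := (Module.projective_def' (R := H) (P := A)).1 inferInstance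
  refine ⟨TensorProduct.lift (freeExtend hS V L f ∘ₗ s.restrictScalars k).flip, ?_, ?_⟩
  · refine isHLinear_of_tmul (V := V) (W := HMod.of k H A) fun g v a => ?_
    rw [HMod.tensor_ρ]
    refine (map_sw (TensorProduct.lift (freeExtend hS V L f ∘ₗ s.restrictScalars k).flip)
      _ _).trans ?_
    refine Eq.trans ?_ (freeExtend_smul hS V L f (s a) g v)
    congr 1; ext x y
    exact congrArg (fun F => freeExtend hS V L f F (V.ρ x v)) (s.map_smul y a)
  · refine TensorProduct.ext' fun v a => ?_
    refine (comp_freeExtend hS f hp (by rwa [hf]) (s a) v).trans ?_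
    rw [show Finsupp.linearCombination H id (s a) = a from LinearMap.congr_fun hs a]
    exact LinearMap.congr_fun hf _

end TensorLift

namespace AYD

/-- The unit `v ↦ (h ↦ ε(h) v)` of the free contramodule `Tr(V)`. -/
noncomputable def trUnit (V : HMod k H) : V.V →ₗ[k] (Tr V).V where
  toFun v := (counit : H →ₗ[k] k).smulRight v
  map_add' v w := LinearMap.ext fun _ => smul_add _ v w
  map_smul' c v := LinearMap.ext fun _ => smul_comm _ c v

theorem isHLinear_trUnit (V : HMod k H) :
    HMod.IsHLinear (W := (Tr V).toHMod) (trUnit V) := by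
  intro a v
  refine LinearMap.ext fun h => Eq.trans ?_ (V.adj_apply a _ h).symm
  change counit (R := k) h • V.ρ a v = sw k (fun p z => sw k (fun x y =>
    V.ρ y (counit (R := k) (HopfAlgebra.antipode k z * h * x) • v)) p) a
  have e1 : ∀ p z : H, sw k (fun x y =>
      V.ρ y (counit (R := k) (HopfAlgebra.antipode k z * h * x) • v)) p =
      counit (R := k) z • counit (R := k) h • V.ρ p v := by
    intro p z
    rw [← sw_counit_left (k := k) (fun y => counit (R := k) z • counit (R := k) h • V.ρ y v)]
    · congr 1; ext x y
      simp only [Bialgebra.counit_mul, HopfAlgebra.counit_antipode, map_smul, smul_smul]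
      congr 1; ring
    · constructor <;> intros <;> simp [smul_smul, mul_left_comm]
      ring_nf
  simp only [e1]
  rw [sw_counit_right (fun p => counit (R := k) h • V.ρ p v)]
  constructor <;> intros <;> simp [smul_smul, mul_comm]

theorem extend_trUnit {V : HMod k H} {M : AYD k H} (f : V.V →ₗ[k] M.V)
    (hf : HMod.IsHLinear (W := M.toHMod) f) (v : V.V) :
    Hom.lin (extend f hf) (trUnit V v) = f v := by
  refine (congrArg M.α (LinearMap.ext fun h => ?_)).trans (M.α_counit (f v))
  exact map_smul f (counit (R := k) h) v

/-- A morphism out of `Tr(V)` is determined by its restriction along the unit. -/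
theorem lin_Tr_apply {V : HMod k H} {M : AYD k H} (u : Tr V ⟶ M) (φ : H →ₗ[k] V.V) :
    Hom.lin u φ = M.α ((Hom.lin u ∘ₗ trUnit V) ∘ₗ φ) := by
  have e : (Tr V).α (trUnit V ∘ₗ φ) = φ := by
    refine LinearMap.ext fun h => (coassocMap_apply V _ h).trans ?_
    exact sw_counit_right (fun y => φ y) ⟨φ.map_add, φ.map_smul⟩ h
  exact (congrArg (Hom.lin u) e).symm.trans (u.2.2 _)

theorem isHLinear_lin_comp_trUnit {V : HMod k H} {M : AYD k H} (u : Tr V ⟶ M) :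
    HMod.IsHLinear (W := M.toHMod) (Hom.lin u ∘ₗ trUnit V) := fun a v =>
  (congrArg (Hom.lin u) (isHLinear_trUnit V a v)).trans (u.2.1 a _)

/-- Projectivity in the relative form used below: maps from `P` lift through `f` if they land in
the kernel of `g`, provided that `L → M → N` is exact at `M`. -/
def IsProj (P : AYD k H) : Prop :=
  ∀ ⦃L M N : AYD k H⦄ (f : L ⟶ M) (g : M ⟶ N),
    (∀ m, Hom.lin g m = 0 → ∃ l, Hom.lin f l = m) →
    ∀ u : P ⟶ M, u ≫ g = 0 → ∃ v : P ⟶ L, v ≫ f = u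

theorem isProj_Tr_tensor (hS : Function.Bijective (HopfAlgebra.antipode k : H →ₗ[k] H))
    {A : Type u} [Ring A] [Algebra k A] [Module H A] [IsScalarTower k H A]
    [Module.Projective H A] (V : HMod k H) : IsProj (Tr (V.tensor (HMod.of k H A))) := by
  intro L M N f g hfg u hu
  obtain ⟨v, hv, hv'⟩ := exists_lift_tensor hS (V := V) (L := L.toHMod) (M := M.toHMod)
    (p := Hom.lin f) f.2.1 (isHLinear_lin_comp_trUnit u)
    (fun t => hfg _ (LinearMap.congr_fun (congrArg Hom.lin hu) _))
  refine ⟨extend (V := V.tensor (HMod.of k H A)) v hv, hom_ext fun φ => ?_⟩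
  refine (f.2.2 _).trans ?_
  refine Eq.trans ?_ (lin_Tr_apply u φ).symm
  rw [← hv']
  rfl

theorem IsProj.biproduct {ι : Type} [Finite ι] {X : ι → AYD k H} (h : ∀ i, IsProj (X i)) :
    IsProj (⨁ X) := by
  intro L M N f g hfg u hu
  choose v hv using fun i => h i f g hfg (Limits.biproduct.ι X i ≫ u)
    (by rw [Category.assoc, hu, Limits.comp_zero])
  exact ⟨Limits.biproduct.desc v, Limits.biproduct.hom_ext' _ _ fun i => by simp [hv]⟩

end AYD

/-! ### Cones of mixed contramodules -/

section ShortComplexes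

variable {R : Type u} [Ring R] {S₁ S₂ : ShortComplex (ModuleCat.{u} R)} (φ : S₁ ⟶ S₂)
  [ShortComplex.QuasiIso φ]

/-- A quasi-isomorphism is injective on homology, in terms of elements. -/
theorem exists_of_quasiIso_of_boundary (x : S₁.X₂) (hx : S₁.g x = 0) (y : S₂.X₁)
    (hxy : φ.τ₂ x = S₂.f y) : ∃ z, S₁.f z = x := by
  let γ := ShortComplex.leftHomologyMapData φ S₁.moduleCatLeftHomologyData
    S₂.moduleCatLeftHomologyData
  have hγ : IsIso γ.φH := γ.quasiIso_iff.1 inferInstance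
  have h1 : γ.φK ⟨x, hx⟩ = S₂.moduleCatLeftHomologyData.f' y := by
    refine Subtype.ext ?_
    refine (ConcreteCategory.congr_hom γ.commi ⟨x, hx⟩).trans ?_
    exact hxy
  have h2 : γ.φH (S₁.moduleCatLeftHomologyData.π ⟨x, hx⟩) = 0 := by
    refine (ConcreteCategory.congr_hom γ.commπ ⟨x, hx⟩).trans ?_
    change S₂.moduleCatLeftHomologyData.π (γ.φK ⟨x, hx⟩) = 0
    rw [h1]
    exact ConcreteCategory.congr_hom S₂.moduleCatLeftHomologyData.f'_π y
  have h3 : S₁.moduleCatLeftHomologyData.π ⟨x, hx⟩ = 0 :=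
    (ConcreteCategory.bijective_of_isIso γ.φH).1 (h2.trans (map_zero γ.φH.hom).symm)
  obtain ⟨z, hz⟩ := (Submodule.Quotient.mk_eq_zero _).1 h3
  exact ⟨z, congrArg Subtype.val hz⟩

/-- A quasi-isomorphism is surjective on homology, in terms of elements. -/
theorem exists_cycle_of_quasiIso (y : S₂.X₂) (hy : S₂.g y = 0) :
    ∃ (x : S₁.X₂) (z : S₂.X₁), S₁.g x = 0 ∧ y = φ.τ₂ x + S₂.f z := by
  let γ := ShortComplex.leftHomologyMapData φ S₁.moduleCatLeftHomologyData
    S₂.moduleCatLeftHomologyData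
  have hγ : IsIso γ.φH := γ.quasiIso_iff.1 inferInstance
  obtain ⟨w, hw⟩ := (ConcreteCategory.bijective_of_isIso γ.φH).2
    (S₂.moduleCatLeftHomologyData.π ⟨y, hy⟩)
  obtain ⟨⟨x, hx⟩, rfl⟩ := Submodule.Quotient.mk_surjective _ w
  have h1 : S₂.moduleCatLeftHomologyData.π (γ.φK ⟨x, hx⟩) =
      S₂.moduleCatLeftHomologyData.π ⟨y, hy⟩ :=
    (ConcreteCategory.congr_hom γ.commπ ⟨x, hx⟩).symm.trans hw
  obtain ⟨z, hz⟩ := (Submodule.Quotient.eq _).1 h1.symm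
  refine ⟨x, z, hx, ?_⟩
  have h2 : S₂.f z = y - (γ.φK ⟨x, hx⟩ : LinearMap.ker S₂.g.hom).1 := congrArg Subtype.val hz
  have h3 : (γ.φK ⟨x, hx⟩ : LinearMap.ker S₂.g.hom).1 = φ.τ₂ x :=
    ConcreteCategory.congr_hom γ.commi (show S₁.moduleCatLeftHomologyData.K from ⟨x, hx⟩)
  rw [h2, h3]
  abel

end ShortComplexes

namespace MixedAYD

variable {P X Y Z : MixedAYD k H}

theorem h_comp (X : MixedAYD k H) (p q r : ℤ) (hpq : p + -1 = q) (hqr : q + -1 = r) :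
    X.h.v p q hpq ≫ X.h.v q r hqr = 0 := by
  have := Cochain.congr_v X.h_comp_h p r (by omega)
  rwa [Cochain.comp_v _ _ _ p q r hpq hqr, Cochain.zero_v] at this

theorem h_comp_d (X : MixedAYD k H) (p q r : ℤ) (hq : p + -1 = q) (hr : r + -1 = p) :
    X.h.v p q hq ≫ X.cx.d q p + X.cx.d p r ≫ X.h.v r p hr = 𝟙 _ - AYD.sigmaHom _ := by
  obtain rfl : q = p - 1 := by omega
  obtain rfl : r = p + 1 := by omega
  exact AYD.hom_ext fun x => X.homotopy p x

theorem isAcyclic_iff (X : MixedAYD k H) : X.IsAcyclic ↔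
    ∀ (p q r : ℤ), p + 1 = q → q + 1 = r → ∀ x : (X.cx.X q).V,
      AYD.Hom.lin (X.cx.d q r) x = 0 → ∃ y, AYD.Hom.lin (X.cx.d p q) y = x := by
  constructor
  · intro h p q r hpq hqr
    have := (HomologicalComplex.exactAt_iff' X.underlying p q r
      ((CochainComplex.prev ℤ q).trans (by omega)) ((CochainComplex.next ℤ q).trans hqr)).1 (h q)
    exact (ShortComplex.moduleCat_exact_iff _).1 this
  · intro h q
    refine (HomologicalComplex.exactAt_iff' X.underlying (q - 1) q (q + 1)
      (CochainComplex.prev ℤ q) (CochainComplex.next ℤ q)).2 ?_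
    exact (ShortComplex.moduleCat_exact_iff _).2 (h (q - 1) q (q + 1) (by omega) rfl)

/-- The underlying map of complexes. -/
def hom (f : X ⟶ Y) : X.cx ⟶ Y.cx := Subtype.val (p := fun f : X.cx ⟶ Y.cx =>
  ∀ (p q : ℤ) (hpq : p + -1 = q), f.f p ≫ Y.h.v p q hpq = X.h.v p q hpq ≫ f.f q) f

theorem hom_comm (f : X ⟶ Y) (p q : ℤ) (hpq : p + -1 = q) :
    (hom f).f p ≫ Y.h.v p q hpq = X.h.v p q hpq ≫ (hom f).f q := f.2 p q hpq

theorem IsQuasiIso.quasiIso_sc {f : X ⟶ Y} (hf : IsQuasiIso f) (p q r : ℤ) (hpq : p + 1 = q)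
    (hqr : q + 1 = r) : ShortComplex.QuasiIso ((HomologicalComplex.shortComplexFunctor' _ _ p q r).map
      (((AYD.forget k H).mapHomologicalComplex (ComplexShape.up ℤ)).map (hom f))) :=
  (quasiIsoAt_iff' _ p q r ((CochainComplex.prev ℤ q).trans (by omega))
    ((CochainComplex.next ℤ q).trans hqr)).1 (hf.quasiIsoAt q)

open CochainComplex mappingCone

section Cone

variable (f : X ⟶ Y)

/-- The homotopy `(x, y) ↦ (-h x, h y)` on the mapping cone `X[1] ⊕ Y`. -/
noncomputable def coneH : Cochain (mappingCone (hom f)) (mappingCone (hom f)) (-1) :=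
  Cochain.mk fun p q hpq =>
    -((fst (hom f)).1.v p (p + 1) rfl ≫ X.h.v (p + 1) (q + 1) (by omega) ≫
      (inl (hom f)).v (q + 1) q (by omega)) +
    (snd (hom f)).v p p (add_zero p) ≫ Y.h.v p q hpq ≫ (inr (hom f)).f q

theorem coneH_fst (p q p' q' : ℤ) (hpq : p + -1 = q) (hp : p + 1 = p') (hq : q + 1 = q') :
    (coneH f).v p q hpq ≫ (fst (hom f)).1.v q q' hq =
      -(fst (hom f)).1.v p p' hp ≫ X.h.v p' q' (by omega) := by
  subst hp hq
  simp [coneH]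

theorem coneH_snd (p q : ℤ) (hpq : p + -1 = q) :
    (coneH f).v p q hpq ≫ (snd (hom f)).v q q (add_zero q) =
      (snd (hom f)).v p p (add_zero p) ≫ Y.h.v p q hpq := by
  simp [coneH]

/-- The cone of a morphism of mixed contramodules: the mapping cone `X[1] ⊕ Y` of complexes, with
the homotopy `(x, y) ↦ (-h x, h y)`. -/
noncomputable def cone : MixedAYD k H where
  cx := mappingCone (hom f)
  h := coneH f
  h_comp_h := by
    refine Cochain.ext _ _ fun p q hpq => ?_
    rw [Cochain.comp_v _ _ _ p (p + -1) q rfl (by omega), Cochain.zero_v]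
    rw [ext_to_iff _ q (q + 1) rfl]
    constructor
    · rw [Category.assoc, coneH_fst f (p + -1) q p (q + 1) _ (by omega) rfl, Preadditive.comp_neg,
        ← Category.assoc, coneH_fst f p (p + -1) (p + 1) p _ rfl (by omega), Preadditive.neg_comp,
        Category.assoc, X.h_comp, Limits.comp_zero, Limits.zero_comp, neg_zero, neg_zero]
    · rw [Category.assoc, coneH_snd, ← Category.assoc, coneH_snd, Category.assoc, Y.h_comp,
        Limits.comp_zero, Limits.zero_comp]
  homotopy i x := by
    suffices e : (coneH f).v i (i - 1) rfl ≫ (mappingCone (hom f)).d (i - 1) i +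
        (mappingCone (hom f)).d i (i + 1) ≫ (coneH f).v (i + 1) i (by omega) =
        𝟙 _ - AYD.sigmaHom _ from congrArg (fun f => AYD.Hom.lin f x) e
    rw [ext_to_iff _ i (i + 1) rfl]
    constructor
    · have e1 := coneH_fst f i (i - 1) (i + 1) i rfl rfl (by omega)
      have e2 := coneH_fst f (i + 1) i (i + 1 + 1) (i + 1) (by omega) rfl rfl
      have e3 := d_fst_v (hom f) (i - 1) i (i + 1) (by omega) rfl
      have e4 := d_fst_v (hom f) i (i + 1) (i + 1 + 1) rfl rfl
      have e5 := X.h_comp_d (i + 1) i (i + 1 + 1) (by omega) (by omega)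
      rw [Preadditive.add_comp, Category.assoc, Category.assoc, e2, e3, Preadditive.comp_neg,
        Preadditive.comp_neg, reassoc_of% e1, reassoc_of% e4, Preadditive.neg_comp,
        Preadditive.neg_comp, neg_neg, neg_neg, Category.assoc, Category.assoc,
        ← Preadditive.comp_add, e5, Preadditive.comp_sub, Preadditive.sub_comp,
        ← AYD.sigmaHom_naturality, Category.comp_id, Category.id_comp]
    · have e1 := coneH_snd f i (i - 1) rfl
      have e1' := coneH_fst f i (i - 1) (i + 1) i rfl rfl (by omega)
      have e2 := coneH_snd f (i + 1) i (by omega)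
      have e3 := d_snd_v (hom f) (i - 1) i (by omega)
      have e4 := d_snd_v (hom f) i (i + 1) rfl
      have e5 := Y.h_comp_d i (i - 1) (i + 1) (by omega) (by omega)
      have e6 := hom_comm f (i + 1) i (by omega)
      rw [Preadditive.add_comp, Category.assoc, Category.assoc, e2, e3, Preadditive.comp_add,
        reassoc_of% e1, reassoc_of% e1', reassoc_of% e4, Preadditive.add_comp, Category.assoc,
        Category.assoc, e6, Preadditive.sub_comp, ← AYD.sigmaHom_naturality, Category.id_comp]
      have e7 := congrArg ((snd (hom f)).v i i (add_zero i) ≫ ·) e5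
      beta_reduce at e7
      rw [Preadditive.comp_sub, Category.comp_id, Preadditive.comp_add] at e7
      rw [← e7, Preadditive.neg_comp, Category.assoc]
      abel

end Cone

/-- The cone of a quasi-isomorphism is acyclic. Homology is computed on elements of the underlying
vector spaces, so that no exactness of the category of contramodules is needed. -/
theorem isAcyclic_cone {f : X ⟶ Y} (hf : IsQuasiIso f) : (cone f).IsAcyclic := by
  rw [isAcyclic_iff]
  intro p q r hpq hqr x hx
  have d1 := fun y => congrArg (fun u => AYD.Hom.lin u y) (d_fst_v (hom f) q r (r + 1) hqr rfl)
  have d2 := fun y => congrArg (fun u => AYD.Hom.lin u y) (d_snd_v (hom f) q r hqr)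
  have d3 := fun y => congrArg (fun u => AYD.Hom.lin u y) (d_fst_v (hom f) p q r hpq hqr)
  have d4 := fun y => congrArg (fun u => AYD.Hom.lin u y) (d_snd_v (hom f) p q hpq)
  have hi := fun y => congrArg (fun u => AYD.Hom.lin u y) (id_X (hom f) q r hqr)
  simp only [AYD.lin_comp, AYD.lin_add, AYD.lin_neg, LinearMap.comp_apply,
    LinearMap.add_apply, LinearMap.neg_apply, AYD.lin_id, LinearMap.id_apply] at d1 d2 d3 d4 hi
  have hx' : AYD.Hom.lin ((mappingCone (hom f)).d q r) x = 0 := hx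
  have d1' := d1 x
  have d2' := d2 x
  rw [hx', map_zero] at d1' d2'
  have := hf.quasiIso_sc q r (r + 1) hqr rfl
  obtain ⟨z, hz⟩ : ∃ z : (X.cx.X q).V, AYD.Hom.lin (X.cx.d q r) z =
      AYD.Hom.lin ((fst (hom f)).1.v q r hqr) x := exists_of_quasiIso_of_boundary
    ((HomologicalComplex.shortComplexFunctor' _ _ q r (r + 1)).map
      (((AYD.forget k H).mapHomologicalComplex (ComplexShape.up ℤ)).map (hom f)))
    (AYD.Hom.lin ((fst (hom f)).1.v q r hqr) x)
    (neg_eq_zero.1 d1'.symm) (-AYD.Hom.lin ((snd (hom f)).v q q (add_zero q)) x)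
    ((eq_neg_of_add_eq_zero_left d2'.symm).trans (map_neg _ _).symm)
  have hfz : AYD.Hom.lin (Y.cx.d q r) (AYD.Hom.lin ((hom f).f q) z) =
      AYD.Hom.lin ((hom f).f r) (AYD.Hom.lin (X.cx.d q r) z) :=
    congrArg (fun u => AYD.Hom.lin u z) ((hom f).comm q r)
  have := hf.quasiIso_sc p q r hpq hqr
  obtain ⟨c, e, hc, hce⟩ : ∃ (c : (X.cx.X q).V) (e : (Y.cx.X p).V),
      AYD.Hom.lin (X.cx.d q r) c = 0 ∧ AYD.Hom.lin ((hom f).f q) z +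
        AYD.Hom.lin ((snd (hom f)).v q q (add_zero q)) x =
        AYD.Hom.lin ((hom f).f q) c + AYD.Hom.lin (Y.cx.d p q) e := exists_cycle_of_quasiIso
    ((HomologicalComplex.shortComplexFunctor' _ _ p q r).map
      (((AYD.forget k H).mapHomologicalComplex (ComplexShape.up ℤ)).map (hom f)))
    (AYD.Hom.lin ((hom f).f q) z + AYD.Hom.lin ((snd (hom f)).v q q (add_zero q)) x) (by
      refine (map_add (AYD.Hom.lin (Y.cx.d q r)) _ _).trans ?_
      rw [hfz, hz]
      exact d2'.symm)
  have f1 := fun y => congrArg (fun u => AYD.Hom.lin u y) (inl_v_fst_v (hom f) q p hpq)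
  have f2 := fun y => congrArg (fun u => AYD.Hom.lin u y) (inl_v_snd_v (hom f) q p (by omega))
  have f3 := fun y => congrArg (fun u => AYD.Hom.lin u y) (inr_f_fst_v (hom f) p q hpq)
  have f4 := fun y => congrArg (fun u => AYD.Hom.lin u y) (inr_f_snd_v (hom f) p)
  simp only [AYD.lin_comp, LinearMap.comp_apply, AYD.lin_id, LinearMap.id_apply, AYD.lin_zero,
    LinearMap.zero_apply] at f1 f2 f3 f4
  refine ⟨AYD.Hom.lin ((inl (hom f)).v q p (by omega)) (c - z) +
    AYD.Hom.lin ((inr (hom f)).f p) e, ?_⟩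
  change AYD.Hom.lin ((mappingCone (hom f)).d p q) _ = x
  rw [← hi (AYD.Hom.lin ((mappingCone (hom f)).d p q) _), d3, d4]
  simp only [map_add, f1, f2, f3, f4, add_zero, zero_add]
  conv_rhs => rw [← hi x]
  rw [← hz]
  congr 2
  · rw [map_sub, hc, zero_sub, neg_neg]
  · rw [← map_add, map_sub, eq_sub_of_add_eq' hce]
    congr 1
    abel

end MixedAYD

/-! ### Uniqueness of K-projective resolutions -/

namespace MixedAYD

variable {P P' X Y Z : MixedAYD k H}

theorem mem_dgHom_iff {n : ℤ} (f : Cochain X.cx Y.cx n) : f ∈ X.dgHom Y n ↔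
    ∀ (p q p' q' : ℤ) (hpq : p + n = q) (hp : p + -1 = p') (hq : q + -1 = q'),
      f.v p q hpq ≫ Y.h.v q q' hq =
        n.negOnePow • X.h.v p p' hp ≫ f.v p' q' (by omega) := by
  constructor
  · intro h p q p' q' hpq hp hq
    have := Cochain.congr_v h p q' (by omega)
    rwa [Cochain.comp_v _ _ _ p q q' hpq hq, Cochain.units_smul_v,
      Cochain.comp_v _ _ _ p p' q' hp (by omega)] at this
  · intro h
    refine Cochain.ext _ _ fun p q hpq => ?_
    rw [Cochain.comp_v _ _ _ p (p + n) q rfl (by omega), Cochain.units_smul_v,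
      Cochain.comp_v _ _ _ p (p + -1) q rfl (by omega)]
    exact h p (p + n) (p + -1) q rfl rfl (by omega)

theorem comp_mem_dgHom {m n l : ℤ} {f : Cochain X.cx Y.cx m} {g : Cochain Y.cx Z.cx n}
    (hf : f ∈ X.dgHom Y m) (hg : g ∈ Y.dgHom Z n) (h : m + n = l) :
    f.comp g h ∈ X.dgHom Z l := by
  subst h
  rw [mem_dgHom_iff] at hf hg ⊢
  intro p q p' q' hpq hp hq
  rw [Cochain.comp_v _ _ _ p (p + m) q rfl (by omega), Category.assoc,
    hg (p + m) q (p' + m) q' (by omega) (by omega) hq,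
    Cochain.comp_v _ _ _ p' (p' + m) q' rfl (by omega), Linear.comp_units_smul,
    ← Category.assoc, hf p (p + m) p' (p' + m) rfl hp (by omega), Linear.units_smul_comp,
    smul_smul, Category.assoc, Int.negOnePow_add, mul_comm]

/-- The differential preserves compatibility with `h`: the terms `1 - ς` of the relations
`dh + hd = 1 - ς` in source and target cancel by naturality of `ς`. -/
theorem δ_mem_dgHom {n m : ℤ} (hm : n + 1 = m) {f : Cochain X.cx Y.cx n} (hf : f ∈ X.dgHom Y n) :
    δ n m f ∈ X.dgHom Y m := by
  rw [mem_dgHom_iff] at hf ⊢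
  intro p q p' q' hpq hp hq
  have hε : m.negOnePow = -n.negOnePow := by rw [← hm, Int.negOnePow_succ]
  have e1 := reassoc_of% eq_sub_of_add_eq (X.h_comp_d p p' (p + 1) hp (by omega))
  have e2 := eq_sub_of_add_eq' (Y.h_comp_d q' (q' - 1) q (by omega) hq)
  have f1 := hf (p + 1) q p q' (by omega) (by omega) hq
  have f2 := reassoc_of% hf p q' p' (q' - 1) (by omega) hp (by omega)
  rw [δ_v n m hm f p q hpq q' (p + 1) (by omega) rfl,
    δ_v n m hm f p' q' (by omega) (q' - 1) p (by omega) (by omega), hε]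
  simp only [Preadditive.add_comp, Preadditive.comp_add, Linear.units_smul_comp, Category.assoc,
    Linear.comp_units_smul, e1, e2, f1, f2, Preadditive.comp_sub, Preadditive.sub_comp,
    Category.id_comp, Category.comp_id, AYD.sigmaHom_naturality, Units.neg_smul, smul_add, smul_sub,
    Preadditive.neg_comp, Preadditive.comp_neg, smul_neg, neg_mul, smul_smul, Int.units_mul_self, one_smul]
  abel

theorem ofHom_mem_dgHom (f : X ⟶ Y) : Cochain.ofHom (hom f) ∈ X.dgHom Y 0 := by
  rw [mem_dgHom_iff]
  intro p q p' q' hpq hp hq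
  obtain rfl : q = p := by omega
  obtain rfl : q' = p' := by omega
  rw [Cochain.ofHom_v, Cochain.ofHom_v, Int.negOnePow_zero, one_smul, hom_comm]

theorem mem_homCocycles_iff {n : ℤ} (m : ℤ) (hm : n + 1 = m) (z : Cochain X.cx Y.cx n) :
    z ∈ X.homCocycles Y n ↔ z ∈ X.dgHom Y n ∧ δ n m z = 0 := by
  subst hm
  exact Iff.rfl

theorem mem_homCoboundaries_iff {n : ℤ} (m : ℤ) (hm : m + 1 = n) (z : Cochain X.cx Y.cx n) :
    z ∈ X.homCoboundaries Y n ↔ ∃ w ∈ X.dgHom Y m, δ m n w = z := by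
  obtain rfl : m = n - 1 := by omega
  exact Iff.rfl

theorem subsingleton_homCohomology_iff (n : ℤ) : Subsingleton (X.HomCohomology Y n) ↔
    X.homCocycles Y n ≤ X.homCoboundaries Y n := by
  rw [Submodule.Quotient.subsingleton_iff, Submodule.submoduleOf,
    Submodule.comap_subtype_eq_top]

open CochainComplex mappingCone

section Cone

variable (f : X ⟶ Y)

theorem mem_dgHom_cone_iff {n : ℤ} (g : Cochain P.cx (mappingCone (hom f)) n) :
    g ∈ P.dgHom (cone f) n ↔
    ∀ (p q p' q' : ℤ) (hpq : p + n = q) (hp : p + -1 = p') (hq : q + -1 = q'),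
      g.v p q hpq ≫ (coneH f).v q q' hq =
        n.negOnePow • P.h.v p p' hp ≫ g.v p' q' (by omega) :=
  mem_dgHom_iff (Y := cone f) g

theorem comp_fst_mem_dgHom {n m : ℤ} {g : Cochain P.cx (mappingCone (hom f)) n}
    (hg : g ∈ P.dgHom (cone f) n) (h : n + 1 = m) :
    g.comp (fst (hom f)).1 h ∈ P.dgHom X m := by
  subst h
  rw [mem_dgHom_cone_iff] at hg
  rw [mem_dgHom_iff]
  intro p q p' q' hpq hp hq
  have e := coneH_fst f q' (q' + -1) q q' rfl (by omega) (by omega)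
  have e' := hg p q' p' (q' + -1) (by omega) hp rfl
  rw [Cochain.comp_v _ _ _ p q' q (by omega) (by omega),
    Cochain.comp_v _ _ _ p' (q' + -1) q' (by omega) (by omega), Category.assoc,
    ← neg_eq_iff_eq_neg.2 e, Preadditive.comp_neg, reassoc_of% e', Linear.units_smul_comp,
    Category.assoc, Int.negOnePow_succ, Units.neg_smul]

theorem comp_snd_mem_dgHom {n : ℤ} {g : Cochain P.cx (mappingCone (hom f)) n}
    (hg : g ∈ P.dgHom (cone f) n) : g.comp (snd (hom f)) (add_zero n) ∈ P.dgHom Y n := by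
  rw [mem_dgHom_cone_iff] at hg
  rw [mem_dgHom_iff]
  intro p q p' q' hpq hp hq
  have e := coneH_snd f q q' hq
  have e' := hg p q p' q' hpq hp hq
  rw [Cochain.comp_zero_cochain_v, Cochain.comp_zero_cochain_v, Category.assoc, ← e,
    reassoc_of% e', Linear.units_smul_comp, Category.assoc]

theorem liftCochain_mem_dgHom {n m : ℤ} {a : Cochain P.cx X.cx m} {b : Cochain P.cx Y.cx n}
    (ha : a ∈ P.dgHom X m) (hb : b ∈ P.dgHom Y n) (h : n + 1 = m) :
    liftCochain (hom f) a b h ∈ P.dgHom (cone f) n := by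
  subst h
  rw [mem_dgHom_iff] at ha hb
  rw [mem_dgHom_cone_iff]
  intro p q p' q' hpq hp hq
  rw [ext_to_iff _ q' q (by omega)]
  constructor
  · rw [Category.assoc, coneH_fst f q q' (q + 1) q hq rfl (by omega), Preadditive.comp_neg,
      liftCochain_v_fst_v_assoc, Linear.units_smul_comp, Category.assoc, liftCochain_v_fst_v,
      ha p (q + 1) p' q (by omega) hp (by omega), Int.negOnePow_succ, Units.neg_smul, neg_neg]
  · rw [Category.assoc, coneH_snd, liftCochain_v_snd_v_assoc, Linear.units_smul_comp,
      Category.assoc, liftCochain_v_snd_v, hb p q p' q' hpq hp hq]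

variable {f}

/-- For K-projective `P`, every cocycle `P → Y` lifts through a quasi-isomorphism `f : X → Y`, up to
a coboundary. -/
theorem exists_lift_of_isQuasiIso (hP : P.IsKProjective) (hf : IsQuasiIso f) {n : ℤ}
    {z : Cochain P.cx Y.cx n} (hz : z ∈ P.homCocycles Y n) :
    ∃ w ∈ P.homCocycles X n,
      z - w.comp (Cochain.ofHom (hom f)) (add_zero n) ∈ P.homCoboundaries Y n := by
  obtain ⟨hz, hz'⟩ := (mem_homCocycles_iff (n + 1) rfl _).1 hz
  let z' : Cochain P.cx (mappingCone (hom f)) n := z.comp (Cochain.ofHom (inr (hom f))) (add_zero n)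
  have h1 : z' ∈ P.homCocycles (cone f) n := by
    refine (mem_homCocycles_iff (n + 1) rfl _).2 ⟨?_, ?_⟩
    · have e : z' = liftCochain (hom f) 0 z rfl := by simp [z', liftCochain]
      rw [e]
      exact liftCochain_mem_dgHom f (zero_mem (P.dgHom X (n + 1))) hz rfl
    · exact (δ_comp_ofHom z _ _).trans (by rw [hz', Cochain.zero_comp])
  obtain ⟨g, hg, hgz⟩ : ∃ g : Cochain P.cx (mappingCone (hom f)) (n - 1),
      g ∈ P.dgHom (cone f) (n - 1) ∧ δ (n - 1) n g = z' := (mem_homCoboundaries_iff (n - 1) (by omega) _).1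
    ((subsingleton_homCohomology_iff n).1 (hP _ (isAcyclic_cone hf) n) h1)
  refine ⟨_, (mem_homCocycles_iff (n + 1) rfl _).2
    ⟨comp_fst_mem_dgHom f hg (by omega), ?_⟩, (mem_homCoboundaries_iff (n - 1) (by omega) _).2
    ⟨_, comp_snd_mem_dgHom f hg, ?_⟩⟩
  · refine (δ_comp g (fst (hom f)).1
      (by omega) n 2 (n + 1) rfl (by omega) rfl).trans ?_
    rw [hgz, (fst (hom f)).δ_eq_zero, Cochain.comp_zero, zero_add]
    simp only [z']
    rw [Cochain.comp_assoc_of_second_is_zero_cochain, inr_fst, Cochain.comp_zero, smul_zero]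
  · refine (δ_comp_zero_cochain g
      (snd (hom f)) n (by omega)).trans ?_
    rw [hgz, δ_snd, Cochain.comp_neg]
    simp only [z']
    rw [Cochain.comp_assoc_of_second_is_zero_cochain, inr_snd, Cochain.comp_id,
      ← Cochain.comp_assoc_of_third_is_zero_cochain]
    exact neg_add_eq_sub _ _

/-- For K-projective `P`, a cocycle `P → X` whose composite with a quasi-isomorphism is a
coboundary is itself a coboundary. -/
theorem mem_homCoboundaries_of_comp (hP : P.IsKProjective) (hf : IsQuasiIso f) {n : ℤ}
    {w : Cochain P.cx X.cx n} (hw : w ∈ P.homCocycles X n)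
    (h : w.comp (Cochain.ofHom (hom f)) (add_zero n) ∈ P.homCoboundaries Y n) :
    w ∈ P.homCoboundaries X n := by
  obtain ⟨hw, hw'⟩ := (mem_homCocycles_iff (n + 1) rfl _).1 hw
  obtain ⟨g, hg, hgw⟩ := (mem_homCoboundaries_iff (n - 1) (by omega) _).1 h
  let c := liftCochain (hom f) w (-g) (by omega)
  have h1 : c ∈ P.homCocycles (cone f) (n - 1) := by
    refine (mem_homCocycles_iff n (by omega) _).2
      ⟨liftCochain_mem_dgHom f hw (neg_mem hg) (by omega), ?_⟩
    have e := δ_liftCochain (hom f) w (-g) (by omega) (n + 1) rfl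
    rwa [hw', δ_neg, hgw, neg_add_cancel, Cochain.zero_comp, Cochain.zero_comp, neg_zero,
      add_zero] at e
  obtain ⟨e, he, hec⟩ : ∃ e : Cochain P.cx (mappingCone (hom f)) (n - 2),
      e ∈ P.dgHom (cone f) (n - 2) ∧ δ (n - 2) (n - 1) e = c := (mem_homCoboundaries_iff (n - 2) (by omega) _).1
    ((subsingleton_homCohomology_iff (n - 1)).1 (hP _ (isAcyclic_cone hf) (n - 1)) h1)
  refine (mem_homCoboundaries_iff (n - 1) (by omega) _).2
    ⟨-_, neg_mem (comp_fst_mem_dgHom f he (by omega)), ?_⟩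
  rw [δ_neg]
  refine (congrArg (- ·) (δ_comp e
    (fst (hom f)).1 (by omega) (n - 1) 2 n (by omega) (by omega) rfl)).trans ?_
  rw [hec, (fst (hom f)).δ_eq_zero, Cochain.comp_zero, zero_add, Int.negOnePow_one]
  simp [c]

end Cone

/-- A K-projective object over `Z` maps to any resolution of `Z` by a degree-zero cocycle that is
compatible with the maps to `Z` up to a coboundary. -/
theorem exists_comparison (hP : P.IsKProjective) (π : P ⟶ Z) {π' : P' ⟶ Z}
    (hπ' : IsQuasiIso π') : ∃ f ∈ P.homCocycles P' 0,
      Cochain.ofHom (hom π) - f.comp (Cochain.ofHom (hom π')) (add_zero 0) ∈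
        P.homCoboundaries Z 0 :=
  exists_lift_of_isQuasiIso hP hπ'
    ((mem_homCocycles_iff 1 (by omega) _).2 ⟨ofHom_mem_dgHom π, δ_ofHom _⟩)

theorem comp_mem_homCocycles {m n l : ℤ} {f : Cochain X.cx Y.cx m} {g : Cochain Y.cx Z.cx n}
    (hf : f ∈ X.homCocycles Y m) (hg : g ∈ Y.homCocycles Z n) (h : m + n = l) :
    f.comp g h ∈ X.homCocycles Z l := by
  rw [mem_homCocycles_iff _ rfl] at hf hg ⊢
  refine ⟨comp_mem_dgHom hf.1 hg.1 h, ?_⟩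
  rw [δ_comp f g h (m + 1) (n + 1) (l + 1) rfl rfl rfl, hf.2, hg.2, Cochain.comp_zero,
    Cochain.zero_comp, smul_zero, add_zero]

theorem comp_mem_homCoboundaries {m n l : ℤ} {f : Cochain X.cx Y.cx m} {g : Cochain Y.cx Z.cx n}
    (hf : f ∈ X.homCocycles Y m) (hg : g ∈ Y.homCoboundaries Z n) (h : m + n = l) :
    f.comp g h ∈ X.homCoboundaries Z l := by
  obtain ⟨w, hw, rfl⟩ := (mem_homCoboundaries_iff (n - 1) (by omega) _).1 hg
  rw [mem_homCocycles_iff _ rfl] at hf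
  refine (mem_homCoboundaries_iff (l - 1) (by omega) _).2
    ⟨_, comp_mem_dgHom hf.1 hw (show m + (n - 1) = l - 1 by omega), ?_⟩
  rw [δ_comp f w _ (m + 1) n l (by omega) rfl (by omega), hf.2, Cochain.zero_comp, smul_zero,
    add_zero]

theorem comp_mem_homCoboundaries' {m n l : ℤ} {f : Cochain X.cx Y.cx m} {g : Cochain Y.cx Z.cx n}
    (hf : f ∈ X.homCoboundaries Y m) (hg : g ∈ Y.homCocycles Z n) (h : m + n = l) :
    f.comp g h ∈ X.homCoboundaries Z l := by
  obtain ⟨w, hw, rfl⟩ := (mem_homCoboundaries_iff (m - 1) (by omega) _).1 hf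
  rw [mem_homCocycles_iff _ rfl] at hg
  have e := δ_comp w g (show m - 1 + n = l - 1 by omega) m (n + 1) l (by omega) (by omega) rfl
  rw [hg.2, Cochain.comp_zero, zero_add] at e
  have hwg : w.comp g (show m - 1 + n = l - 1 by omega) ∈ X.dgHom Z (l - 1) :=
    comp_mem_dgHom hw hg.1 _
  refine (mem_homCoboundaries_iff (l - 1) (by omega) _).2 ⟨n.negOnePow • w.comp g (by omega), ?_, ?_⟩
  · rcases Int.units_eq_one_or n.negOnePow with h | h <;> rw [h]
    · rwa [one_smul]
    · rw [Units.neg_smul, one_smul]; exact neg_mem hwg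
  · rw [δ_units_smul, e, smul_smul, Int.units_mul_self, one_smul]

/-- Precomposition with a degree-zero cocycle, on cohomology. -/
noncomputable def precompCohomology {f : Cochain X.cx Y.cx 0} (hf : f ∈ X.homCocycles Y 0)
    (Z : MixedAYD k H) (n : ℤ) : Y.HomCohomology Z n →ₗ[k] X.HomCohomology Z n :=
  Submodule.mapQ _ _
    { toFun := fun z => ⟨f.comp z.1 (zero_add n), comp_mem_homCocycles hf z.2 (zero_add n)⟩
      map_add' := fun _ _ => Subtype.ext (Cochain.comp_add _ _ _ (zero_add n))
      map_smul' := fun _ _ => Subtype.ext (Cochain.comp_smul _ _ _ (zero_add n)) }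
    fun z (hz : z.1 ∈ _) => comp_mem_homCoboundaries hf hz (zero_add n)

theorem precompCohomology_comp {f : Cochain X.cx Y.cx 0} (hf : f ∈ X.homCocycles Y 0)
    {g : Cochain Y.cx X.cx 0} (hg : g ∈ Y.homCocycles X 0)
    (h : Cochain.ofHom (𝟙 X.cx) - f.comp g (add_zero 0) ∈ X.homCoboundaries X 0)
    (Z : MixedAYD k H) (n : ℤ) :
    precompCohomology hf Z n ∘ₗ precompCohomology hg Z n = LinearMap.id := by
  refine LinearMap.ext fun x => ?_
  obtain ⟨⟨z, hz⟩, rfl⟩ := Submodule.Quotient.mk_surjective _ x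
  refine ((Submodule.Quotient.eq _).2 ?_).symm
  have := comp_mem_homCoboundaries' h hz (zero_add n)
  rw [Cochain.sub_comp, Cochain.id_comp, Cochain.comp_assoc_of_first_is_zero_cochain] at this
  exact this

/-- Maps out of a K-projective resolution do not depend on its choice, up to isomorphism on
cohomology. -/
theorem nonempty_homCohomology_equiv (hP : P.IsKProjective) (hP' : P'.IsKProjective)
    {π : P ⟶ Z} {π' : P' ⟶ Z} (hπ : IsQuasiIso π) (hπ' : IsQuasiIso π') (Y : MixedAYD k H) (n : ℤ) :
    Nonempty (P'.HomCohomology Y n ≃ₗ[k] P.HomCohomology Y n) := by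
  obtain ⟨f, hf, hfπ⟩ := exists_comparison hP π hπ'
  obtain ⟨g, hg, hgπ⟩ := exists_comparison hP' π' hπ
  have key : ∀ {P P' : MixedAYD k H} {π : P ⟶ Z} {π' : P' ⟶ Z} (_ : P.IsKProjective)
      (_ : IsQuasiIso π) {f : Cochain P.cx P'.cx 0} {g : Cochain P'.cx P.cx 0}
      (_ : f ∈ P.homCocycles P' 0) (_ : g ∈ P'.homCocycles P 0)
      (_ : Cochain.ofHom (hom π) - f.comp (Cochain.ofHom (hom π')) (add_zero 0) ∈
        P.homCoboundaries Z 0)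
      (_ : Cochain.ofHom (hom π') - g.comp (Cochain.ofHom (hom π)) (add_zero 0) ∈
        P'.homCoboundaries Z 0),
      Cochain.ofHom (𝟙 P.cx) - f.comp g (add_zero 0) ∈ P.homCoboundaries P 0 := by
    intro P P' π π' hP hπ f g hf hg h1 h2
    refine mem_homCoboundaries_of_comp hP hπ (sub_mem ?_ (comp_mem_homCocycles hf hg _)) ?_
    · exact (mem_homCocycles_iff 1 (by omega) _).2 ⟨ofHom_mem_dgHom (𝟙 P), δ_ofHom _⟩
    · have h3 := add_mem h1 (comp_mem_homCoboundaries hf h2 (add_zero 0))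
      rw [Cochain.sub_comp, Cochain.id_comp, Cochain.comp_assoc_of_third_is_zero_cochain]
      rwa [Cochain.comp_sub, sub_add_sub_cancel] at h3
  exact ⟨LinearEquiv.ofLinearMap (precompCohomology hf Y n) (precompCohomology hg Y n)
    (precompCohomology_comp hf hg (key hP hπ hf hg hfπ hgπ) Y n)
    (precompCohomology_comp hg hf (key hP' hπ' hg hf hgπ hfπ) Y n)⟩

end MixedAYD

/-! ### Semi-free mixed contramodules -/

namespace AYD

/-- The natural endomorphism `1 - ς`. -/
noncomputable def curvature (M : AYD k H) : M ⟶ M := 𝟙 M - M.sigmaHom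

theorem curvature_naturality {M N : AYD k H} (f : M ⟶ N) :
    f ≫ N.curvature = M.curvature ≫ f := by
  rw [curvature, curvature, Preadditive.comp_sub, Preadditive.sub_comp, Category.comp_id,
    Category.id_comp, sigmaHom_naturality]

theorem curvature_naturality_assoc {M N L : AYD k H} (f : M ⟶ N) (g : N ⟶ L) :
    f ≫ N.curvature ≫ g = M.curvature ≫ f ≫ g := by
  rw [← Category.assoc, curvature_naturality, Category.assoc]

end AYD

/-- A graded contramodule `T` with a map `D` of degree `1` and a map `U` of degree `2` such that
`D² = (1 - ς) U` and `D U = U D`. The periodic columns of the cyclic bicomplex have this shape, with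
`U` the shift by two columns. -/
structure CurvedComplex (k H : Type u) [Field k] [Ring H] [HopfAlgebra k H] where
  T : ℤ → AYD k H
  D (i j : ℤ) (h : i + 1 = j) : T i ⟶ T j
  U (i j : ℤ) (h : i + 2 = j) : T i ⟶ T j
  D_comp_D (i j l : ℤ) (hij : i + 1 = j) (hjl : j + 1 = l) :
    D i j hij ≫ D j l hjl = AYD.curvature _ ≫ U i l (by omega)
  D_comp_U (i j j' l : ℤ) (hij : i + 1 = j) (hjl : j + 2 = l) (hij' : i + 2 = j') :
    D i j hij ≫ U j l hjl = U i j' hij' ≫ D j' l (by omega)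

namespace CurvedComplex

variable (C : CurvedComplex k H)

open Limits

/-- The differential `(x, y) ↦ (D x + (1 - ς) y, - U x - D y)` on `T ⊕ T[1]`. -/
noncomputable def freeD (i j : ℤ) (h : i + 1 = j) :
    C.T i ⊞ C.T (i + 1) ⟶ C.T j ⊞ C.T (j + 1) :=
  biprod.desc (C.D i j h ≫ biprod.inl - C.U i (j + 1) (by omega) ≫ biprod.inr)
    (AYD.curvature _ ≫ eqToHom (by rw [h]) ≫ biprod.inl -
      C.D (i + 1) (j + 1) (by omega) ≫ biprod.inr)

/-- The homotopy `(x, y) ↦ (0, x)` on `T ⊕ T[1]`. -/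
noncomputable def freeH (i j : ℤ) (h : i + -1 = j) :
    C.T i ⊞ C.T (i + 1) ⟶ C.T j ⊞ C.T (j + 1) :=
  biprod.desc (eqToHom (by rw [← h]; congr 1; omega) ≫ biprod.inr) 0

theorem inl_freeD (i j : ℤ) (h : i + 1 = j) : biprod.inl ≫ C.freeD i j h =
    C.D i j h ≫ biprod.inl - C.U i (j + 1) (by omega) ≫ biprod.inr := biprod.inl_desc _ _

theorem inr_freeD (i : ℤ) : biprod.inr ≫ C.freeD i (i + 1) rfl =
    AYD.curvature _ ≫ biprod.inl - C.D (i + 1) (i + 1 + 1) (by omega) ≫ biprod.inr := by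
  refine (biprod.inr_desc _ _).trans ?_
  rw [eqToHom_refl, Category.id_comp]

theorem inl_freeH (i : ℤ) : biprod.inl ≫ C.freeH (i + 1) i (by omega) = biprod.inr := by
  refine (biprod.inl_desc _ _).trans ?_
  rw [eqToHom_refl, Category.id_comp]

theorem inr_freeH (i j : ℤ) (h : i + -1 = j) : biprod.inr ≫ C.freeH i j h = 0 :=
  biprod.inr_desc _ _

theorem freeD_comp (i j l : ℤ) (hij : i + 1 = j) (hjl : j + 1 = l) :
    C.freeD i j hij ≫ C.freeD j l hjl = 0 := by
  subst hij hjl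
  refine biprod.hom_ext' _ _ ?_ ?_
  · rw [← Category.assoc, inl_freeD, Preadditive.sub_comp, Category.assoc, Category.assoc,
      inl_freeD, inr_freeD, Preadditive.comp_sub, Preadditive.comp_sub, ← Category.assoc,
      ← Category.assoc, ← Category.assoc, ← Category.assoc, C.D_comp_D,
      C.D_comp_U i (i + 1) (i + 1 + 1) _ _ _ (by omega), AYD.curvature_naturality, comp_zero]
    abel
  · rw [← Category.assoc, inr_freeD, Preadditive.sub_comp, Category.assoc, Category.assoc,
      inl_freeD, inr_freeD, Preadditive.comp_sub, Preadditive.comp_sub, ← Category.assoc,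
      ← Category.assoc, ← Category.assoc, ← Category.assoc, C.D_comp_D,
      AYD.curvature_naturality, comp_zero]
    abel

/-- The complex `T ⊕ T[1]`. -/
noncomputable def freeComplex : CochainComplex (AYD k H) ℤ where
  X i := C.T i ⊞ C.T (i + 1)
  d i j := if h : i + 1 = j then C.freeD i j h else 0
  shape i j h := dif_neg h
  d_comp_d' i j l hij hjl := by
    have hij : i + 1 = j := hij
    have hjl : j + 1 = l := hjl
    rw [dif_pos hij, dif_pos hjl, freeD_comp]

theorem freeComplex_d (i j : ℤ) (h : i + 1 = j) : C.freeComplex.d i j = C.freeD i j h := dif_pos h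

theorem freeH_comp_freeD (i j l : ℤ) (hij : i + -1 = j) (hil : i + 1 = l) :
    C.freeH i j hij ≫ C.freeD j i (by omega) + C.freeD i l hil ≫ C.freeH l i (by omega) =
      AYD.curvature _ := by
  obtain rfl : i = j + 1 := by omega
  subst hil
  refine biprod.hom_ext' _ _ ?_ ?_
  · rw [Preadditive.comp_add, ← Category.assoc, ← Category.assoc, inl_freeH, inr_freeD, inl_freeD,
      Preadditive.sub_comp, Category.assoc, Category.assoc, inl_freeH, inr_freeH, comp_zero,
      sub_zero, sub_add_cancel, AYD.curvature_naturality]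
  · rw [Preadditive.comp_add, ← Category.assoc, ← Category.assoc, inr_freeH, inr_freeD,
      Preadditive.sub_comp, Category.assoc, Category.assoc, inl_freeH, inr_freeH, comp_zero,
      sub_zero, zero_comp, zero_add, AYD.curvature_naturality]

/-- The semi-free mixed contramodule `T ⊕ T[1]`. A map that commutes with the homotopies is
determined by its restriction to `T`, which is an arbitrary graded map. -/
noncomputable def free : MixedAYD k H where
  cx := C.freeComplex
  h := Cochain.mk C.freeH
  h_comp_h := by
    refine Cochain.ext _ _ fun p q hpq => ?_
    rw [Cochain.comp_v _ _ _ p (p + -1) q rfl (by omega)]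
    change C.freeH p (p + -1) rfl ≫ C.freeH (p + -1) q (by omega) = 0
    refine biprod.hom_ext' _ _ ?_ ?_
    · rw [freeH, biprod.inl_desc_assoc, Category.assoc, inr_freeH, comp_zero, comp_zero]
    · rw [← Category.assoc, inr_freeH, zero_comp, comp_zero]
  homotopy i x := by
    have e := C.freeH_comp_freeD i (i - 1) (i + 1) rfl rfl
    rw [← C.freeComplex_d, ← C.freeComplex_d] at e
    exact congrArg (fun f => AYD.Hom.lin f x) e

/-- The inclusion of `T` into `T ⊕ T[1]`. -/
noncomputable def inl (p : ℤ) : C.T p ⟶ C.free.cx.X p :=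
  (biprod.inl : C.T p ⟶ C.T p ⊞ C.T (p + 1))

/-- The inclusion of `T[1]` into `T ⊕ T[1]`. -/
noncomputable def inr (p : ℤ) : C.T (p + 1) ⟶ C.free.cx.X p :=
  (biprod.inr : C.T (p + 1) ⟶ C.T p ⊞ C.T (p + 1))

/-- The map out of `T ⊕ T[1]` with given restrictions. -/
noncomputable def desc {p : ℤ} {M : AYD k H} (f : C.T p ⟶ M) (g : C.T (p + 1) ⟶ M) :
    C.free.cx.X p ⟶ M := biprod.desc f g

variable {C}

theorem inl_desc {p : ℤ} {M : AYD k H} (f : C.T p ⟶ M) (g : C.T (p + 1) ⟶ M) :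
    C.inl p ≫ desc C f g = f := biprod.inl_desc f g

theorem inr_desc {p : ℤ} {M : AYD k H} (f : C.T p ⟶ M) (g : C.T (p + 1) ⟶ M) :
    C.inr p ≫ desc C f g = g := biprod.inr_desc f g

theorem hom_ext {p : ℤ} {M : AYD k H} {f g : C.free.cx.X p ⟶ M} (h : C.inl p ≫ f = C.inl p ≫ g)
    (h' : C.inr p ≫ f = C.inr p ≫ g) : f = g := biprod.hom_ext' f g h h'

theorem inl_d (p q : ℤ) (h : p + 1 = q) : C.inl p ≫ C.free.cx.d p q =
    C.D p q h ≫ C.inl q - C.U p (q + 1) (by omega) ≫ C.inr q :=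
  (congrArg (C.inl p ≫ ·) (C.freeComplex_d p q h)).trans (C.inl_freeD p q h)

theorem inr_d (p : ℤ) : C.inr p ≫ C.free.cx.d p (p + 1) =
    AYD.curvature _ ≫ C.inl (p + 1) - C.D (p + 1) (p + 1 + 1) rfl ≫ C.inr (p + 1) :=
  (congrArg (C.inr p ≫ ·) (C.freeComplex_d p (p + 1) rfl)).trans (C.inr_freeD p)

theorem inl_h (p : ℤ) : C.inl (p + 1) ≫ C.free.h.v (p + 1) p (by omega) = C.inr p := C.inl_freeH p

theorem inr_h (p q : ℤ) (hpq : p + -1 = q) : C.inr p ≫ C.free.h.v p q hpq = 0 :=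
  C.inr_freeH p q hpq

section Maps

variable {N : MixedAYD k H} {n : ℤ}

/-- The restriction to `T` of a cochain on `T ⊕ T[1]`. -/
noncomputable def restr (f : Cochain C.free.cx N.cx n) (p q : ℤ) (hpq : p + n = q) :
    C.T p ⟶ N.cx.X q := C.inl p ≫ f.v p q hpq

/-- The restriction to `T[1]` of a cochain on `T ⊕ T[1]`. -/
noncomputable def restr' (f : Cochain C.free.cx N.cx n) (p q : ℤ) (hpq : p + n = q) :
    C.T (p + 1) ⟶ N.cx.X q := C.inr p ≫ f.v p q hpq

theorem cochain_ext {f g : Cochain C.free.cx N.cx n} (h : ∀ p q hpq, restr f p q hpq = restr g p q hpq)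
    (h' : ∀ p q hpq, restr' f p q hpq = restr' g p q hpq) : f = g :=
  Cochain.ext _ _ fun p q hpq => hom_ext (h p q hpq) (h' p q hpq)

/-- A cochain on `T ⊕ T[1]` commutes with `h` if and only if its restriction to `T[1]` is determined by
its restriction to `T` and the map `h` of the target. -/
theorem mem_dgHom_free_iff (f : Cochain C.free.cx N.cx n) : f ∈ C.free.dgHom N n ↔
    ∀ (p q : ℤ) (hpq : p + n = q), restr' f p q hpq =
      n.negOnePow • restr f (p + 1) (q + 1) (by omega) ≫ N.h.v (q + 1) q (by omega) := by
  rw [MixedAYD.mem_dgHom_iff]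
  have e1 : ∀ (p q : ℤ) (hpq : p + n = q),
      C.inl (p + 1) ≫ C.free.h.v (p + 1) p (by omega) ≫ f.v p q hpq = restr' f p q hpq := by
    intro p q hpq
    rw [← Category.assoc, inl_h, restr']
  constructor
  · intro h p q hpq
    rw [restr, Category.assoc, h (p + 1) (q + 1) p q (by omega) (by omega) (by omega),
      Linear.comp_units_smul, e1, smul_smul, Int.units_mul_self, one_smul]
  · intro h p q p' q' hpq hp hq
    obtain rfl : p = p' + 1 := by omega
    obtain rfl : q = q' + 1 := by omega
    refine hom_ext ?_ ?_
    · rw [Linear.comp_units_smul, e1, h, smul_smul, Int.units_mul_self, one_smul, restr,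
        Category.assoc]
    · rw [Linear.comp_units_smul, ← Category.assoc, ← Category.assoc, inr_h, zero_comp,
        smul_zero]
      have := h (p' + 1) (q' + 1) hpq
      rw [restr'] at this
      rw [this, Linear.units_smul_comp, Category.assoc, N.h_comp, comp_zero, smul_zero]

theorem restr_δ (f : Cochain C.free.cx N.cx n) (m p p' q q' : ℤ) (hm : n + 1 = m)
    (hpq : p + n = q) (hp : p + 1 = p') (hq : q + 1 = q') :
    restr (δ n m f) p q' (by omega) = restr f p q hpq ≫ N.cx.d q q' +
      m.negOnePow • (C.D p p' hp ≫ restr f p' q' (by omega) -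
        C.U p (p' + 1) (by omega) ≫ restr' f p' q' (by omega)) := by
  rw [restr, δ_v n m hm f p q' (by omega) q p' (by omega) hp, Preadditive.comp_add,
    Linear.comp_units_smul, ← Category.assoc, ← Category.assoc, inl_d _ _ hp,
    Preadditive.sub_comp, Category.assoc, Category.assoc]
  rfl

theorem restr'_δ (f : Cochain C.free.cx N.cx n) (m p q q' : ℤ) (hm : n + 1 = m)
    (hpq : p + n = q) (hq : q + 1 = q') :
    restr' (δ n m f) p q' (by omega) = restr' f p q hpq ≫ N.cx.d q q' +
      m.negOnePow • (AYD.curvature _ ≫ restr f (p + 1) q' (by omega) -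
        C.D (p + 1) (p + 1 + 1) rfl ≫ restr' f (p + 1) q' (by omega)) := by
  rw [restr', δ_v n m hm f p q' (by omega) q (p + 1) (by omega) rfl, Preadditive.comp_add,
    Linear.comp_units_smul, ← Category.assoc, ← Category.assoc, inr_d,
    Preadditive.sub_comp, Category.assoc, Category.assoc]
  rfl

/-- The cochain in the complex of maps with the restriction `g` to `T`. -/
noncomputable def extendCochain (g : ∀ p q : ℤ, p + n = q → (C.T p ⟶ N.cx.X q)) :
    Cochain C.free.cx N.cx n :=
  Cochain.mk fun p q hpq => desc C (g p q hpq)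
    (n.negOnePow • g (p + 1) (q + 1) (by omega) ≫ N.h.v (q + 1) q (by omega))

theorem restr_extendCochain (g : ∀ p q : ℤ, p + n = q → (C.T p ⟶ N.cx.X q)) (p q : ℤ)
    (hpq : p + n = q) : restr (extendCochain g) p q hpq = g p q hpq := inl_desc _ _

theorem restr'_extendCochain (g : ∀ p q : ℤ, p + n = q → (C.T p ⟶ N.cx.X q)) (p q : ℤ)
    (hpq : p + n = q) : restr' (extendCochain g) p q hpq =
      n.negOnePow • g (p + 1) (q + 1) (by omega) ≫ N.h.v (q + 1) q (by omega) :=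
  inr_desc _ _

theorem extendCochain_mem (g : ∀ p q : ℤ, p + n = q → (C.T p ⟶ N.cx.X q)) :
    extendCochain g ∈ C.free.dgHom N n := by
  rw [mem_dgHom_free_iff]
  intro p q hpq
  rw [restr'_extendCochain, restr_extendCochain]

end Maps

section KProjective

variable {N : MixedAYD k H} {m n : ℤ}

open Classical in
/-- A lift of `u` through the differential of `N`, if there is one, and zero otherwise. -/
noncomputable def liftD {P : AYD k H} {p q : ℤ} (u : P ⟶ N.cx.X q) : P ⟶ N.cx.X p :=
  if h : ∃ v : P ⟶ N.cx.X p, v ≫ N.cx.d p q = u then h.choose else 0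

theorem liftD_comp {P : AYD k H} (hP : P.IsProj) (hN : N.IsAcyclic) {p q r : ℤ} (hpq : p + 1 = q)
    (hqr : q + 1 = r) (u : P ⟶ N.cx.X q) (hu : u ≫ N.cx.d q r = 0) :
    liftD u ≫ N.cx.d p q = u := by
  have h := hP (N.cx.d p q) (N.cx.d q r) ((MixedAYD.isAcyclic_iff N).1 hN p q r hpq hqr) u hu
  rw [liftD, dif_pos h]
  exact h.choose_spec

/-- A primitive of the cocycle with the restriction `g` to `T`, constructed by induction on the
degree, from the top degree `0` downwards. -/
noncomputable def primitive (hm : m + 1 = n) (g : ∀ p q : ℤ, p + n = q → (C.T p ⟶ N.cx.X q))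
    (p q : ℤ) (hpq : p + m = q) : C.T p ⟶ N.cx.X q :=
  if 0 < p then 0 else
    liftD (q := q + 1) (g p (q + 1) (by omega) + m.negOnePow • C.D p (p + 1) rfl ≫
      primitive hm g (p + 1) (q + 1) (by omega) -
      C.U p (p + 2) rfl ≫ primitive hm g (p + 2) (q + 2) (by omega) ≫
        N.h.v (q + 2) (q + 1) (by omega))
termination_by (1 - p).toNat
decreasing_by all_goals omega

/-- The restrictions `g` of a cocycle to `T` are the coboundary of `primitive`, by descending induction
on the degree. -/
theorem primitive_comp_d (hT : ∀ i, (C.T i).IsProj) (hT' : ∀ i, 0 < i → IsZero (C.T i))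
    (hN : N.IsAcyclic) (hm : m + 1 = n) {g : ∀ p q : ℤ, p + n = q → (C.T p ⟶ N.cx.X q)}
    (hg : ∀ (p q : ℤ) (hpq : p + n = q), g p q hpq ≫ N.cx.d q (q + 1) =
      n.negOnePow • C.D p (p + 1) rfl ≫ g (p + 1) (q + 1) (by omega) -
      C.U p (p + 2) rfl ≫ g (p + 2) (q + 2) (by omega) ≫ N.h.v (q + 2) (q + 1) (by omega)) :
    ∀ (p q : ℤ) (hpq : p + m = q), primitive hm g p q hpq ≫ N.cx.d q (q + 1) =
      g p (q + 1) (by omega) + m.negOnePow • C.D p (p + 1) rfl ≫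
      primitive hm g (p + 1) (q + 1) (by omega) -
      C.U p (p + 2) rfl ≫ primitive hm g (p + 2) (q + 2) (by omega) ≫
        N.h.v (q + 2) (q + 1) (by omega)
  | p, q, hpq => by
    by_cases hp : 0 < p
    · exact (hT' p hp).eq_of_src _ _
    have ih1 := primitive_comp_d hT hT' hN hm hg (p + 1) (q + 1) (by omega)
    have ih2 := primitive_comp_d hT hT' hN hm hg (p + 2) (q + 2) (by omega)
    have hε : n.negOnePow = -m.negOnePow := by rw [← hm, Int.negOnePow_succ]
    -- the induction hypotheses with the indices in normal form
    have gen : ∀ (p q : ℤ) (hpq : p + m = q),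
        (primitive hm g p q hpq ≫ N.cx.d q (q + 1) =
          g p (q + 1) (by omega) + m.negOnePow • C.D p (p + 1) rfl ≫
          primitive hm g (p + 1) (q + 1) (by omega) -
          C.U p (p + 2) rfl ≫ primitive hm g (p + 2) (q + 2) (by omega) ≫
            N.h.v (q + 2) (q + 1) (by omega)) →
        ∀ (p₁ p₂ q₁ q₂ : ℤ) (h₁ : p + 1 = p₁) (h₂ : p + 2 = p₂) (e₁ : q + 1 = q₁)
          (e₂ : q + 2 = q₂), primitive hm g p q hpq ≫ N.cx.d q q₁ =
          g p q₁ (by omega) + m.negOnePow • C.D p p₁ h₁ ≫ primitive hm g p₁ q₁ (by omega) -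
          C.U p p₂ h₂ ≫ primitive hm g p₂ q₂ (by omega) ≫ N.h.v q₂ q₁ (by omega) := by
      intro p q hpq h p₁ p₂ q₁ q₂ h₁ h₂ e₁ e₂
      subst h₁ h₂ e₁ e₂
      exact h
    have ih1 := gen _ _ _ ih1 (p + 2) (p + 3) (q + 2) (q + 3) (by omega) (by omega) (by omega)
      (by omega)
    have ih2 := gen _ _ _ ih2 (p + 3) (p + 4) (q + 3) (q + 4) (by omega) (by omega) (by omega)
      (by omega)
    have hgn : g p (q + 1) (by omega) ≫ N.cx.d (q + 1) (q + 2) =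
        -(m.negOnePow • C.D p (p + 1) rfl ≫ g (p + 1) (q + 2) (by omega)) -
        C.U p (p + 2) rfl ≫ g (p + 2) (q + 3) (by omega) ≫ N.h.v (q + 3) (q + 2) (by omega) := by
      have gen' : ∀ (q q₁ q₂ : ℤ) (hpq : p + n = q) (e₁ : q + 1 = q₁) (e₂ : q + 2 = q₂),
          g p q hpq ≫ N.cx.d q q₁ = n.negOnePow • C.D p (p + 1) rfl ≫ g (p + 1) q₁ (by omega) -
          C.U p (p + 2) rfl ≫ g (p + 2) q₂ (by omega) ≫ N.h.v q₂ q₁ (by omega) := by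
        intro q q₁ q₂ hpq e₁ e₂
        subst e₁ e₂
        exact hg p q hpq
      rw [gen' (q + 1) (q + 2) (q + 3) (by omega) (by omega) (by omega), hε,
        Units.neg_smul]
    have hU : C.D p (p + 1) rfl ≫ C.U (p + 1) (p + 3) (by omega) =
        C.U p (p + 2) rfl ≫ C.D (p + 2) (p + 3) (by omega) := C.D_comp_U _ _ _ _ _ _ _
    have hD : C.D p (p + 1) rfl ≫ C.D (p + 1) (p + 2) (by omega) =
        AYD.curvature _ ≫ C.U p (p + 2) rfl := C.D_comp_D _ _ _ _ _
    have hh : N.h.v (q + 2) (q + 1) (by omega) ≫ N.cx.d (q + 1) (q + 2) =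
        AYD.curvature _ - N.cx.d (q + 2) (q + 3) ≫ N.h.v (q + 3) (q + 2) (by omega) :=
      eq_sub_of_add_eq (N.h_comp_d _ _ _ _ _)
    have hh0 : N.h.v (q + 4) (q + 3) (by omega) ≫ N.h.v (q + 3) (q + 2) (by omega) = 0 :=
      N.h_comp _ _ _ _ _
    conv_lhs => rw [primitive, if_neg hp]
    refine liftD_comp (hT p) hN rfl (show q + 1 + 1 = q + 2 by omega) _ ?_
    have hκ := AYD.curvature_naturality (C.U p (p + 2) rfl ≫
      primitive hm g (p + 2) (q + 2) (by omega))
    rw [Category.assoc] at hκ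
    have hU' := reassoc_of% hU
    have hD' := reassoc_of% hD
    have ih2' := reassoc_of% ih2
    simp only [Preadditive.comp_add, Preadditive.comp_sub, Preadditive.add_comp,
      Preadditive.sub_comp, Linear.comp_units_smul, Linear.units_smul_comp, Category.assoc,
      hgn, ih1, hh, hκ, ih2', hD', hU', hh0, comp_zero, smul_add, smul_sub, smul_smul, Int.units_mul_self, one_smul]
    abel
termination_by p => (1 - p).toNat
decreasing_by all_goals omega

/-- If `T` is bounded above and consists of projective contramodules, `free` is K-projective. -/
theorem isKProjective_free (hT : ∀ i, (C.T i).IsProj) (hT' : ∀ i, 0 < i → IsZero (C.T i)) :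
    C.free.IsKProjective := by
  intro N hN n
  rw [MixedAYD.subsingleton_homCohomology_iff]
  intro f hf
  obtain ⟨hf, hf'⟩ := (MixedAYD.mem_homCocycles_iff (n + 1) rfl f).1 hf
  have hr := (mem_dgHom_free_iff f).1 hf
  obtain ⟨m, hm⟩ : ∃ m, m + 1 = n := ⟨n - 1, by omega⟩
  have hε : (n + 1).negOnePow = -n.negOnePow := Int.negOnePow_succ n
  have hε' : n.negOnePow = -m.negOnePow := by rw [← hm, Int.negOnePow_succ]
  have hg : ∀ (p q : ℤ) (hpq : p + n = q), restr f p q hpq ≫ N.cx.d q (q + 1) =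
      n.negOnePow • C.D p (p + 1) rfl ≫ restr f (p + 1) (q + 1) (by omega) -
      C.U p (p + 2) rfl ≫ restr f (p + 2) (q + 2) (by omega) ≫
        N.h.v (q + 2) (q + 1) (by omega) := by
    intro p q hpq
    have e := restr_δ f (n + 1) p (p + 1) q (q + 1) rfl hpq rfl rfl
    have e2 : ∀ (p₂ q₂ : ℤ) (hp : p + 2 = p₂) (hq : q + 2 = q₂),
        C.U p (p + 1 + 1) (by omega) ≫ restr' f (p + 1) (q + 1) (by omega) =
        n.negOnePow • C.U p p₂ hp ≫ restr f p₂ q₂ (by omega) ≫ N.h.v q₂ (q + 1) (by omega) := by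
      intro p₂ q₂ hp hq
      obtain rfl : p₂ = p + 1 + 1 := by omega
      obtain rfl : q₂ = q + 1 + 1 := by omega
      rw [hr, Linear.comp_units_smul]
    have e3 : restr (δ n (n + 1) f) p (q + 1) (by omega) = 0 := by
      rw [hf', restr, Cochain.zero_v, comp_zero]
    rw [e3, hε, e2 _ _ rfl rfl, Units.neg_smul, smul_sub, smul_smul, Int.units_mul_self, one_smul] at e
    rw [eq_neg_of_add_eq_zero_left e.symm, neg_neg]
  have hγ := primitive_comp_d hT hT' hN hm hg
  refine (MixedAYD.mem_homCoboundaries_iff m hm f).2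
    ⟨extendCochain (primitive hm (restr f)), extendCochain_mem _, ?_⟩
  refine cochain_ext (fun p q' hpq => ?_) fun p q' hpq => ?_
  · obtain ⟨q, rfl⟩ : ∃ q, q' = q + 1 := ⟨q' - 1, by omega⟩
    have e2 : ∀ (p₂ q₂ : ℤ) (hp : p + 2 = p₂) (hq : q + 2 = q₂),
        C.U p (p + 1 + 1) (by omega) ≫
          restr' (extendCochain (primitive hm (restr f))) (p + 1) (q + 1) (by omega) =
        m.negOnePow • C.U p p₂ hp ≫ primitive hm (restr f) p₂ q₂ (by omega) ≫
          N.h.v q₂ (q + 1) (by omega) := by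
      intro p₂ q₂ hp hq
      obtain rfl : p₂ = p + 1 + 1 := by omega
      obtain rfl : q₂ = q + 1 + 1 := by omega
      rw [restr'_extendCochain, Linear.comp_units_smul]
    rw [restr_δ _ n p (p + 1) q (q + 1) hm (by omega) rfl rfl, restr_extendCochain,
      restr_extendCochain, e2 _ _ rfl rfl, hγ, hε', Units.neg_smul, smul_sub, smul_smul,
      Int.units_mul_self, one_smul]
    abel
  · obtain ⟨q, rfl⟩ : ∃ q, q' = q + 1 := ⟨q' - 1, by omega⟩
    rw [restr'_δ _ n p q (q + 1) hm (by omega) rfl, restr'_extendCochain, restr_extendCochain,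
      restr'_extendCochain, hr]
    have hh := eq_sub_of_add_eq (N.h_comp_d (q + 1) q (q + 1 + 1) (by omega) (by omega))
    have hκ := AYD.curvature_naturality (primitive hm (restr f) (p + 1) (q + 1) (by omega))
    have hγ' := reassoc_of% (hγ (p + 1) (q + 1) (by omega))
    have hh0 := N.h_comp (q + 1 + 2) (q + 1 + 1) (q + 1) (by omega) (by omega)
    rw [← AYD.curvature] at hh
    simp only [hε', Preadditive.comp_sub, Preadditive.add_comp,
      Preadditive.sub_comp, Linear.comp_units_smul, Linear.units_smul_comp, Category.assoc,
      hh, hκ, hγ', hh0, comp_zero, smul_zero, smul_add, smul_sub, smul_smul, Int.units_mul_self, one_smul,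
      Units.neg_smul, neg_mul]
    abel

end KProjective

end CurvedComplex

/-! ### The cyclic bicomplex of a paracyclic contramodule -/

namespace Paracyclic

section Rows

variable {C : Type*} [Category* C] [Preadditive C] (P : Paracyclic C)

/-- The vertical differential of the cyclic bicomplex: `b` in the even columns and `-b'` in the odd
columns. -/
def col (p q : ℕ) : P.X (q + 1) ⟶ P.X q := if Even p then P.b q else -P.b' q

/-- The horizontal differential of the cyclic bicomplex from column `p + 1` to column `p`. -/
def row (p q : ℕ) : P.X q ⟶ P.X q := if Even p then 𝟙 _ - P.t q else P.N q

theorem col_zero (q : ℕ) : P.col 0 q = P.b q := if_pos Even.zero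

theorem col_one (q : ℕ) : P.col 1 q = -P.b' q := if_neg (by decide)

theorem row_zero (q : ℕ) : P.row 0 q = 𝟙 _ - P.t q := if_pos Even.zero

theorem row_one (q : ℕ) : P.row 1 q = P.N q := if_neg (by decide)

theorem col_add_two (p q : ℕ) : P.col (p + 2) q = P.col p q := by
  simp [col, Nat.even_add]

theorem row_add_two (p q : ℕ) : P.row (p + 2) q = P.row p q := by
  simp [row, Nat.even_add]

theorem col_comp_col (p q : ℕ) : P.col p (q + 1) ≫ P.col p q = 0 := by
  unfold col
  split_ifs
  · exact P.b_comp_b q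
  · rw [Preadditive.neg_comp_neg, P.b'_comp_b']

theorem row_comp_col (p q : ℕ) :
    P.row p (q + 1) ≫ P.col p q + P.col (p + 1) q ≫ P.row p q = 0 := by
  by_cases h : Even p
  · rw [row, row, col, col, if_pos h, if_pos h, if_pos h, if_neg (by rwa [Nat.even_add_one, not_not]),
      one_sub_t_comp_b, Preadditive.neg_comp, add_neg_cancel]
  · rw [row, row, col, col, if_neg h, if_neg h, if_neg h, if_pos (by rwa [Nat.even_add_one]),
      Preadditive.comp_neg, N_comp_b', neg_add_cancel]

theorem row_comp_row (p q : ℕ) :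
    P.row (p + 1) q ≫ P.row p q = 𝟙 _ - iter (P.τ q) (q + 1) := by
  by_cases h : Even p
  · rw [row, row, if_pos h, if_neg (by rwa [Nat.even_add_one, not_not]), N_comp_one_sub_t]
  · rw [row, row, if_neg h, if_pos (by rwa [Nat.even_add_one]), one_sub_t_comp_N]

end Rows

section Families

variable (P : Paracyclic (AYD k H)) {M N : AYD k H}

/-- The families of maps to `M` from the objects of total degree `e` of the cyclic bicomplex. -/
abbrev Fam (M : AYD k H) (e : ℤ) : Type u := ∀ p q : ℕ, (p : ℤ) + q = e → (P.X q ⟶ M)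

variable {P} {e e' e'' e''' : ℤ}

/-- Precomposition with the vertical differential. -/
def famVert (h : e + 1 = e') (φ : P.Fam M e) : P.Fam M e'
  | _, 0, _ => 0
  | p, q + 1, hpq => P.col p q ≫ φ p q (by push_cast at hpq; omega)

/-- Precomposition with the horizontal differential. -/
def famHoriz (h : e + 1 = e') (φ : P.Fam M e) : P.Fam M e'
  | 0, _, _ => 0
  | p + 1, q, hpq => P.row p q ≫ φ p q (by push_cast at hpq; omega)

/-- Precomposition with the total differential. -/
def famD (h : e + 1 = e') (φ : P.Fam M e) : P.Fam M e' := fun p q hpq =>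
  famVert h φ p q hpq + famHoriz h φ p q hpq

/-- Precomposition with the shift by two columns. -/
def famU (h : e + 2 = e') (φ : P.Fam M e) : P.Fam M e'
  | 0, _, _ => 0
  | 1, _, _ => 0
  | p + 2, q, hpq => φ p q (by push_cast at hpq; omega)

theorem famD_comp (h : e + 1 = e') (φ : P.Fam M e) (f : M ⟶ N) (p q : ℕ) (hpq : (p : ℤ) + q = e') :
    famD h φ p q hpq ≫ f = famD h (fun p q hpq => φ p q hpq ≫ f) p q hpq := by
  rcases p with _ | p <;> rcases q with _ | q <;> simp [famD, famVert, famHoriz]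

theorem famU_comp (h : e + 2 = e') (φ : P.Fam M e) (f : M ⟶ N) (p q : ℕ) (hpq : (p : ℤ) + q = e') :
    famU h φ p q hpq ≫ f = famU h (fun p q hpq => φ p q hpq ≫ f) p q hpq := by
  rcases p with _ | _ | p <;> simp [famU]

/-- The differential on families is a differential up to the curvature `1 - ς`; it squares to zero on
maps to a stable contramodule. -/
theorem famD_famD (hP : ∀ n, iter (P.τ n) (n + 1) = AYD.sigmaHom _) (h : e + 1 = e')
    (h' : e' + 1 = e'') (φ : P.Fam M e) (p q : ℕ) (hpq : (p : ℤ) + q = e'') :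
    famD h' (famD h φ) p q hpq =
      AYD.curvature _ ≫ famU (show e + 2 = e'' by omega) φ p q hpq := by
  have e1 : ∀ {Z : AYD k H} (p q : ℕ) (f : P.X q ⟶ Z), P.col p (q + 1) ≫ P.col p q ≫ f = 0 :=
    fun p q f => by rw [← Category.assoc, col_comp_col, Limits.zero_comp]
  have e2 : ∀ {Z : AYD k H} (p q : ℕ) (f : P.X q ⟶ Z), P.row p (q + 1) ≫ P.col p q ≫ f =
      -(P.col (p + 1) q ≫ P.row p q ≫ f) := fun p q f => by
    rw [← Category.assoc, ← Category.assoc, ← Preadditive.neg_comp,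
      eq_neg_of_add_eq_zero_left (P.row_comp_col p q)]
  have e3 : ∀ {Z : AYD k H} (p q : ℕ) (f : P.X q ⟶ Z), P.row (p + 1) q ≫ P.row p q ≫ f =
      AYD.curvature _ ≫ f := fun p q f => by
    rw [← Category.assoc, row_comp_row, hP]; rfl
  rcases p with _ | _ | p <;> rcases q with _ | _ | q <;>
    simp [famD, famVert, famHoriz, famU, e1, e2, e3]

theorem famD_famU (h : e + 1 = e') (h' : e + 2 = e'') (h'' : e' + 2 = e''') (φ : P.Fam M e) (p q : ℕ)
    (hpq : (p : ℤ) + q = e''') :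
    famU h'' (famD h φ) p q hpq = famD (show e'' + 1 = e''' by omega) (famU h' φ) p q hpq := by
  have e1 : ∀ p q, P.col (p + 1 + 1) q = P.col p q := P.col_add_two
  have e2 : ∀ p q, P.row (p + 1 + 1) q = P.row p q := P.row_add_two
  rcases p with _ | _ | _ | p <;> rcases q with _ | q <;>
    simp [famD, famVert, famHoriz, famU, P.col_add_two 0, e1, e2]

end Families

section Bicomplex

open Limits

variable (P : Paracyclic (AYD k H))

/-- The indices of the entries of the cyclic bicomplex of total degree `-i`. -/
abbrev Idx (i : ℤ) : Type := {x : ℕ × ℕ // (x.1 : ℤ) + x.2 = -i}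

instance (i : ℤ) : Finite (Idx i) := by
  refine Set.Finite.subset (s := Set.Iic ((-i).toNat, (-i).toNat)) (Set.finite_Iic _) ?_
  rintro ⟨p, q⟩ h
  have h : (p : ℤ) + q = -i := h
  exact ⟨by dsimp only; omega, by dsimp only; omega⟩

/-- The total object of the cyclic bicomplex, with the entry `(p, q)` in the degree `-(p + q)`. -/
noncomputable def tot (i : ℤ) : AYD k H := ⨁ fun x : Idx i => P.X x.1.2

/-- The inclusion of the entry `(p, q)`. -/
noncomputable def inc (i : ℤ) : P.Fam (P.tot i) (-i) := fun p q h =>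
  biproduct.ι (fun x : Idx i => P.X x.1.2) ⟨(p, q), h⟩

variable {P} {i j : ℤ} {M : AYD k H}

/-- The map with given restrictions to the entries. -/
noncomputable def descTot (φ : P.Fam M (-i)) : P.tot i ⟶ M :=
  biproduct.desc fun x => φ x.1.1 x.1.2 x.2

theorem inc_descTot (φ : P.Fam M (-i)) (p q : ℕ) (h : (p : ℤ) + q = -i) :
    P.inc i p q h ≫ descTot φ = φ p q h := biproduct.ι_desc _ _

theorem tot_ext {f g : P.tot i ⟶ M} (h : ∀ p q h, P.inc i p q h ≫ f = P.inc i p q h ≫ g) : f = g :=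
  biproduct.hom_ext' _ _ fun x => h x.1.1 x.1.2 x.2

theorem isZero_tot (hi : 0 < i) : IsZero (P.tot i) := by
  rw [IsZero.iff_id_eq_zero]
  exact tot_ext fun p q h => by omega

variable (P) in
/-- The total differential. -/
noncomputable def totD (i j : ℤ) (h : i + 1 = j) : P.tot i ⟶ P.tot j :=
  descTot (famD (by omega) (P.inc j))

variable (P) in
/-- The shift by two columns. -/
noncomputable def totU (i j : ℤ) (h : i + 2 = j) : P.tot i ⟶ P.tot j :=
  descTot (famU (by omega) (P.inc j))

theorem inc_totD_comp (h : i + 1 = j) (f : P.tot j ⟶ M) (p q : ℕ) (hpq : (p : ℤ) + q = -i) :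
    P.inc i p q hpq ≫ P.totD i j h ≫ f =
      famD (by omega) (fun p q hpq => P.inc j p q hpq ≫ f) p q hpq := by
  rw [← Category.assoc, totD, inc_descTot, famD_comp]

theorem inc_totU_comp (h : i + 2 = j) (f : P.tot j ⟶ M) (p q : ℕ) (hpq : (p : ℤ) + q = -i) :
    P.inc i p q hpq ≫ P.totU i j h ≫ f =
      famU (by omega) (fun p q hpq => P.inc j p q hpq ≫ f) p q hpq := by
  rw [← Category.assoc, totU, inc_descTot, famU_comp]

/-- The total complex of the cyclic bicomplex, where the square of the differential is `1 - ς`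
times the shift by two columns. -/
noncomputable def curved (P : Paracyclic (AYD k H))
    (hP : ∀ n, iter (P.τ n) (n + 1) = AYD.sigmaHom _) : CurvedComplex k H where
  T := P.tot
  D := P.totD
  U := P.totU
  D_comp_D i j l hij hjl := tot_ext fun p q hpq => by
    rw [inc_totD_comp, AYD.curvature_naturality_assoc, totU, inc_descTot]
    refine Eq.trans ?_ (famD_famD hP (show -l + 1 = -j by omega) (by omega) _ p q hpq)
    congr 1
    funext p q hpq
    exact inc_descTot _ _ _ _
  D_comp_U i j j' l hij hjl hij' := tot_ext fun p q hpq => by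
    rw [inc_totD_comp, inc_totU_comp]
    have e1 : (fun p q hpq => P.inc j p q hpq ≫ P.totU j l hjl) = famU (by omega) (P.inc l) := by
      funext p q hpq; exact inc_descTot _ _ _ _
    have e2 : (fun p q hpq => P.inc j' p q hpq ≫ P.totD j' l (by omega)) =
        famD (by omega) (P.inc l) := by
      funext p q hpq; exact inc_descTot _ _ _ _
    rw [e1, e2, famD_famU]

end Bicomplex

end Paracyclic

/-! ### The semi-free resolution of the Chern character -/

namespace MixedAYD

section Inj

variable {X : ℕ → AYD k H}

theorem obj_of_eq {q : ℕ} {i : ℤ} (h : (q : ℤ) = -i) : X q = obj X i := by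
  obtain rfl : i = -q := by omega
  cases q <;> rfl

/-- The identification of `X q` with the part of degree `-q` of the graded object. -/
def inj (i : ℤ) (q : ℕ) (h : (q : ℤ) = -i) : X q ⟶ obj X i := eqToHom (obj_of_eq h)

theorem isZero_obj {i : ℤ} (h : 0 < i) : Limits.IsZero (obj X i) := by
  obtain ⟨n, rfl⟩ : ∃ n : ℕ, i = (n + 1 : ℕ) := ⟨i.toNat - 1, by omega⟩
  exact AYD.isZero_zero

theorem obj_ext {i : ℤ} {M : AYD k H} {f g : obj X i ⟶ M} (h : ∀ q h, inj i q h ≫ f = inj i q h ≫ g) :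
    f = g := by
  rcases lt_or_ge 0 i with hi | hi
  · exact (isZero_obj hi).eq_of_src _ _
  · have := h (-i).toNat (by omega)
    exact (cancel_epi (eqToHom (obj_of_eq (X := X) (q := (-i).toNat) (i := i) (by omega)))).1 this

/-- The map out of the graded object with given components. -/
def descObj {M : AYD k H} : ∀ {i : ℤ}, (∀ q : ℕ, (q : ℤ) = -i → (X q ⟶ M)) → (obj X i ⟶ M)
  | .ofNat 0, φ => φ 0 rfl
  | .ofNat (_ + 1), _ => 0
  | .negSucc n, φ => φ (n + 1) rfl

theorem inj_descObj {M : AYD k H} {i : ℤ} (φ : ∀ q : ℕ, (q : ℤ) = -i → (X q ⟶ M)) (q : ℕ)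
    (h : (q : ℤ) = -i) : inj i q h ≫ descObj φ = φ q h := by
  obtain rfl : i = -q := by omega
  cases q <;> exact Category.id_comp _

theorem inj_zero_map (b : ∀ n, X (n + 1) ⟶ X n) {i j : ℤ} (h : ((0 : ℕ) : ℤ) = -i) (hij : i + 1 = j) :
    inj i 0 h ≫ map (down b) i j = 0 :=
  (isZero_obj (by push_cast at h; omega)).eq_of_tgt _ _

theorem inj_map_down (b : ∀ n, X (n + 1) ⟶ X n) {i j : ℤ} (q : ℕ) (h : ((q + 1 : ℕ) : ℤ) = -i)
    (h' : (q : ℤ) = -j) : inj i (q + 1) h ≫ map (down b) i j = b q ≫ inj j q h' := by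
  obtain rfl : i = -(q + 1 : ℕ) := by omega
  obtain rfl : j = -q := by omega
  cases q <;>
  exact (Category.id_comp _).trans ((down_self b _).trans (Category.comp_id _).symm)

theorem inj_map_up (B : ∀ n, X n ⟶ X (n + 1)) {i j : ℤ} (q : ℕ) (h : (q : ℤ) = -i)
    (h' : ((q + 1 : ℕ) : ℤ) = -j) : inj i q h ≫ map (up B) i j = B q ≫ inj j (q + 1) h' := by
  obtain rfl : i = -q := by omega
  obtain rfl : j = -(q + 1 : ℕ) := by omega
  cases q <;>
  exact (Category.id_comp _).trans ((up_self B _).trans (Category.comp_id _).symm)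

end Inj

end MixedAYD

namespace Paracyclic

open MixedAYD

variable (P : Paracyclic (AYD k H)) (hP : ∀ n, iter (P.τ n) (n + 1) = AYD.sigmaHom _)

/-- The mixed contramodule `(X, b, B)`. -/
noncomputable def mixed : MixedAYD k H :=
  MixedAYD.ofNonpos P.b P.B P.b_comp_b
    (P.B_comp_B fun n f => by rw [hP, hP, AYD.sigmaHom_naturality])
    (fun x => by
      rw [Paracyclic.B_comp_b_zero, hP]
      rfl)
    (fun n x => by
      rw [Paracyclic.b_comp_B_add, hP]
      rfl)

/-- The semi-free mixed contramodule on the total complex of the cyclic bicomplex. -/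
noncomputable abbrev res : MixedAYD k H := (P.curved hP).free

/-- The inclusion of the first summand of `T ⊕ T[1]`. -/
noncomputable def resInl (i : ℤ) : P.tot i ⟶ (P.res hP).cx.X i := (P.curved hP).inl i

/-- The inclusion of the second summand of `T ⊕ T[1]`. -/
noncomputable def resInr (i : ℤ) : P.tot (i + 1) ⟶ (P.res hP).cx.X i := (P.curved hP).inr i

/-- The inclusion of the entry `(p, q)` of the first summand of `T ⊕ T[1]`. -/
noncomputable def entry (i : ℤ) : P.Fam ((P.res hP).cx.X i) (-i) := fun p q h =>
  P.inc i p q h ≫ P.resInl hP i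

/-- The inclusion of the entry `(p, q)` of the second summand of `T ⊕ T[1]`. -/
noncomputable def entry' (i : ℤ) : P.Fam ((P.res hP).cx.X i) (-(i + 1)) := fun p q h =>
  P.inc (i + 1) p q h ≫ P.resInr hP i

variable {P hP} {i j : ℤ} {M : AYD k H}

/-- The map with given restrictions to the entries. -/
noncomputable def descRes (φ : P.Fam M (-i)) (ψ : P.Fam M (-(i + 1))) : (P.res hP).cx.X i ⟶ M :=
  CurvedComplex.desc (P.curved hP) (descTot φ) (descTot ψ)

theorem resInl_desc (φ : P.Fam M (-i)) (ψ : P.Fam M (-(i + 1))) :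
    P.resInl hP i ≫ descRes φ ψ = descTot φ := CurvedComplex.inl_desc _ _

theorem resInr_desc (φ : P.Fam M (-i)) (ψ : P.Fam M (-(i + 1))) :
    P.resInr hP i ≫ descRes φ ψ = descTot ψ := CurvedComplex.inr_desc _ _

theorem resInl_d_comp (hij : i + 1 = j) (f : (P.res hP).cx.X j ⟶ M) :
    P.resInl hP i ≫ (P.res hP).cx.d i j ≫ f = P.totD i j hij ≫ P.resInl hP j ≫ f -
      P.totU i (j + 1) (by omega) ≫ P.resInr hP j ≫ f := by
  have e : P.resInl hP i ≫ (P.res hP).cx.d i j = P.totD i j hij ≫ P.resInl hP j -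
      P.totU i (j + 1) (by omega) ≫ P.resInr hP j := CurvedComplex.inl_d (C := P.curved hP) i j hij
  rw [← Category.assoc, e, Preadditive.sub_comp, Category.assoc, Category.assoc]

theorem resInr_d_comp (f : (P.res hP).cx.X (i + 1) ⟶ M) :
    P.resInr hP i ≫ (P.res hP).cx.d i (i + 1) ≫ f =
      AYD.curvature _ ≫ P.resInl hP (i + 1) ≫ f -
        P.totD (i + 1) (i + 1 + 1) rfl ≫ P.resInr hP (i + 1) ≫ f := by
  have e : P.resInr hP i ≫ (P.res hP).cx.d i (i + 1) = AYD.curvature _ ≫ P.resInl hP (i + 1) -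
        P.totD (i + 1) (i + 1 + 1) rfl ≫ P.resInr hP (i + 1) :=
    CurvedComplex.inr_d (C := P.curved hP) i
  rw [← Category.assoc, e, Preadditive.sub_comp, Category.assoc, Category.assoc]

theorem resInl_h (i : ℤ) :
    P.resInl hP (i + 1) ≫ (P.res hP).h.v (i + 1) i (by omega) = P.resInr hP i :=
  CurvedComplex.inl_h (C := P.curved hP) i

theorem resInr_h (hij : i + -1 = j) : P.resInr hP i ≫ (P.res hP).h.v i j hij = 0 :=
  CurvedComplex.inr_h (C := P.curved hP) i j hij

theorem entry_descRes (φ : P.Fam M (-i)) (ψ : P.Fam M (-(i + 1))) (p q : ℕ) (h) :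
    P.entry hP i p q h ≫ descRes φ ψ = φ p q h := by
  rw [entry, Category.assoc, resInl_desc, inc_descTot]

theorem entry'_descRes (φ : P.Fam M (-i)) (ψ : P.Fam M (-(i + 1))) (p q : ℕ) (h) :
    P.entry' hP i p q h ≫ descRes φ ψ = ψ p q h := by
  rw [entry', Category.assoc, resInr_desc, inc_descTot]

theorem entry_descRes_assoc (φ : P.Fam M (-i)) (ψ : P.Fam M (-(i + 1))) {N : AYD k H} (f : M ⟶ N)
    (p q : ℕ) (h) : P.entry hP i p q h ≫ descRes φ ψ ≫ f = φ p q h ≫ f := by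
  rw [← Category.assoc, entry_descRes]

theorem entry'_descRes_assoc (φ : P.Fam M (-i)) (ψ : P.Fam M (-(i + 1))) {N : AYD k H} (f : M ⟶ N)
    (p q : ℕ) (h) : P.entry' hP i p q h ≫ descRes φ ψ ≫ f = ψ p q h ≫ f := by
  rw [← Category.assoc, entry'_descRes]

theorem res_ext {f g : (P.res hP).cx.X i ⟶ M}
    (h : ∀ p q h, P.entry hP i p q h ≫ f = P.entry hP i p q h ≫ g)
    (h' : ∀ p q h, P.entry' hP i p q h ≫ f = P.entry' hP i p q h ≫ g) : f = g := by
  simp only [entry, entry', Category.assoc] at h h'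
  exact CurvedComplex.hom_ext (tot_ext h) (tot_ext h')

theorem entry_d_comp (hij : i + 1 = j) (f : (P.res hP).cx.X j ⟶ M) (p q : ℕ) (h) :
    P.entry hP i p q h ≫ (P.res hP).cx.d i j ≫ f =
      famD (by omega) (fun p q h => P.entry hP j p q h ≫ f) p q h -
        famU (by omega) (fun p q h => P.entry' hP j p q h ≫ f) p q h := by
  simp only [entry, entry', Category.assoc]
  rw [resInl_d_comp hij, Preadditive.comp_sub, inc_totD_comp, inc_totU_comp]

theorem entry'_d_comp (f : (P.res hP).cx.X (i + 1) ⟶ M) (p q : ℕ) (h) :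
    P.entry' hP i p q h ≫ (P.res hP).cx.d i (i + 1) ≫ f =
      AYD.curvature _ ≫ P.entry hP (i + 1) p q h ≫ f -
        famD (by omega) (fun p q h => P.entry' hP (i + 1) p q h ≫ f) p q h := by
  simp only [entry, entry', Category.assoc]
  rw [resInr_d_comp, Preadditive.comp_sub, inc_totD_comp, AYD.curvature_naturality_assoc]

theorem entry_h (p q : ℕ) (h) :
    P.entry hP (i + 1) p q h ≫ (P.res hP).h.v (i + 1) i (by omega) = P.entry' hP i p q h := by
  rw [entry, Category.assoc, resInl_h, entry']

theorem entry'_h (hij : i + -1 = j) (p q : ℕ) (h) :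
    P.entry' hP i p q h ≫ (P.res hP).h.v i j hij = 0 := by
  rw [entry', Category.assoc, resInr_h, Limits.comp_zero]

variable (P) in
/-- The restriction of the augmentation to the first summand of `T ⊕ T[1]`. -/
def aug₀ (i : ℤ) : P.Fam (obj P.X i) (-i)
  | 0, q, h => inj i q (by push_cast at h; omega)
  | 1, q, h => P.s' q ≫ (𝟙 _ - P.t (q + 1)) ≫ inj i (q + 1) (by push_cast at h ⊢; omega)
  | _ + 2, _, _ => 0

variable (P) in
/-- The restriction of the augmentation to the second summand of `T ⊕ T[1]`. -/
def aug₁ (i : ℤ) : P.Fam (obj P.X i) (-(i + 1))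
  | 0, q, h => P.B q ≫ inj i (q + 1) (by push_cast at h ⊢; omega)
  | _ + 1, _, _ => 0

variable (P hP) in
/-- The components of the augmentation. -/
noncomputable def augX (i : ℤ) : (P.res hP).cx.X i ⟶ obj P.X i := descRes (P.aug₀ i) (P.aug₁ i)

theorem augX_d (hij : i + 1 = j) :
    P.augX hP i ≫ map (down P.b) i j = (P.res hP).cx.d i j ≫ P.augX hP j := by
  subst hij
  have hs : ∀ {Z : AYD k H} (q : ℕ) (f : P.X (q + 1) ⟶ Z),
      P.s' (q + 1) ≫ P.b' (q + 1) ≫ f = f - P.b' q ≫ P.s' q ≫ f := fun q f => by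
    rw [← Category.assoc, eq_sub_of_add_eq' (P.b's'_add_s'b' q), Preadditive.sub_comp,
      Category.id_comp, Category.assoc]
  have hs0 : ∀ {Z : AYD k H} (f : P.X 0 ⟶ Z), P.s' 0 ≫ P.b' 0 ≫ f = f := fun f => by
    rw [← Category.assoc, s'_comp_b'_zero, Category.id_comp]
  have ht : ∀ {Z : AYD k H} (q : ℕ) (f : P.X q ⟶ Z), (𝟙 _ - P.t (q + 1)) ≫ P.b q ≫ f =
      P.b' q ≫ (𝟙 _ - P.t q) ≫ f := fun q f => by
    rw [← Category.assoc, one_sub_t_comp_b, Category.assoc]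
  have hB0 : ∀ {Z : AYD k H} (f : P.X 0 ⟶ Z), P.B 0 ≫ P.b 0 ≫ f = AYD.curvature _ ≫ f :=
    fun f => by rw [← Category.assoc, B_comp_b_zero, hP]; rfl
  have hB : ∀ {Z : AYD k H} (q : ℕ) (f : P.X (q + 1) ⟶ Z), P.B (q + 1) ≫ P.b (q + 1) ≫ f =
      AYD.curvature _ ≫ f - P.b q ≫ P.B q ≫ f := fun q f => by
    rw [← Category.assoc, eq_sub_of_add_eq' (P.b_comp_B_add q), hP, Preadditive.sub_comp,
      Category.assoc]
    rfl
  have hN : ∀ {Z : AYD k H} (q : ℕ) (f : P.X q ⟶ Z), (𝟙 _ - P.t q) ≫ P.N q ≫ f =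
      AYD.curvature _ ≫ f := fun q f => by
    rw [← Category.assoc, one_sub_t_comp_N, hP]; rfl
  refine res_ext (fun p q h => ?_) fun p q h => ?_
  · rw [entry_d_comp rfl]
    simp only [augX, entry_descRes, entry'_descRes]
    rw [← Category.assoc, entry_descRes]
    rcases p with _ | _ | p
    · rcases q with _ | q
      · simp [aug₀, famD, famVert, famHoriz, famU, inj_zero_map P.b (j := i + 1)]
      · simp [aug₀, famD, famVert, famHoriz, famU, inj_map_down P.b (j := i + 1) q _ (by push_cast at h ⊢; omega), col_zero]
    · rcases q with _ | q
      · have e := P.row_zero 0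
        simp only [aug₀, famD, famVert, famHoriz, famU, Category.assoc, zero_add,
          inj_map_down P.b (j := i + 1) 0 _ (by push_cast at h ⊢; omega), ht, hs0, e, sub_zero]
      · have e := P.row_zero (q + 1)
        have e1 := P.col_one q
        simp only [aug₀, famD, famVert, famHoriz, famU, Category.assoc, zero_add, sub_zero,
          inj_map_down P.b (j := i + 1) (q + 1) _ (by push_cast at h ⊢; omega), ht, hs, e, e1]
        rw [Preadditive.neg_comp, neg_add_eq_sub]
    · rcases p with _ | p
      · have e := P.row_one q
        have e' : P.B q = P.N q ≫ P.s' q ≫ (𝟙 _ - P.t (q + 1)) := rfl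
        rcases q with _ | q <;> simp [aug₀, aug₁, famD, famVert, famHoriz, famU, e, e']
      · rcases q with _ | q <;> simp [aug₀, aug₁, famD, famVert, famHoriz, famU]
  · rw [entry'_d_comp]
    simp only [augX, entry_descRes, entry'_descRes]
    rw [← Category.assoc, entry'_descRes]
    rcases p with _ | _ | p
    · rcases q with _ | q
      · simp only [aug₀, aug₁, famD, famVert, famHoriz, Category.assoc, add_zero, sub_zero,
          inj_map_down P.b (j := i + 1) 0 _ (by push_cast at h ⊢; omega), hB0]
      · simp only [aug₀, aug₁, famD, famVert, famHoriz, Category.assoc, add_zero, col_zero,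
          inj_map_down P.b (j := i + 1) (q + 1) _ (by push_cast at h ⊢; omega), hB]
    · have e := P.row_zero q
      have e' : P.B q = P.N q ≫ P.s' q ≫ (𝟙 _ - P.t (q + 1)) := rfl
      rcases q with _ | q <;>
        simp [aug₀, aug₁, famD, famVert, famHoriz, e, e', hN]
    · rcases q with _ | q <;> simp [aug₀, aug₁, famD, famVert, famHoriz]

theorem augX_h (hij : i + -1 = j) :
    P.augX hP i ≫ map (up P.B) i j = (P.res hP).h.v i j hij ≫ P.augX hP j := by
  obtain rfl : i = j + 1 := by omega
  have hB : ∀ q : ℕ, P.B q ≫ P.B (q + 1) = 0 :=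
    P.B_comp_B fun n f => by rw [hP, hP, AYD.sigmaHom_naturality]
  have hs : ∀ q : ℕ, P.s' q ≫ (𝟙 _ - P.t (q + 1)) ≫ P.B (q + 1) = 0 := fun q => by
    rw [B, ← Category.assoc (𝟙 _ - P.t (q + 1)), one_sub_t_comp_N, hP, ← AYD.curvature,
      AYD.curvature_naturality_assoc, ← Category.assoc (P.s' q), s'_comp_s', Limits.zero_comp,
      Limits.comp_zero]
  refine res_ext (fun p q h => ?_) fun p q h => ?_
  · rw [← Category.assoc, ← Category.assoc, entry_h, augX, augX, entry'_descRes, entry_descRes]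
    rcases p with _ | _ | p
    · exact inj_map_up P.B q (by push_cast at h ⊢; omega) (by push_cast at h ⊢; omega)
    · simp only [aug₀, aug₁, Category.assoc]
      rw [inj_map_up P.B (q + 1) _ (by push_cast at h ⊢; omega), reassoc_of% (hs q),
        Limits.zero_comp]
    · exact Limits.zero_comp
  · rw [← Category.assoc, ← Category.assoc, entry'_h, augX, entry'_descRes, Limits.zero_comp]
    rcases p with _ | p
    · simp only [aug₁, Category.assoc]
      rw [inj_map_up P.B (q + 1) _ (by push_cast at h ⊢; omega), reassoc_of% (hB q),
        Limits.zero_comp]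
    · exact Limits.zero_comp

variable (P hP) in
/-- The augmentation of the total complex, as a map of complexes. -/
noncomputable def augCx : (P.res hP).cx ⟶ (P.mixed hP).cx where
  f := P.augX hP
  comm' _ _ hij := augX_d hij

variable (P hP) in
/-- The augmentation from the semi-free mixed contramodule. -/
noncomputable def aug : P.res hP ⟶ P.mixed hP := ⟨P.augCx hP, fun _ _ => augX_h⟩

theorem entry_d (hij : i + 1 = j) (p q : ℕ) (h) :
    P.entry hP i p q h ≫ (P.res hP).cx.d i j =
      famD (by omega) (P.entry hP j) p q h - famU (by omega) (P.entry' hP j) p q h := by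
  have e := entry_d_comp hij (𝟙 _) p q h (hP := hP)
  simpa only [Category.comp_id] using e

variable (P hP) in
/-- The inclusion of the column `p = 0`. -/
noncomputable def colZeroX (i : ℤ) : obj P.X i ⟶ (P.res hP).cx.X i :=
  descObj fun q h => P.entry hP i 0 q (by push_cast; omega)

theorem colZeroX_d (hij : i + 1 = j) :
    P.colZeroX hP i ≫ (P.res hP).cx.d i j = map (down P.b) i j ≫ P.colZeroX hP j := by
  refine obj_ext fun q h => ?_
  rw [← Category.assoc, colZeroX, inj_descObj, entry_d hij, ← Category.assoc]
  rcases q with _ | q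
  · rw [inj_zero_map P.b h hij]
    simp [famD, famVert, famHoriz, famU]
  · rw [inj_map_down P.b q h (by push_cast at h; omega), Category.assoc, colZeroX, inj_descObj]
    simp [famD, famVert, famHoriz, famU, col_zero]

variable (P hP) in
/-- The inclusion of the column `p = 0`, as a map of complexes. It does not commute with the
homotopies. -/
noncomputable def colZero : (P.mixed hP).cx ⟶ (P.res hP).cx where
  f := P.colZeroX hP
  comm' _ _ hij := colZeroX_d hij

theorem colZeroX_comp_augX (i : ℤ) : P.colZeroX hP i ≫ P.augX hP i = 𝟙 _ := by
  refine obj_ext fun q h => ?_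
  rw [← Category.assoc, colZeroX, inj_descObj, augX, entry_descRes, Category.comp_id]
  rfl

variable (P hP) in
/-- The restriction to `T` of the homotopy between the identity and the projection to the column
`p = 0`: it contracts the odd column `p = 1` by `s'`. -/
noncomputable def contr₀ (i j : ℤ) (hij : i + -1 = j) : P.Fam ((P.res hP).cx.X j) (-i)
  | 1, q, h => -P.s' q ≫ P.entry hP j 1 (q + 1) (by push_cast at h ⊢; omega)
  | 0, _, _ => 0
  | _ + 2, _, _ => 0

variable (P hP) in
/-- The restriction to `T[1]` of the homotopy between the identity and the projection to the column
`p = 0`: it identifies `T[1]` with the columns `p ≥ 2` of `T`, up to a correction. -/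
noncomputable def contr₁ (i j : ℤ) (hij : i + -1 = j) : P.Fam ((P.res hP).cx.X j) (-(i + 1))
  | 0, q, h => -P.entry hP j 2 q (by push_cast at h ⊢; omega) -
      P.N q ≫ P.s' q ≫ P.entry hP j 1 (q + 1) (by push_cast at h ⊢; omega)
  | p + 1, q, h => -P.entry hP j (p + 3) q (by push_cast at h ⊢; omega)

variable (P hP) in
/-- The homotopy between the identity and the projection to the column `p = 0`. -/
noncomputable def contrX (i j : ℤ) (hij : i + -1 = j) : (P.res hP).cx.X i ⟶ (P.res hP).cx.X j :=
  descRes (P.contr₀ hP i j hij) (P.contr₁ hP i j hij)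

/-- The resolution is homotopy equivalent to the column `p = 0` as a complex; the homotopy need not
commute with `h`. -/
theorem contrX_comm (i j l : ℤ) (hij : i + -1 = j) (hl : l + -1 = i) :
    P.contrX hP i j hij ≫ (P.res hP).cx.d j i + (P.res hP).cx.d i l ≫ P.contrX hP l i hl =
      𝟙 _ - P.augX hP i ≫ P.colZeroX hP i := by
  obtain rfl : l = i + 1 := by omega
  have hs : ∀ {Z : AYD k H} (q : ℕ) (f : P.X (q + 1) ⟶ Z),
      P.s' (q + 1) ≫ P.b' (q + 1) ≫ f = f - P.b' q ≫ P.s' q ≫ f := fun q f => by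
    rw [← Category.assoc, eq_sub_of_add_eq' (P.b's'_add_s'b' q), Preadditive.sub_comp,
      Category.id_comp, Category.assoc]
  have hs0 : ∀ {Z : AYD k H} (f : P.X 0 ⟶ Z), P.s' 0 ≫ P.b' 0 ≫ f = f := fun f => by
    rw [← Category.assoc, s'_comp_b'_zero, Category.id_comp]
  have hN : ∀ {Z : AYD k H} (q : ℕ) (f : P.X q ⟶ Z), AYD.curvature _ ≫ f =
      P.N q ≫ f - P.t q ≫ P.N q ≫ f := fun q f => by
    rw [AYD.curvature, ← hP, ← one_sub_t_comp_N, Category.assoc, Preadditive.sub_comp,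
      Category.id_comp]
  have hbN : ∀ {Z : AYD k H} (q : ℕ) (f : P.X q ⟶ Z), P.N (q + 1) ≫ P.b' q ≫ f =
      P.b q ≫ P.N q ≫ f := fun q f => by
    rw [← Category.assoc, N_comp_b', Category.assoc]
  have hd := fun p q h => entry_d (P := P) (hP := hP) (show j + 1 = i by omega) p q h
  have hinj : ∀ q h, inj i q h ≫ P.colZeroX hP i = P.entry hP i 0 q (by push_cast; omega) :=
    fun q h => inj_descObj _ _ _
  refine res_ext (fun p q h => ?_) fun p q h => ?_
  · rw [Preadditive.comp_add, entry_d_comp rfl, Preadditive.comp_sub, Category.comp_id, augX,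
      entry_descRes_assoc]
    simp only [contrX, entry_descRes, entry'_descRes, entry_descRes_assoc]
    rcases p with _ | _ | _ | p
    · rcases q with _ | q <;>
        simp [contr₀, aug₀, famD, famVert, famHoriz, famU, hinj]
    · have e := P.row_zero (q + 1)
      rcases q with _ | q
      · have e' := P.col_one 0
        simp [contr₀, aug₀, famD, famVert, famHoriz, famU, hd, hinj, e, e', hs0]
        abel
      · have e' := P.col_one
        simp [contr₀, aug₀, famD, famVert, famHoriz, famU, hd, hinj, e, e', hs]
        abel
    · have e := P.row_one q
      rcases q with _ | q <;>
      · simp [contr₀, contr₁, aug₀, famD, famVert, famHoriz, famU, e]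
        abel
    · rcases q with _ | q <;>
        simp [contr₀, contr₁, aug₀, famD, famVert, famHoriz, famU]
  · rw [Preadditive.comp_add, entry'_d_comp, Preadditive.comp_sub, Category.comp_id, augX,
      entry'_descRes_assoc]
    simp only [contrX, entry_descRes, entry'_descRes, entry'_descRes_assoc]
    have e0 := P.row_zero
    have e1 := P.row_one
    have e2 := P.col_zero
    have e3 := P.col_one
    have e4 := P.row_add_two
    have e5 := P.col_add_two
    rcases p with _ | _ | p
    · rcases q with _ | q
      · simp [contr₀, contr₁, aug₁, famD, famVert, famHoriz, famU, hd, hinj, e0, e1, e3, hs0, B]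
        abel
      · simp [contr₀, contr₁, aug₁, famD, famVert, famHoriz, famU, hd, hinj, e0, e1, e2, e3,
          e5 0, hs, hbN, B]
        abel
    · rcases q with _ | q
      · simp [contr₀, contr₁, aug₁, famD, famVert, famHoriz, famU, hd, e0, e4 0, hN]
        abel
      · simp [contr₀, contr₁, aug₁, famD, famVert, famHoriz, famU, hd, e0, e4 0, e5 1, hN]
        abel
    · rcases q with _ | q
      · simp [contr₀, contr₁, aug₁, famD, famVert, famHoriz, famU, hd, e4]
      · simp [contr₀, contr₁, aug₁, famD, famVert, famHoriz, famU, hd, e4, e5]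
        abel

variable (P hP) in
/-- The augmentation is a homotopy equivalence of complexes. -/
noncomputable def augEquiv : HomotopyEquiv (P.res hP).cx (P.mixed hP).cx where
  hom := P.augCx hP
  inv := P.colZero hP
  homotopyHomInvId := (Cochain.equivHomotopy _ _).symm
    ⟨-Cochain.mk (P.contrX hP), by
      refine Cochain.ext _ _ fun i l hil => ?_
      obtain rfl : i = l := by omega
      rw [δ_neg, Cochain.add_v, Cochain.neg_v,
        δ_v (-1) 0 (by omega) _ i i hil (i - 1) (i + 1) (by omega) rfl, Cochain.mk_v, Cochain.mk_v,
        Cochain.ofHom_v, Cochain.ofHom_v, Int.negOnePow_zero, one_smul]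
      have e := contrX_comm (P := P) (hP := hP) i (i - 1) (i + 1) (by omega) (by omega)
      rw [e]
      change P.augX hP i ≫ P.colZeroX hP i = -(𝟙 _ - P.augX hP i ≫ P.colZeroX hP i) + 𝟙 _
      abel⟩
  homotopyInvHomId := Homotopy.ofEq (by
    ext1 i
    exact colZeroX_comp_augX i)

theorem isQuasiIso_aug : MixedAYD.IsQuasiIso (P.aug hP) :=
  inferInstanceAs (QuasiIso ((AYD.forget k H).mapHomotopyEquiv (P.augEquiv hP)).hom)

end Paracyclic

/-! ### Comparison of the cyclic operators -/

section Comparison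

variable {A : Type u} [Ring A] [Algebra k A] [Module H A] [IsScalarTower k H A]
  (hS : Function.Bijective (HopfAlgebra.antipode k : H →ₗ[k] H)) (hA : IsModuleAlgebra k H A)
  (M : AYD k H)

/-- The rotation inverts the backward rotation. -/
theorem sw_rot_rotBack (n : ℕ) (v : (Pow k H A (n + 1)).V) (h : H) :
    sw k (fun x y => rot k H A n (rotBack hS A n v x) y) h = counit (R := k) h • v := by
  have hl : IsLinearMap k fun v => sw k (fun x y => rot k H A n (rotBack hS A n v x) y) h := by
    constructor <;> intros <;> simp [sw, Finset.sum_add_distrib, Finset.smul_sum]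
  refine LinearMap.congr_fun (f := hl.mk') (g := counit (R := k) h • LinearMap.id)
    (TensorProduct.ext' (M := (Pow k H A n).V) (N := A) fun w a => ?_) v
  have e : ∀ x y : H, rot k H A n (rotBack hS A n (w ⊗ₜ[k] a : (Pow k H A n).V ⊗[k] A) x) y =
      (w ⊗ₜ[k] ((y * antipodeInv hS x) • a) : (Pow k H A n).V ⊗[k] A) := by
    intro x y
    rw [rotBack_tmul, mul_smul]
    exact congrArg (fun z => moveFirst k H A (Pow k H A n).V z y)
      ((front k H A n).symm_apply_apply _)
  refine (congrArg (sw k · h) (funext₂ e)).trans ?_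
  refine (sw_mul_antipodeInv hS
    (fun t => (w ⊗ₜ[k] (t • a) : (Pow k H A n).V ⊗[k] A)) ?_ h).trans ?_
  · constructor <;> intros <;> simp [add_smul, tmul_add]
  · rw [one_smul]; rfl

variable {M}

/-- The restriction of a map out of `Tr(A^{⊗ (n + 1)})` along the unit `A^{⊗ (n + 1)} → Tr(A^{⊗ (n + 1)})`. -/
noncomputable def toHomH (n : ℕ) : ((trPow hA).X n ⟶ M) →ₗ[k] HomH A M n where
  toFun u := ⟨AYD.Hom.lin u ∘ₗ AYD.trUnit (Pow k H A (n + 1)), AYD.isHLinear_lin_comp_trUnit u⟩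
  map_add' _ _ := rfl
  map_smul' _ _ := rfl

variable {hA}

theorem toHomH_injective (n : ℕ) : Function.Injective (toHomH (M := M) hA n) := by
  intro u u' h
  refine AYD.hom_ext fun φ => ?_
  have h := congrArg Subtype.val h
  exact (AYD.lin_Tr_apply (V := Pow k H A (n + 1)) u φ).trans ((congrArg (fun f => M.α (f ∘ₗ φ)) h).trans
    (AYD.lin_Tr_apply (V := Pow k H A (n + 1)) u' φ).symm)

theorem toHomH_surjective (n : ℕ) : Function.Surjective (toHomH (M := M) hA n) := fun f =>
  ⟨AYD.extend (V := Pow k H A (n + 1)) f.1 f.2,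
    Subtype.ext (LinearMap.ext fun v => AYD.extend_trUnit f.1 f.2 v)⟩

theorem coface_toHomH {n i : ℕ} (u : (trPow hA).X n ⟶ M) :
    coface M hA n i (toHomH hA n u) = toHomH hA (n + 1) ((trPow hA).d n (n - i) ≫ u) := by
  refine Subtype.ext (LinearMap.ext fun v => congrArg (AYD.Hom.lin u) ?_)
  exact LinearMap.ext fun h => (map_smul (mulAt k H A n (n - i)) (counit (R := k) h) v).symm

theorem lin_tau_trUnit (n : ℕ) (v : (Pow k H A (n + 1)).V) :
    AYD.Hom.lin (tau k H A n) (AYD.trUnit (Pow k H A (n + 1)) v) = rot k H A n v :=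
  AYD.extend_trUnit _ _ _

/-- Under the identification of `Hom(Tr(A^{⊗ (n + 1)}), M)` with `Hom_H(A^{⊗ (n + 1)}, M)` the cyclic
operator is inverse to the precomposition with `τ`. -/
theorem cyclicOp_toHomH {n : ℕ} (u : (trPow hA).X n ⟶ M) :
    cyclicOp hS A M n (toHomH hA n ((trPow hA).τ n ≫ u)) = toHomH hA n u := by
  refine Subtype.ext (LinearMap.ext fun v => ?_)
  have e1 : ∀ w, (toHomH hA n ((trPow hA).τ n ≫ u)).1 w =
      M.α ((toHomH hA n u).1 ∘ₗ rot k H A n w) := fun w =>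
    (congrArg (AYD.Hom.lin u) (lin_tau_trUnit n w)).trans
      (AYD.lin_Tr_apply (V := Pow k H A (n + 1)) u _)
  have e2 : (toHomH hA n ((trPow hA).τ n ≫ u)).1 ∘ₗ rotBack hS A n v = M.α ∘ₗ
      (LinearMap.llcomp k H _ M.V (toHomH hA n u).1 ∘ₗ rot k H A n ∘ₗ rotBack hS A n v) :=
    LinearMap.ext fun h => e1 _
  rw [cyclicOp_apply, e2, M.α_assoc]
  refine (congrArg M.α (LinearMap.ext fun h => ?_)).trans (M.α_counit _)
  refine (lift_comul _ h).trans ?_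
  refine (map_sw (toHomH hA n u).1 (fun x y => rot k H A n (rotBack hS A n v x) y) h).symm.trans ?_
  rw [sw_rot_rotBack, map_smul]
  rfl

variable (hA)

theorem t_toHomH {n : ℕ} (u : (trPow hA).X n ⟶ M) :
    (hopfCyclicData hS M hA).t n (toHomH hA n ((trPow hA).t n ≫ u)) = toHomH hA n u := by
  rw [Paracyclic.t, Preadditive.zsmul_comp, map_zsmul, map_zsmul, CyclicData.t,
    LinearMap.smul_apply, smul_smul, ← mul_pow, neg_one_mul, neg_neg, one_pow, one_smul]
  exact cyclicOp_toHomH hS u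

theorem t_pow_toHomH {n : ℕ} (i : ℕ) (u : (trPow hA).X n ⟶ M) :
    ((hopfCyclicData hS M hA).t n ^ i) (toHomH hA n (iter ((trPow hA).t n) i ≫ u)) =
      toHomH hA n u := by
  induction i generalizing u with
  | zero => rw [iter_zero, Category.id_comp]; rfl
  | succ i ih =>
    rw [pow_succ', iter_succ, Category.assoc, Module.End.mul_apply, ih, t_toHomH]

theorem iter_t_comp (hM : M.IsStable) {n : ℕ} (u : (trPow hA).X n ⟶ M) : iter ((trPow hA).t n) (n + 1) ≫ u = u := by
  refine AYD.hom_ext fun x => ?_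
  rw [Paracyclic.t_pow, AYD.lin_comp, LinearMap.comp_apply, trPow_iter, ← AYD.sigma_naturality, hM]

/-- The cyclic operators are inverse to each other, and `t` has order `n + 1` on maps to a stable
contramodule, so that the sums over its powers agree up to precomposition with `t`. -/
theorem N_toHomH (hM : M.IsStable) {n : ℕ} (u : (trPow hA).X n ⟶ M) :
    (hopfCyclicData hS M hA).N n (toHomH hA n u) =
      toHomH hA n ((trPow hA).t n ≫ (trPow hA).N n ≫ u) := by
  have e : ∀ i ∈ Finset.range (n + 1), ((hopfCyclicData hS M hA).t n ^ i) (toHomH hA n u) =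
      toHomH hA n ((trPow hA).t n ≫ iter ((trPow hA).t n) (n - i) ≫ u) := by
    intro i hi
    have hi : i ≤ n := by have := Finset.mem_range.1 hi; omega
    rw [← t_pow_toHomH hS hA i ((trPow hA).t n ≫ iter ((trPow hA).t n) (n - i) ≫ u)]
    refine congrArg (fun w => ((hopfCyclicData hS M hA).t n ^ i) (toHomH hA n w)) ?_
    have e1 : iter ((trPow hA).t n) i ≫ (trPow hA).t n ≫ iter ((trPow hA).t n) (n - i) =
        iter ((trPow hA).t n) (n + 1) := by
      change ((show End _ from (trPow hA).t n) ^ (n - i) * (show End _ from (trPow hA).t n)) *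
        (show End _ from (trPow hA).t n) ^ i = (show End _ from (trPow hA).t n) ^ (n + 1)
      rw [← pow_succ, ← pow_add]
      congr 1
      omega
    rw [← Category.assoc ((trPow hA).t n), ← Category.assoc, e1, iter_t_comp hA hM]
  rw [CyclicData.N, LinearMap.sum_apply, Finset.sum_congr rfl e, ← map_sum,
    ← Preadditive.comp_sum, ← Preadditive.sum_comp, Paracyclic.N]
  congr 3
  exact Finset.sum_range_reflect (fun i => iter ((trPow hA).t n) i) (n + 1)

theorem hopfCyclicData_δ_of_le {n i : ℕ} (h : i ≤ n) :
    (hopfCyclicData hS M hA).δ n i = coface M hA n i := if_pos h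

theorem hopfCyclicData_δ_last (n : ℕ) : (hopfCyclicData hS M hA).δ n (n + 1) =
    cyclicOp hS A M (n + 1) ∘ₗ coface M hA n 0 := if_neg (by omega)

theorem b'_toHomH {n : ℕ} (u : (trPow hA).X n ⟶ M) :
    (hopfCyclicData hS M hA).b' n (toHomH hA n u) =
      (-1 : ℤ) ^ n • toHomH hA (n + 1) ((trPow hA).b' n ≫ u) := by
  have e : ∀ i ∈ Finset.range (n + 1),
      ((-1 : ℤ) ^ i • (hopfCyclicData hS M hA).δ n i) (toHomH hA n u) =
      (-1 : ℤ) ^ n • toHomH hA (n + 1) (((-1 : ℤ) ^ (n - i) • (trPow hA).face n (n - i)) ≫ u) := by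
    intro i hi
    have hi : i ≤ n := by have := Finset.mem_range.1 hi; omega
    rw [(trPow hA).face_of_le (Nat.sub_le n i), Preadditive.zsmul_comp, map_zsmul, ← coface_toHomH,
      smul_smul, LinearMap.smul_apply, hopfCyclicData_δ_of_le hS hA hi, ← pow_add,
      show n + (n - i) = i + 2 * (n - i) by omega, pow_add, pow_mul, neg_one_sq, one_pow, mul_one]
  rw [CyclicData.b', LinearMap.sum_apply, Finset.sum_congr rfl e, ← Finset.smul_sum, ← map_sum,
    ← Preadditive.sum_comp, Paracyclic.b']
  congr 3
  exact Finset.sum_range_reflect (fun i => (-1 : ℤ) ^ i • (trPow hA).face n i) (n + 1)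

/-- On maps of the form `t ≫ u`, the coface `δ_i` corresponds, up to sign, to the face `d_{n+1-i}`
before `u`, for every `i ≤ n + 1`; without the factor `t` the reversal is `i ↦ n - i`, which misses
the last coface and the last face. -/
theorem b_toHomH {n : ℕ} (u : (trPow hA).X n ⟶ M) :
    (hopfCyclicData hS M hA).b n (toHomH hA n ((trPow hA).t n ≫ u)) =
      (-1 : ℤ) ^ n • toHomH hA (n + 1) ((trPow hA).t (n + 1) ≫ (trPow hA).b n ≫ u) := by
  have e : (hopfCyclicData hS M hA).b n = (hopfCyclicData hS M hA).b' n +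
      (-1 : ℤ) ^ (n + 1) • (hopfCyclicData hS M hA).δ n (n + 1) := Finset.sum_range_succ _ _
  have e1 : (hopfCyclicData hS M hA).δ n (n + 1) (toHomH hA n ((trPow hA).t n ≫ u)) =
      (-1 : ℤ) ^ n • toHomH hA (n + 1) ((trPow hA).face n (n + 1) ≫ u) := by
    rw [hopfCyclicData_δ_last, LinearMap.comp_apply, coface_toHomH, Paracyclic.t, Preadditive.zsmul_comp,
      Preadditive.comp_zsmul, map_zsmul, map_zsmul, Nat.sub_zero,
      ← reassoc_of% (trPow hA).τ_comp_τ_comp_d n, cyclicOp_toHomH, Paracyclic.face_last,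
      Category.assoc]
  rw [e, LinearMap.add_apply, b'_toHomH, LinearMap.smul_apply, e1,
    ← Category.assoc ((trPow hA).t (n + 1)), Paracyclic.t_comp_b, Preadditive.add_comp, map_add,
    smul_add, smul_comm ((-1 : ℤ) ^ (n + 1)), Paracyclic.c, Preadditive.zsmul_comp, map_zsmul,
    Category.assoc]
  exact add_comm _ _

end Comparison

/-! ### Maps to a stable contramodule -/

section ToTot

variable {A : Type u} [Ring A] [Algebra k A] [Module H A] [IsScalarTower k H A]
  (hS : Function.Bijective (HopfAlgebra.antipode k : H →ₗ[k] H)) (hA : IsModuleAlgebra k H A)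
  {M : AYD k H}

/-- The twist by `t` in the even columns, which accounts for the cyclic operators of the two
bicomplexes being inverse to each other. -/
noncomputable def twist (p q : ℕ) : (trPow hA).X q ⟶ (trPow hA).X q :=
  if Even p then (trPow hA).t q else 𝟙 _

/-- The sign `(-1) ^ (⌈p / 2⌉ + q (q - 1) / 2)`. -/
def twistSign (p q : ℕ) : ℤ := (-1) ^ ((p + 1) / 2 + ∑ i ∈ Finset.range q, i)

theorem twistSign_mul_self (p q : ℕ) : twistSign p q * twistSign p q = 1 := by
  rw [twistSign, ← mul_pow]
  simp

theorem twistSign_succ_right (p q : ℕ) : twistSign p (q + 1) = twistSign p q * (-1) ^ q := by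
  rw [twistSign, twistSign, Finset.sum_range_succ, ← add_assoc, pow_add _ _ q]

theorem twistSign_succ_left (p q : ℕ) :
    twistSign (p + 1) q = (if Even p then -1 else 1) * twistSign p q := by
  rw [twistSign, twistSign]
  split_ifs with h
  · obtain ⟨r, rfl⟩ := h
    rw [show (r + r + 1 + 1) / 2 = (r + r + 1) / 2 + 1 by omega, add_right_comm, pow_succ]
    ring
  · obtain ⟨r, rfl⟩ := Nat.not_even_iff_odd.1 h
    rw [show (2 * r + 1 + 1 + 1) / 2 = (2 * r + 1 + 1) / 2 by omega, one_mul]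

/-- The identification of the entries of the bicomplex of maps from the cyclic bicomplex of
`Tr(A^{⊗ (• + 1)})` to `M` with those of the cyclic bicomplex of `Hom_H(A^{⊗ (• + 1)}, M)`. -/
noncomputable def toEntry (p q : ℕ) : ((trPow hA).X q ⟶ M) →ₗ[k] HomH A M q :=
  twistSign p q • toHomH hA q ∘ₗ Linear.leftComp k M (twist hA p q)

theorem toEntry_apply (p q : ℕ) (u : (trPow hA).X q ⟶ M) :
    toEntry hA p q u = twistSign p q • toHomH hA q (twist hA p q ≫ u) := rfl

theorem toEntry_col (p q : ℕ) (u : (trPow hA).X q ⟶ M) :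
    toEntry hA p (q + 1) ((trPow hA).col p q ≫ u) =
      (if Even p then (hopfCyclicData hS M hA).b q else -(hopfCyclicData hS M hA).b' q)
        (toEntry hA p q u) := by
  rw [toEntry_apply, toEntry_apply, map_zsmul, twistSign_succ_right, mul_smul]
  congr 1
  unfold twist Paracyclic.col
  split_ifs
  · rw [b_toHomH]
  · rw [LinearMap.neg_apply, Category.id_comp, Category.id_comp, Preadditive.neg_comp, map_neg,
      b'_toHomH, smul_neg]

theorem toEntry_row (hM : M.IsStable) (p q : ℕ) (u : (trPow hA).X q ⟶ M) :
    toEntry hA (p + 1) q ((trPow hA).row p q ≫ u) =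
      (if Even p then 1 - (hopfCyclicData hS M hA).t q else (hopfCyclicData hS M hA).N q)
        (toEntry hA p q u) := by
  rw [toEntry_apply, toEntry_apply, map_zsmul, twistSign_succ_left, mul_comm, mul_smul]
  congr 1
  by_cases h : Even p
  · rw [twist, twist, Paracyclic.row, if_pos h, if_pos h, if_pos h, if_pos h,
      if_neg (by rwa [Nat.even_add_one, not_not]), Category.id_comp, LinearMap.sub_apply, t_toHomH,
      Preadditive.sub_comp, map_sub, neg_one_smul, neg_sub, Category.id_comp]
    rfl
  · rw [twist, twist, Paracyclic.row, if_neg h, if_neg h, if_neg h, if_neg h,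
      if_pos (by rwa [Nat.even_add_one]), Category.id_comp, N_toHomH hS hA hM, one_smul]

theorem toEntry_injective (hM : M.IsStable) (p q : ℕ) :
    Function.Injective (toEntry (M := M) hA p q) := by
  refine (injective_iff_map_eq_zero _).2 fun u hu => ?_
  have h : toHomH hA q (twist hA p q ≫ u) = 0 := by
    have := congrArg (twistSign p q • ·) hu
    simpa only [toEntry_apply, smul_smul, twistSign_mul_self, one_smul, smul_zero] using this
  have h := toHomH_injective q (h.trans (map_zero (toHomH hA q)).symm)
  unfold twist at h
  split_ifs at h
  · have e := iter_t_comp hA hM u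
    rwa [iter_succ, Category.assoc, h, Limits.comp_zero, eq_comm] at e
  · rwa [Category.id_comp] at h

theorem toEntry_surjective (hM : M.IsStable) (p q : ℕ) :
    Function.Surjective (toEntry (M := M) hA p q) := by
  intro f
  obtain ⟨u, rfl⟩ := toHomH_surjective (hA := hA) q f
  obtain ⟨w, hw⟩ : ∃ w, twist hA p q ≫ w = u := by
    unfold twist
    split_ifs
    · refine ⟨iter ((trPow hA).t q) q ≫ u, ?_⟩
      rw [← Category.assoc]
      refine Eq.trans ?_ (iter_t_comp hA hM u)
      exact congrArg (· ≫ u) (pow_succ (show End _ from (trPow hA).t q) q).symm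
    · exact ⟨u, Category.id_comp u⟩
  refine ⟨twistSign p q • w, ?_⟩
  rw [map_zsmul, toEntry_apply, smul_smul, twistSign_mul_self, one_smul, hw]

/-- The identification of the total complex of the bicomplex of maps from the cyclic bicomplex of
`Tr(A^{⊗ (• + 1)})` to `M` with that of the cyclic bicomplex of `Hom_H(A^{⊗ (• + 1)}, M)`. -/
noncomputable def toTot (n : ℤ) (φ : (trPow hA).Fam M n) : Tot (fun q => HomH A M q) n :=
  fun x => toEntry hA x.1.1 x.1.2 (φ x.1.1 x.1.2 x.2)

theorem toTot_famD (hM : M.IsStable) {n m : ℤ} (h : n + 1 = m) (φ : (trPow hA).Fam M n) :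
    toTot hA m (Paracyclic.famD h φ) = (hopfCyclicData hS M hA).D h (toTot hA n φ) := by
  funext x
  obtain ⟨⟨p, q⟩, hx⟩ := x
  change toEntry hA p q (Paracyclic.famVert h φ p q hx + Paracyclic.famHoriz h φ p q hx) =
    ((hopfCyclicData hS M hA).vert h ⟨(p, q), hx⟩ (toTot hA n φ) +
      (hopfCyclicData hS M hA).horiz h ⟨(p, q), hx⟩ (toTot hA n φ) : HomH A M q)
  rw [map_add]
  congr 1
  · rcases q with _ | q
    · exact map_zero _
    · exact toEntry_col hS hA p q _
  · rcases p with _ | p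
    · exact map_zero _
    · exact toEntry_row hS hA hM p q _

end ToTot

section Single

variable {M : AYD k H} (hM : M.IsStable)

/-- The part of degree `0` of a stable contramodule, regarded as a mixed one. -/
def singleZero : (MixedAYD.single M hM).cx.X 0 ⟶ M := 𝟙 M

theorem isZero_single {i : ℤ} (hi : i ≠ 0) : Limits.IsZero ((MixedAYD.single M hM).cx.X i) := by
  rcases i with (_ | i) | i
  · exact absurd rfl hi
  · exact AYD.isZero_zero
  · exact AYD.isZero_zero

variable {P : Paracyclic (AYD k H)} {hP : ∀ n, iter (P.τ n) (n + 1) = AYD.sigmaHom _}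

/-- The restriction of a cochain with values in `M` to the entries of the cyclic bicomplex. -/
noncomputable def toFam (n : ℤ) (f : Cochain (P.res hP).cx (MixedAYD.single M hM).cx n) :
    P.Fam M n := fun p q h => P.entry hP (-n) p q (by omega) ≫ f.v (-n) 0 (by omega) ≫ singleZero hM

variable {hM}

theorem toFam_add {n : ℤ} (f g : Cochain (P.res hP).cx (MixedAYD.single M hM).cx n) (p q : ℕ) (h) :
    toFam hM n (f + g) p q h = toFam hM n f p q h + toFam hM n g p q h := by
  rw [toFam, Cochain.add_v, Preadditive.add_comp, Preadditive.comp_add]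
  rfl

theorem toFam_smul {n : ℤ} (c : k) (f : Cochain (P.res hP).cx (MixedAYD.single M hM).cx n)
    (p q : ℕ) (h) : toFam hM n (c • f) p q h = c • toFam hM n f p q h := by
  rw [toFam, Cochain.smul_v, Linear.smul_comp, Linear.comp_smul]
  rfl

theorem single_h (p q : ℤ) (hpq : p + -1 = q) : (MixedAYD.single M hM).h.v p q hpq = 0 := by
  by_cases h : p = 0
  · exact (isZero_single hM (by omega)).eq_of_tgt _ _
  · exact (isZero_single hM h).eq_of_src _ _

theorem entry'_comp_eq_zero {n : ℤ} {f : Cochain (P.res hP).cx (MixedAYD.single M hM).cx n}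
    (hf : f ∈ (P.res hP).dgHom (MixedAYD.single M hM) n) (i j : ℤ) (hij : i + n = j) (p q : ℕ) (h) :
    P.entry' hP i p q h ≫ f.v i j hij = 0 := by
  have e : P.resInr hP i ≫ f.v i j hij = 0 := by
    refine ((CurvedComplex.mem_dgHom_free_iff f).1 hf i j hij).trans ?_
    exact (congrArg (n.negOnePow • ·) ((congrArg _ (single_h (j + 1) j (by omega))).trans
      Limits.comp_zero)).trans (smul_zero _)
  rw [Paracyclic.entry', Category.assoc, e, Limits.comp_zero]

theorem toFam_δ {n m : ℤ} (hm : n + 1 = m)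
    {f : Cochain (P.res hP).cx (MixedAYD.single M hM).cx n}
    (hf : f ∈ (P.res hP).dgHom (MixedAYD.single M hM) n) (p q : ℕ)
    (h : (p : ℤ) + q = m) :
    toFam hM m (δ n m f) p q h = m.negOnePow • Paracyclic.famD hm (toFam hM n f) p q h := by
  change P.entry hP (-m) p q _ ≫ (δ n m f).v (-m) 0 _ ≫ singleZero hM =
    m.negOnePow • Paracyclic.famD hm (toFam hM n f) p q h
  rw [δ_v n m hm f (-m) 0 (by omega) (-1) (-n) (by omega) (by omega),
    (isZero_single hM (show (-1 : ℤ) ≠ 0 by decide)).eq_of_src ((MixedAYD.single M hM).cx.d (-1) 0) 0,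
    Limits.comp_zero, zero_add, Linear.units_smul_comp, Linear.comp_units_smul, Category.assoc,
    Paracyclic.entry_d_comp (show -m + 1 = -n by omega)]
  congr 1
  refine Eq.trans (congrArg₂ (· - ·) ?_ ?_) (sub_zero _)
  · rcases p with _ | p <;> rcases q with _ | q <;> rfl
  · have e : ∀ p q h, P.entry' hP (-n) p q h ≫ f.v (-n) 0 (by omega) ≫ singleZero hM = 0 :=
      fun p q h => by rw [← Category.assoc, entry'_comp_eq_zero hf, Limits.zero_comp]
    rcases p with _ | _ | p
    · rfl
    · rfl
    · exact e _ _ _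

theorem toFam_injective {n : ℤ} {f : Cochain (P.res hP).cx (MixedAYD.single M hM).cx n}
    (hf : f ∈ (P.res hP).dgHom (MixedAYD.single M hM) n) (h : ∀ p q h, toFam hM n f p q h = 0) : f = 0 := by
  refine Cochain.ext _ _ fun i j hij => ?_
  by_cases hj : j = 0
  · subst hj
    obtain rfl : i = -n := by omega
    refine Paracyclic.res_ext (fun p q hpq => ?_) fun p q hpq => ?_
    · have e : P.entry hP (-n) p q hpq ≫ f.v (-n) 0 (by omega) ≫ 𝟙 _ = 0 := h p q (by omega)
      rw [Cochain.zero_v, Limits.comp_zero]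
      exact (congrArg _ (Category.comp_id _)).symm.trans e
    · rw [entry'_comp_eq_zero hf, Cochain.zero_v, Limits.comp_zero]
  · exact (isZero_single hM hj).eq_of_tgt _ _

theorem toFam_surjective {n : ℤ} (φ : P.Fam M n) :
    ∃ f ∈ (P.res hP).dgHom (MixedAYD.single M hM) n, toFam hM n f = φ := by
  let g : ∀ i j : ℤ, i + n = j → (P.tot i ⟶ (MixedAYD.single M hM).cx.X j) := fun i j hij =>
    if hj : j = 0 then Paracyclic.descTot (fun p q hpq => φ p q (by omega)) ≫
      eqToHom (by subst hj; rfl) else 0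
  refine ⟨CurvedComplex.extendCochain (C := P.curved hP) g, CurvedComplex.extendCochain_mem _, ?_⟩
  funext p q h
  have e : P.resInl hP (-n) ≫ (CurvedComplex.extendCochain (C := P.curved hP) g).v (-n) 0
      (by omega) = Paracyclic.descTot (fun p q hpq => φ p q (by omega)) ≫ 𝟙 M :=
    (CurvedComplex.restr_extendCochain (C := P.curved hP) g (-n) 0 (by omega)).trans (dif_pos rfl)
  rw [toFam, Paracyclic.entry, Category.assoc, reassoc_of% e]
  refine (congrArg (P.inc (-n) p q _ ≫ ·) ?_).trans
    (Paracyclic.inc_descTot (fun p q hpq => φ p q (by omega)) p q (by omega))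
  exact (congrArg _ (Category.comp_id _)).trans (Category.comp_id _)

end Single

section Final

variable {A : Type u} [Ring A] [Algebra k A] [Module H A] [IsScalarTower k H A]
  (hS : Function.Bijective (HopfAlgebra.antipode k : H →ₗ[k] H)) (hA : IsModuleAlgebra k H A)
  {M : AYD k H} (hM : M.IsStable)

theorem trPow_iter_eq (n : ℕ) : iter ((trPow hA).τ n) (n + 1) = AYD.sigmaHom _ :=
  AYD.hom_ext fun x => trPow_iter hA n x

/-- The semi-free resolution of the Chern character. -/
noncomputable abbrev chRes : MixedAYD k H := (trPow hA).res (trPow_iter_eq hA)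

/-- The cochains on the semi-free resolution with values in `M`, as cochains of the cyclic
bicomplex. -/
noncomputable def cochainToTot (n : ℤ) :
    Cochain (chRes hA).cx (MixedAYD.single M hM).cx n →ₗ[k] Tot (fun q => HomH A M q) n where
  toFun f := toTot hA n (toFam hM n f)
  map_add' f g := funext fun x =>
    (congrArg (toEntry hA x.1.1 x.1.2) (toFam_add f g _ _ _)).trans (map_add _ _ _)
  map_smul' c f := funext fun x =>
    (congrArg (toEntry hA x.1.1 x.1.2) (toFam_smul c f _ _ _)).trans (map_smul _ _ _)

theorem cochainToTot_δ {n m : ℤ} (hm : n + 1 = m)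
    {f : Cochain (chRes hA).cx (MixedAYD.single M hM).cx n}
    (hf : f ∈ (chRes hA).dgHom (MixedAYD.single M hM) n) :
    cochainToTot hA hM m (δ n m f) =
      m.negOnePow • (hopfCyclicData hS M hA).D hm (cochainToTot hA hM n f) := by
  refine Eq.trans ?_ (congrArg (m.negOnePow • ·) (toTot_famD hS hA hM hm _))
  exact funext fun x => (congrArg (toEntry hA x.1.1 x.1.2) (toFam_δ hm hf _ _ _)).trans
    (map_zsmul _ (m.negOnePow : ℤ) _)

theorem cochainToTot_injective {n : ℤ} {f : Cochain (chRes hA).cx (MixedAYD.single M hM).cx n}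
    (hf : f ∈ (chRes hA).dgHom (MixedAYD.single M hM) n) (h : cochainToTot hA hM n f = 0) :
    f = 0 := by
  refine toFam_injective hf fun p q hpq => ?_
  exact toEntry_injective hA hM p q ((congrFun h ⟨(p, q), hpq⟩).trans (map_zero _).symm)

theorem cochainToTot_surjective {n : ℤ} (z : Tot (fun q => HomH A M q) n) :
    ∃ f ∈ (chRes hA).dgHom (MixedAYD.single M hM) n, cochainToTot hA hM n f = z := by
  choose φ hφ using fun x : {x : ℕ × ℕ // (x.1 : ℤ) + x.2 = n} =>
    toEntry_surjective hA hM x.1.1 x.1.2 (z x)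
  obtain ⟨f, hf, e⟩ := toFam_surjective (hP := trPow_iter_eq hA) (hM := hM)
    fun p q hpq => φ ⟨(p, q), hpq⟩
  refine ⟨f, hf, (congrArg (toTot hA n) e).trans ?_⟩
  funext x
  exact hφ x

/-- The complex of maps from the semi-free resolution to `M` computes Hopf-cyclic cohomology. -/
theorem nonempty_HCold_equiv (n : ℤ) :
    Nonempty (HCold hS M hA n ≃ₗ[k] (chRes hA).HomCohomology (MixedAYD.single M hM) n) := by
  have hker : ∀ {n : ℤ} {f : Cochain (chRes hA).cx (MixedAYD.single M hM).cx n},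
      f ∈ (chRes hA).dgHom (MixedAYD.single M hM) n →
      (δ n (n + 1) f = 0 ↔ (hopfCyclicData hS M hA).D rfl (cochainToTot hA hM n f) = 0) := by
    intro n f hf
    have e := cochainToTot_δ hS hA hM rfl hf
    constructor
    · intro h
      rw [h, map_zero, eq_comm, smul_eq_zero_iff_eq] at e
      exact e
    · intro h
      rw [h, smul_zero] at e
      exact cochainToTot_injective hA hM (MixedAYD.δ_mem_dgHom rfl hf) e
  let L : (chRes hA).homCocycles (MixedAYD.single M hM) n →ₗ[k]
      LinearMap.ker ((hopfCyclicData hS M hA).D (n := n) rfl) :=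
    (cochainToTot hA hM n ∘ₗ Submodule.subtype _).codRestrict _ fun f => by
      obtain ⟨h, h'⟩ := (MixedAYD.mem_homCocycles_iff _ rfl _).1 f.2
      exact (hker h).1 h'
  have hL : Function.Bijective L := by
    constructor
    · refine (injective_iff_map_eq_zero _).2 fun f hf => Subtype.ext ?_
      exact cochainToTot_injective hA hM ((MixedAYD.mem_homCocycles_iff _ rfl _).1 f.2).1
        (congrArg Subtype.val hf)
    · rintro ⟨z, hz⟩
      obtain ⟨f, hf, rfl⟩ := cochainToTot_surjective hA hM z
      exact ⟨⟨f, (MixedAYD.mem_homCocycles_iff _ rfl _).2 ⟨hf, (hker hf).2 hz⟩⟩, rfl⟩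
  have hn : n - 1 + 1 = n := by omega
  have hL' : (((chRes hA).homCoboundaries (MixedAYD.single M hM) n).submoduleOf
      ((chRes hA).homCocycles (MixedAYD.single M hM) n)).map
        (LinearEquiv.ofBijective L hL).toLinearMap =
      (LinearMap.range ((hopfCyclicData hS M hA).D hn)).submoduleOf
        (LinearMap.ker ((hopfCyclicData hS M hA).D rfl)) := by
    ext z
    constructor
    · rintro ⟨c, hc, rfl⟩
      obtain ⟨w, hw, e⟩ := (MixedAYD.mem_homCoboundaries_iff (n - 1) hn _).1 hc
      have e1 := cochainToTot_δ hS hA hM hn hw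
      rw [e] at e1
      refine ⟨(n.negOnePow : ℤ) • cochainToTot hA hM (n - 1) w, ?_⟩
      rw [map_zsmul]
      exact e1.symm
    · rintro ⟨y, hy⟩
      obtain ⟨w, hw, e⟩ := cochainToTot_surjective hA hM ((n.negOnePow : ℤ) • y)
      have e1 := cochainToTot_δ hS hA hM hn hw
      rw [e, map_zsmul, hy] at e1
      have e2 : cochainToTot hA hM n (δ (n - 1) n w) = z.1 :=
        e1.trans ((smul_smul n.negOnePow n.negOnePow z.1).trans
          (by rw [Int.units_mul_self, one_smul]))
      have hd := MixedAYD.δ_mem_dgHom hn hw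
      refine ⟨⟨δ (n - 1) n w, (MixedAYD.mem_homCocycles_iff _ rfl _).2 ⟨hd, δ_δ _ _ _ _⟩⟩,
        (MixedAYD.mem_homCoboundaries_iff (n - 1) hn _).2 ⟨w, hw, rfl⟩, Subtype.ext e2⟩
  exact ⟨(Submodule.Quotient.equiv _ _ (LinearEquiv.ofBijective L hL) hL').symm⟩

theorem isKProjective_chRes
    (hS : Function.Bijective (HopfAlgebra.antipode k : H →ₗ[k] H)) [Module.Projective H A] : (chRes hA).IsKProjective :=
  CurvedComplex.isKProjective_free
    (fun _ => AYD.IsProj.biproduct fun x => AYD.isProj_Tr_tensor hS (Pow k H A x.1.2))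
    fun _ hi => Paracyclic.isZero_tot hi

end Final
end HopfCyclic

theorem theorem6 {k H A : Type u} [Field k] [Ring H] [HopfAlgebra k H]
    (hS : Function.Bijective (HopfAlgebra.antipode k : H →ₗ[k] H))
    [Ring A] [Algebra k A] [Module H A] [IsScalarTower k H A]
    (hA : IsModuleAlgebra k H A) [Module.Projective H A]
    (M : AYD k H) (hM : M.IsStable) :
    (∃ (P : MixedAYD k H) (π : P ⟶ ch hA), MixedAYD.IsQuasiIso π ∧ P.IsKProjective) ∧
    ∀ (P : MixedAYD k H) (π : P ⟶ ch hA), MixedAYD.IsQuasiIso π → P.IsKProjective →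
      ∀ n : ℤ, Nonempty (HCold hS M hA n ≃ₗ[k] P.HomCohomology (MixedAYD.single M hM) n) := by
  have hK := isKProjective_chRes hA hS
  have hq : MixedAYD.IsQuasiIso (Y := ch hA) ((trPow hA).aug (trPow_iter_eq hA)) :=
    Paracyclic.isQuasiIso_aug
  refine ⟨⟨chRes hA, (trPow hA).aug (trPow_iter_eq hA), hq, hK⟩, fun P π hπ hP n => ?_⟩
  obtain ⟨e⟩ := nonempty_HCold_equiv hS hA hM n
  obtain ⟨e'⟩ := MixedAYD.nonempty_homCohomology_equiv hP hK hπ hq (MixedAYD.single M hM) n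
  exact ⟨e.trans e'⟩
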